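/- **Theorem 2.** Let $d\ge 1$ and $f:\mathbb R^d\to\mathbb R$ (Euclidean norm $\|\cdot\|$) satisfy: (A1) $f$ is $C^1$; $\|\nabla f(x)\|\le L(1+\|x\|^a)$ for all $x$, with constants $a,L>0$; $f$ has a unique minimizer $x^\ast$, and $f(x)\ge f(x^\ast)+\frac\kappa2\|x-x^\ast\|^\beta$ for all $x$, with constants $\kappa>0$, $\beta\ge1$. (A2) $f$ is $C^3$, and $\lambda$-strongly convex on the open ball $B(x^\ast,\delta)$ for some $\delta,\lambda>0$. *Algorithm.* Let $\alpha,\gamma>0$, $R\ge\|x^\ast\|+\delta$, $\eta_k=\eta_0/k^\zeta$ ($k\ge1$) with $\eta_0\in(0,1]$, $\zeta\in(0,1]$, and $\mathrm{clip}_R(x)=(R\wedge\|x\|)\frac{x}{\|x\|}$ (with $\mathrm{clip}_R(0)=0$). For $n\ge1$ and $i\in\{1,\dots,n\}$, $$X^i_{k+1}=X^i_k+\eta_{k+1}\big(\mathrm{clip}_R(\theta_k)-X^i_k\big)+\sqrt{\tfrac{2\eta_{k+1}\gamma}{\alpha}}\;\xi^i_{k+1},\qquad \theta_k=\frac{\sum_{j=1}^n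 e^{-\alpha f(X^j_k)}X^j_k}{\sum_{j=1}^n e^{-\alpha f(X^j_k)}},$$ where the $\xi^i_k$ ($k\ge1$) are i.i.d. standard Gaussian vectors of $\mathbb R^d$, independent of $X_0^1,\dots,X_0^n$, which are i.i.d. of law $\nu=\mathcal N(m_0,\sigma_0^2I_d)$ with $\sigma_0^2\ge\frac{\gamma}{2\alpha}$. *Constants.* Given $\alpha_0>0$, put $c_1=(1+\frac{2}{\lambda\gamma})^{-1}$, $T_1=\frac{\log 72}{c_1}$, $C_0=6\gamma d$, $s=\sqrt{2d\gamma/\alpha_0}$, $$C_4=\sqrt{\mathbb E_{X\sim\nu}\|X\|^2\vee\big((R+s)^2+\eta_0(2d\tfrac{\gamma}{\alpha_0}+2\eta_0(R+s))\big)},\qquad C_8'=\tfrac34\exp\Big(-\alpha\sup_{y\in B(0,2C_4)}f(y)\Big),$$ $$L_0=e^{-\alpha f(x^\ast)}\sup_{x}e^{-\frac{\kappa\alpha}2\|x-x^\ast\|^\beta}(1+L\|x\|+L\|x\|^{a+1}),\qquad L_1=e^{-\alpha f(x^\ast)}\sup_{x}e^{-\frac{\kappa\alpha}2\|x-x^\ast\|^\beta}L(1+\|x\|^{a}),$$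 $$C_2'=\tfrac{16}{C_8'^2}\Big(2R^2+C_4^2+\big(\tfrac{C_4}{C_8'}\big)^2\Big)+8R^2\Big(1+\tfrac{12}{C_8'^2}\Big),\qquad C_3'=2\Big(\tfrac{L_0+4\frac{C_4}{C_8'}L_1}{C_8'}\Big)^2+\tfrac{16R^2L_1^2}{C_8'^2},$$ $$C_4'=5\Big(2\eta_0(R^2+C_4^2)+\tfrac{2d\gamma}{\alpha_0}\Big),\qquad C_5'=5\Big(\tfrac{L_0+4L_1\frac{C_4}{C_8'}}{\frac12C_8'}\Big)^2+\tfrac{240L_1^2R^2}{C_8'^2},$$ $$C_6'=R^2C_2'e^{C_3'T_1}\Big(400\big(\tfrac{L_1}{C_8'}\big)^2+20\big(\tfrac{L_1}{C_4}\big)^2\Big)+\tfrac{800R^2}{C_8'^2}+40R^2,\qquad C_7'=e^{C_5'T_1}C_4',$$ $$C_{2,\alpha}=6e^{C_3'T_1}C_2'+6e^{C_5'T_1}C_6',$$ and, for $\zeta<1$, $$C_9'=\min\Big((T_1(1-\zeta))^{\frac\zeta{1-\zeta}},\,T_1(1-\zeta),\,(1+T_1(1-\zeta))^{\frac\zeta{1-\zeta}}-1\Big)^{-1},\qquad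 c_2=2^{\frac{\eta_0}{(1-\zeta)T_1}}-1,$$ $$C_{1,\alpha}=2^{\frac{\eta_0}{(1-\zeta)T_1}+1}\Big(3\big(C_4^2+\tfrac{C_0}{\alpha_0}+\tfrac{\gamma d}{\alpha_0}\big)+C_7'\eta_0\Big),\qquad C_{3,\alpha}=C_7'\eta_0C_9'\Big(\tfrac{\eta_0}{2(1-\zeta)T_1}\Big)^{-\frac\zeta{1-\zeta}}\sum_{\ell\ge0}2^{-\ell}(\ell+1)^{\frac\zeta{1-\zeta}}.$$ *Claim.* There is a threshold $\alpha_0=\alpha_0(\gamma)>0$, depending only on $\gamma$, $f$ and the constants in (A1)–(A2), such that for all $R,\eta_0,\zeta,m_0$ as above there exist $\tilde\gamma_0>0$ and $K_0\in\mathbb N$ with the following property. For every $\gamma>\tilde\gamma_0$, $\alpha>\alpha_0(\gamma)$, $\sigma_0^2\ge\frac\gamma{2\alpha}$, $n\ge1$, $k\ge K_0$ and $i\in\{1,\dots,n\}$, $$\mathbb E\|X^i_k-x^\ast\|^2\le\frac{6C_0}{\alpha}+\frac{C_{1,\alpha}}{(1+c_2)^{k^{1-\zeta}}}+\frac{C_{2,\alpha}}{n}+\frac{C_{3,\alpha}}{k^\zeta}.$$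 If $\zeta<1$ all constants are those above; in particular $c_2$ does not depend on $\alpha$. If $\zeta=1$, where the formulas for $c_2,C_{1,\alpha},C_{3,\alpha}$ are undefined, the bound holds with $C_0$, $C_{2,\alpha}$ as above and with some $c_2>0$ not depending on $(\alpha,\sigma_0,n,k,i)$ and some $C_{1,\alpha},C_{3,\alpha}$ not depending on $(n,k,i)$. -/

import Mathlib

open MeasureTheory ProbabilityTheory

noncomputable section

namespace CBO

/-- First assumption on the objective: `f` is `C¹`, its gradient has polynomial growth, `xstar` is
its unique minimizer, and `f` grows at least like a power of the distance to `xstar`. -/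
structure GrowthAssumption {d : ℕ} (f : EuclideanSpace ℝ (Fin d) → ℝ)
    (xstar : EuclideanSpace ℝ (Fin d)) (a L κ β : ℝ) : Prop where
  contDiff : ContDiff ℝ 1 f
  a_pos : 0 < a
  L_pos : 0 < L
  norm_gradient_le : ∀ x, ‖gradient f x‖ ≤ L * (1 + ‖x‖ ^ a)
  isMin : ∀ x, f xstar ≤ f x
  isMin_unique : ∀ y, (∀ x, f y ≤ f x) → y = xstar
  κ_pos : 0 < κ
  one_le_β : 1 ≤ β
  growth : ∀ x, f xstar + κ / 2 * ‖x - xstar‖ ^ β ≤ f x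

/-- Second assumption on the objective: `f` is `C³` and `lam`-strongly convex on the open ball
`B(xstar, δ)`. -/
structure LocalConvexityAssumption {d : ℕ} (f : EuclideanSpace ℝ (Fin d) → ℝ)
    (xstar : EuclideanSpace ℝ (Fin d)) (δ lam : ℝ) : Prop where
  contDiff : ContDiff ℝ 3 f
  δ_pos : 0 < δ
  lam_pos : 0 < lam
  strongConvexOn : StrongConvexOn (Metric.ball xstar δ) lam f

/-- Step sizes `η_k = η₀ / k ^ ζ` (used for `k ≥ 1`). -/
def stepSize (η₀ ζ : ℝ) (k : ℕ) : ℝ := η₀ / (k : ℝ) ^ ζ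

/-- `clip_R x = (R ∧ ‖x‖) x / ‖x‖`, with value `0` at `x = 0`. -/
def clip {d : ℕ} (R : ℝ) (x : EuclideanSpace ℝ (Fin d)) : EuclideanSpace ℝ (Fin d) :=
  (min R ‖x‖ / ‖x‖) • x

/-- The consensus point of the positions `x 1, …, x n`: their mean with weights
proportional to `exp (-α f (x i))`. -/
def consensus {d n : ℕ} (f : EuclideanSpace ℝ (Fin d) → ℝ) (α : ℝ)
    (x : Fin n → EuclideanSpace ℝ (Fin d)) : EuclideanSpace ℝ (Fin d) :=
  (∑ i, Real.exp (-α * f (x i)))⁻¹ • ∑ i, Real.exp (-α * f (x i)) • x i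

/-- The isotropic Gaussian law `N(m, σ² I_d)`. -/
def isoGaussian {d : ℕ} (m : EuclideanSpace ℝ (Fin d)) (σ : ℝ) :
    Measure (EuclideanSpace ℝ (Fin d)) :=
  multivariateGaussian m (σ ^ 2 • (1 : Matrix (Fin d) (Fin d) ℝ))

/-- `X` is the `n`-particle clipped CBO algorithm driven by the noise `ξ` (of which only the
`ξ k i` with `k ≥ 1` are used) and started from i.i.d. particles of law `ν`:
`X_{k+1}^i = X_k^i + η_{k+1} (clip_R θ_k - X_k^i) + √(2 η_{k+1} γ / α) ξ_{k+1}^i`. -/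
structure IsClippedCBO {d n : ℕ} {Ω : Type*} [MeasurableSpace Ω] (P : Measure Ω)
    (f : EuclideanSpace ℝ (Fin d) → ℝ) (R α γ η₀ ζ : ℝ)
    (ν : Measure (EuclideanSpace ℝ (Fin d)))
    (X ξ : ℕ → Fin n → Ω → EuclideanSpace ℝ (Fin d)) : Prop where
  law_init : ∀ i, HasLaw (X 0 i) ν P
  law_noise : ∀ k i, HasLaw (ξ (k + 1) i) (stdGaussian (EuclideanSpace ℝ (Fin d))) P
  /-- The initial positions and all the noise vectors are mutually independent. -/
  indep : iIndepFun
    (Sum.elim (fun i : Fin n => X 0 i) (fun p : ℕ × Fin n => ξ (p.1 + 1) p.2)) P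
  step : ∀ k i ω, X (k + 1) i ω = X k i ω
    + stepSize η₀ ζ (k + 1) • (clip R (consensus f α (fun j => X k j ω)) - X k i ω)
    + √(2 * stepSize η₀ ζ (k + 1) * γ / α) • ξ (k + 1) i ω

/-! ### The explicit constants -/

/-- `c₁ = (1 + 2 / (λ γ))⁻¹`. -/
def c₁ (lam γ : ℝ) : ℝ := (1 + 2 / (lam * γ))⁻¹

/-- The block length `T₁ = log 72 / c₁`. -/
def T₁ (lam γ : ℝ) : ℝ := 1 / c₁ lam γ * Real.log 72

/-- The rate `c₂ = 2 ^ (η₀ / ((1 - ζ) T₁)) - 1`, meaningful for `ζ < 1`. -/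
def c₂ (lam γ η₀ ζ : ℝ) : ℝ := (2 : ℝ) ^ (η₀ / ((1 - ζ) * T₁ lam γ)) - 1

/-- The data on which the constants depend. -/
structure Data (d : ℕ) where
  f : EuclideanSpace ℝ (Fin d) → ℝ
  xstar : EuclideanSpace ℝ (Fin d)
  a : ℝ
  L : ℝ
  κ : ℝ
  β : ℝ
  lam : ℝ
  R : ℝ
  η₀ : ℝ
  ζ : ℝ
  γ : ℝ
  α₀ : ℝ
  α : ℝ
  /-- the initial law -/
  ν : Measure (EuclideanSpace ℝ (Fin d))

namespace Data

variable {d : ℕ} (D : Data d)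

/-- `C₀ = 6 γ d`. -/
def C₀ : ℝ := 6 * D.γ * d

/-- `C₄`, the bound on the second moments. -/
def C₄ : ℝ :=
  √(max (∫ x, ‖x‖ ^ 2 ∂D.ν)
    ((D.R + √(2 * (d * D.γ / D.α₀))) ^ 2
      + D.η₀ * (2 * d * (D.γ / D.α₀) + 2 * D.η₀ * (D.R + √(2 * (d * D.γ / D.α₀))))))

/-- `L_{0,α}`. -/
def L₀ : ℝ :=
  Real.exp (-D.α * D.f D.xstar) *
    ⨆ x : EuclideanSpace ℝ (Fin d),
      Real.exp (-(D.κ * D.α / 2) * ‖x - D.xstar‖ ^ D.β)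
        * (1 + D.L * ‖x‖ + D.L * ‖x‖ ^ (D.a + 1))

/-- `L_{1,α}`. -/
def L₁ : ℝ :=
  Real.exp (-D.α * D.f D.xstar) *
    ⨆ x : EuclideanSpace ℝ (Fin d),
      Real.exp (-(D.κ * D.α / 2) * ‖x - D.xstar‖ ^ D.β) * (D.L * (1 + ‖x‖ ^ D.a))

/-- `C^int_{8,α}`. -/
def Cint₈ : ℝ :=
  3 / 4 * Real.exp (-D.α * ⨆ y : Metric.ball (0 : EuclideanSpace ℝ (Fin d)) (2 * D.C₄), D.f y)

/-- `C^int_{2,α}`. -/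
def Cint₂ : ℝ :=
  16 / D.Cint₈ ^ 2 * (2 * D.R ^ 2 + D.C₄ ^ 2 + (D.C₄ / D.Cint₈) ^ 2)
    + 8 * D.R ^ 2 * (1 + 12 / D.Cint₈ ^ 2)

/-- `C^int_{3,α}`. -/
def Cint₃ : ℝ :=
  2 * ((D.L₀ + 4 * (D.C₄ / D.Cint₈) * D.L₁) / D.Cint₈) ^ 2
    + 16 * D.R ^ 2 * D.L₁ ^ 2 / D.Cint₈ ^ 2

/-- `C^int_4`. -/
def Cint₄ : ℝ :=
  5 * (2 * D.η₀ * (D.R ^ 2 + D.C₄ ^ 2) + 2 * (d * D.γ / D.α₀))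

/-- `C^int_{5,α}`. -/
def Cint₅ : ℝ :=
  5 * ((D.L₀ + 4 * D.L₁ * (D.C₄ / D.Cint₈)) / (1 / 2 * D.Cint₈)) ^ 2
    + 240 * D.L₁ ^ 2 * D.R ^ 2 / D.Cint₈ ^ 2

/-- `C^int_{6,α,T}`. -/
def Cint₆ (T : ℝ) : ℝ :=
  D.R ^ 2 * D.Cint₂ * Real.exp (D.Cint₃ * T)
      * (400 * (D.L₁ / D.Cint₈) ^ 2 + 20 * (D.L₁ / D.C₄) ^ 2)
    + 800 * D.R ^ 2 / D.Cint₈ ^ 2 + 40 * D.R ^ 2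

/-- `C^int_{7,α}`. -/
def Cint₇ : ℝ := Real.exp (D.Cint₅ * T₁ D.lam D.γ) * D.Cint₄

/-- `C^int_9`, meaningful for `ζ < 1`. -/
def Cint₉ : ℝ :=
  (min (min ((T₁ D.lam D.γ * (1 - D.ζ)) ^ (D.ζ / (1 - D.ζ))) (T₁ D.lam D.γ * (1 - D.ζ)))
    ((1 + T₁ D.lam D.γ * (1 - D.ζ)) ^ (D.ζ / (1 - D.ζ)) - 1))⁻¹

/-- `C_{1,α}`, meaningful for `ζ < 1`. -/
def C₁ : ℝ :=
  (2 : ℝ) ^ (D.η₀ / ((1 - D.ζ) * T₁ D.lam D.γ) + 1)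
    * (3 * (D.C₄ ^ 2 + D.C₀ / D.α₀ + D.γ * d / D.α₀) + D.Cint₇ * D.η₀)

/-- `C_{2,α}`. -/
def C₂ : ℝ :=
  6 * Real.exp (D.Cint₃ * T₁ D.lam D.γ) * D.Cint₂
    + 6 * Real.exp (D.Cint₅ * T₁ D.lam D.γ) * D.Cint₆ (T₁ D.lam D.γ)

/-- `C_{3,α}`, meaningful for `ζ < 1`. -/
def C₃ : ℝ :=
  D.Cint₇ * D.η₀ * D.Cint₉
    * (D.η₀ / (2 * (1 - D.ζ) * T₁ D.lam D.γ)) ^ (-(D.ζ / (1 - D.ζ)))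
    * ∑' l : ℕ, ((2 : ℝ) ^ l)⁻¹ * ((l : ℝ) + 1) ^ (D.ζ / (1 - D.ζ))

end Data

end CBO

end

/-! All particles share one drift, and the noise is additive and independent of the state. Hence `X
k i = M k + G k i`, where `M k` is a common `drift` and the fluctuations `G k i` (`fluct`) are
independent over `i`, centered Gaussian, with deterministic variance `varSeq`; this variance never
falls below γ/(2α) (`le_varSeq`). Clipping keeps `M k` in the ball of radius max(R, ‖m₀‖). The
consensus point is thus a Gibbs-weighted mean of a Gaussian sample translated by `M k`; as `M k`
depends on the sample, the law of large numbers has to be uniform over translations.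

Mean-field estimate (`exists_gibbs_mean_le`): under the probability proportional to exp(-αf) N(m, v
I), integration by parts against x - x* shows that α ∇f·(x - x*) + (x - m)·(x - x*)/v has mean d.
Strong convexity bounds ∇f·(x - x*) from below near x*, the complement of the ball is negligible
when γ is large compared with ‖m‖² (`exists_tail_le`), and Cauchy–Schwarz leaves a quadratic
inequality for the mean distance to x*. It is at most q‖m - x*‖ + b, with q = 1/(1 + λγ/4) and b² =
4d/(αλ).

Empirical estimate (`exists_bad_event`): Chebyshev's inequality on a grid of translations and
Lipschitz bounds transfer this, with 2b for b, to the consensus point outside an event of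
probability O(1/n), on which clipping still gives the bound 2R.

Squaring one step then contracts E‖M k - x*‖² by 1 - 3η/4 (`IsClippedCBO.second_moment_le`), without
coupling or Grönwall argument. The terms in b² and in the limiting variance add up to 6C₀/α, the bad
events give C₂/n, and the initial error is multiplied by the product of the factors 1 - 3η/4.

What remains is to compare constants. The law of large numbers costs a polynomial in `gap`, the
oscillation of the weight, whereas C₂ contains an exponential of it; the product decays faster than
(1 + c₂)^(-k^(1-ζ)); C₃ only has to be nonnegative. -/

open MeasureTheory ProbabilityTheory

noncomputable section

namespace CBO

section

variable {d : ℕ}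

/-! ### Functions of polynomial growth -/

/-- A continuous function bounded by a power of `1 + ‖x‖`. -/
structure HasPolyGrowth (g : EuclideanSpace ℝ (Fin d) → ℝ) : Prop where
  continuous : Continuous g
  bound : ∃ (C : ℝ) (p : ℕ), 0 ≤ C ∧ ∀ x, |g x| ≤ C * (1 + ‖x‖) ^ p

namespace HasPolyGrowth

variable {g h : EuclideanSpace ℝ (Fin d) → ℝ}

lemma of_bounded (hg : Continuous g) {C : ℝ} (h : ∀ x, |g x| ≤ C) : HasPolyGrowth g :=
  ⟨hg, C, 0, (abs_nonneg _).trans (h 0), by simpa using h⟩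

lemma const (c : ℝ) : HasPolyGrowth (fun _ : EuclideanSpace ℝ (Fin d) => c) :=
  of_bounded continuous_const (C := |c|) fun _ => le_rfl

lemma norm : HasPolyGrowth (fun x : EuclideanSpace ℝ (Fin d) => ‖x‖) :=
  ⟨continuous_norm, 1, 1, zero_le_one, fun x => by
    rw [abs_of_nonneg (norm_nonneg x)]; linarith⟩

lemma add (hg : HasPolyGrowth g) (hh : HasPolyGrowth h) : HasPolyGrowth (fun x => g x + h x) := by
  obtain ⟨C, p, hC, hg'⟩ := hg.bound
  obtain ⟨C', p', hC', hh'⟩ := hh.bound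
  refine ⟨hg.continuous.add hh.continuous, C + C', p + p', by positivity, fun x => ?_⟩
  have h1 : 1 ≤ 1 + ‖x‖ := by linarith [norm_nonneg x]
  have e1 : (1 + ‖x‖) ^ p ≤ (1 + ‖x‖) ^ (p + p') := pow_le_pow_right₀ h1 (by omega)
  have e2 : (1 + ‖x‖) ^ p' ≤ (1 + ‖x‖) ^ (p + p') := pow_le_pow_right₀ h1 (by omega)
  calc |g x + h x| ≤ |g x| + |h x| := abs_add_le _ _
    _ ≤ C * (1 + ‖x‖) ^ p + C' * (1 + ‖x‖) ^ p' := add_le_add (hg' x) (hh' x)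
    _ ≤ C * (1 + ‖x‖) ^ (p + p') + C' * (1 + ‖x‖) ^ (p + p') := by gcongr
    _ = _ := by ring

lemma mul (hg : HasPolyGrowth g) (hh : HasPolyGrowth h) : HasPolyGrowth (fun x => g x * h x) := by
  obtain ⟨C, p, hC, hg'⟩ := hg.bound
  obtain ⟨C', p', hC', hh'⟩ := hh.bound
  refine ⟨hg.continuous.mul hh.continuous, C * C', p + p', by positivity, fun x => ?_⟩
  calc |g x * h x| = |g x| * |h x| := abs_mul _ _
    _ ≤ (C * (1 + ‖x‖) ^ p) * (C' * (1 + ‖x‖) ^ p') :=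
      mul_le_mul (hg' x) (hh' x) (abs_nonneg _) (by positivity)
    _ = _ := by ring

lemma mono (hg : HasPolyGrowth g) (hh : Continuous h) (H : ∀ x, |h x| ≤ g x) :
    HasPolyGrowth h := by
  obtain ⟨C, p, hC, hg'⟩ := hg.bound
  exact ⟨hh, C, p, hC, fun x => (H x).trans ((le_abs_self _).trans (hg' x))⟩

lemma norm_sub (y : EuclideanSpace ℝ (Fin d)) : HasPolyGrowth (fun x => ‖x - y‖) :=
  (norm.add (const ‖y‖)).mono (by fun_prop) fun x => by
    rw [abs_of_nonneg (norm_nonneg _)]; exact norm_sub_le _ _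

lemma norm_rpow {a : ℝ} (ha : 0 ≤ a) :
    HasPolyGrowth (fun x : EuclideanSpace ℝ (Fin d) => ‖x‖ ^ a) := by
  refine ⟨continuous_norm.rpow_const fun x => Or.inr ha, 1, ⌈a⌉₊, zero_le_one, fun x => ?_⟩
  rw [abs_of_nonneg (by positivity), one_mul, ← Real.rpow_natCast]
  calc ‖x‖ ^ a ≤ (1 + ‖x‖) ^ a := by gcongr; linarith
    _ ≤ (1 + ‖x‖) ^ (⌈a⌉₊ : ℝ) :=
      Real.rpow_le_rpow_of_exponent_le (by linarith [norm_nonneg x]) (Nat.le_ceil a)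

end HasPolyGrowth

/-- Stretched exponential decay of exponent at least one beats polynomial growth. -/
lemma exists_exp_neg_mul_pow_le {c β : ℝ} (hc : 0 < c) (hβ : 1 ≤ β)
    (y : EuclideanSpace ℝ (Fin d)) (p : ℕ) :
    ∃ C : ℝ, 0 < C ∧ ∀ x, Real.exp (-c * ‖x - y‖ ^ β) * (1 + ‖x‖) ^ p ≤ C := by
  have hlim := tendsto_rpow_mul_exp_neg_mul_atTop_nhds_zero (p : ℝ) c hc
  have hev : ∀ᶠ u : ℝ in Filter.atTop, u ^ (p : ℝ) * Real.exp (-c * u) < 1 :=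
    hlim.eventually (gt_mem_nhds one_pos)
  obtain ⟨N, hN⟩ := Filter.eventually_atTop.1 hev
  -- The entry 1 serves beyond `N`, the crude power of `N` below it.
  set K : ℝ := max 1 (max N 1 ^ p)
  have hK : ∀ u : ℝ, 1 ≤ u → u ^ p * Real.exp (-c * u) ≤ K := by
    intro u hu
    rcases le_total N u with h | h
    · have := (hN u h).le
      rw [Real.rpow_natCast] at this
      exact this.trans (le_max_left _ _)
    · calc u ^ p * Real.exp (-c * u) ≤ u ^ p * 1 := by
            gcongr
            exact Real.exp_le_one_iff.2 (by nlinarith)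
        _ ≤ (max N 1) ^ p := by
            rw [mul_one]; gcongr; exact h.trans (le_max_left _ _)
        _ ≤ K := le_max_right _ _
  refine ⟨Real.exp (c * (‖y‖ + 2)) * K, by positivity, fun x => ?_⟩
  -- Since β ≥ 1, t ^ β ≥ t - 1 for t ≥ 0, which reduces the claim to an ordinary exponential.
  have h1 : ‖x‖ - ‖y‖ - 1 ≤ ‖x - y‖ ^ β := by
    have h2 : ‖x‖ - ‖y‖ ≤ ‖x - y‖ := norm_sub_norm_le x y
    rcases le_total 1 ‖x - y‖ with h | h
    · have := Real.self_le_rpow_of_one_le h hβ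
      linarith
    · have : 0 ≤ ‖x - y‖ ^ β := by positivity
      linarith
  have h2 : Real.exp (-c * ‖x - y‖ ^ β)
      ≤ Real.exp (c * (‖y‖ + 2)) * Real.exp (-c * (1 + ‖x‖)) := by
    rw [← Real.exp_add]
    refine Real.exp_le_exp.2 ?_
    nlinarith
  calc Real.exp (-c * ‖x - y‖ ^ β) * (1 + ‖x‖) ^ p
      ≤ Real.exp (c * (‖y‖ + 2)) * Real.exp (-c * (1 + ‖x‖)) * (1 + ‖x‖) ^ p := by gcongr
    _ = Real.exp (c * (‖y‖ + 2)) * ((1 + ‖x‖) ^ p * Real.exp (-c * (1 + ‖x‖))) := by ring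
    _ ≤ _ := by
      gcongr
      exact hK _ (by linarith [norm_nonneg x])

lemma HasPolyGrowth.exists_exp_neg_mul_le {g : EuclideanSpace ℝ (Fin d) → ℝ}
    (hg : HasPolyGrowth g) {c β : ℝ} (hc : 0 < c) (hβ : 1 ≤ β) (y : EuclideanSpace ℝ (Fin d)) :
    ∃ C : ℝ, 0 < C ∧ ∀ x, Real.exp (-c * ‖x - y‖ ^ β) * |g x| ≤ C := by
  obtain ⟨A, p, hA, h⟩ := hg.bound
  obtain ⟨C, hC, h'⟩ := exists_exp_neg_mul_pow_le hc hβ y p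
  refine ⟨A * C + 1, by positivity, fun x => ?_⟩
  calc Real.exp (-c * ‖x - y‖ ^ β) * |g x|
      ≤ Real.exp (-c * ‖x - y‖ ^ β) * (A * (1 + ‖x‖) ^ p) := by gcongr; exact h x
    _ = A * (Real.exp (-c * ‖x - y‖ ^ β) * (1 + ‖x‖) ^ p) := by ring
    _ ≤ A * C := by gcongr; exact h' x
    _ ≤ _ := by linarith

lemma HasPolyGrowth.integrable_exp_neg_mul {g : EuclideanSpace ℝ (Fin d) → ℝ}
    (hg : HasPolyGrowth g) {c β : ℝ} (hc : 0 < c) (hβ : 1 ≤ β) (y : EuclideanSpace ℝ (Fin d)) :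
    Integrable (fun x => Real.exp (-c * ‖x - y‖ ^ β) * g x) := by
  -- The exponential also absorbs this factor, which leaves the integrable majorant (1 +
  -- ‖x‖)^(-(d+1)).
  have hp : HasPolyGrowth (fun x : EuclideanSpace ℝ (Fin d) => (1 + ‖x‖) ^ (d + 1)) :=
    ⟨by fun_prop, 1, d + 1, zero_le_one, fun x => by
      rw [abs_of_nonneg (by positivity), one_mul]⟩
  obtain ⟨C, hC, h⟩ := (hg.mul hp).exists_exp_neg_mul_le hc hβ y
  have hint : Integrable (fun x : EuclideanSpace ℝ (Fin d) =>
      C * (1 + ‖x‖) ^ (-((d : ℝ) + 1))) :=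
    (integrable_one_add_norm (by simp)).const_mul C
  have hcont : Continuous (fun x => Real.exp (-c * ‖x - y‖ ^ β) * g x) := by
    have := hg.continuous
    have h2 : Continuous fun x : EuclideanSpace ℝ (Fin d) => ‖x - y‖ ^ β :=
      (continuous_id.sub continuous_const).norm.rpow_const fun x => Or.inr (by linarith)
    fun_prop
  refine hint.mono' hcont.aestronglyMeasurable (Filter.Eventually.of_forall fun x => ?_)
  have hx := h x
  have h0 : 0 < 1 + ‖x‖ := by positivity
  rw [abs_mul, abs_of_nonneg (by positivity : 0 ≤ (1 + ‖x‖) ^ (d + 1)), ← mul_assoc] at hx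
  rw [Real.rpow_neg h0.le, ← div_eq_mul_inv, le_div_iff₀ (by positivity), norm_mul,
    Real.norm_eq_abs, Real.norm_eq_abs, abs_of_pos (Real.exp_pos _)]
  exact_mod_cast hx

/-! ### The Gibbs weight -/

/-- The Gibbs weight `exp (-α (f x - f xstar))`, normalized to be `1` at the minimizer. -/
def weight (f : EuclideanSpace ℝ (Fin d) → ℝ) (xstar : EuclideanSpace ℝ (Fin d)) (α : ℝ)
    (x : EuclideanSpace ℝ (Fin d)) : ℝ := Real.exp (-α * (f x - f xstar))

variable {f : EuclideanSpace ℝ (Fin d) → ℝ} {xstar : EuclideanSpace ℝ (Fin d)}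
  {a L κ β δ lam α : ℝ}

lemma weight_pos (x : EuclideanSpace ℝ (Fin d)) : 0 < weight f xstar α x := Real.exp_pos _

namespace GrowthAssumption

variable (hf : GrowthAssumption f xstar a L κ β)
include hf

lemma weight_le_one (hα : 0 ≤ α) (x : EuclideanSpace ℝ (Fin d)) : weight f xstar α x ≤ 1 :=
  Real.exp_le_one_iff.2 (by nlinarith [hf.isMin x])

lemma weight_le_exp (hα : 0 ≤ α) (x : EuclideanSpace ℝ (Fin d)) :
    weight f xstar α x ≤ Real.exp (-(κ * α / 2) * ‖x - xstar‖ ^ β) :=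
  Real.exp_le_exp.2 (by nlinarith [hf.growth x])

/-- Lowering α to 1 gives a majorant that makes the later constants uniform in α. -/
lemma weight_le (hα : 1 ≤ α) (x : EuclideanSpace ℝ (Fin d)) :
    weight f xstar α x ≤ Real.exp (-(κ / 2) * ‖x - xstar‖ ^ β) := by
  refine (hf.weight_le_exp (by linarith) x).trans (Real.exp_le_exp.2 ?_)
  have := hf.κ_pos
  have h : 0 ≤ ‖x - xstar‖ ^ β := by positivity
  have h2 : 0 ≤ κ / 2 * ‖x - xstar‖ ^ β := by positivity
  nlinarith

lemma continuous_weight : Continuous (weight f xstar α) := by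
  have := hf.contDiff.continuous
  unfold weight
  fun_prop

lemma integrable_weight_mul {g : EuclideanSpace ℝ (Fin d) → ℝ} (hg : HasPolyGrowth g)
    (hα : 1 ≤ α) : Integrable (fun x => weight f xstar α x * g x) := by
  have hκ := hf.κ_pos
  refine ((hg.mul (HasPolyGrowth.const 1)).integrable_exp_neg_mul
    (c := κ / 2) (by positivity) hf.one_le_β xstar).norm.mono'
    (hf.continuous_weight.mul hg.continuous).aestronglyMeasurable
    (Filter.Eventually.of_forall fun x => ?_)
  rw [norm_mul, norm_mul, mul_one, Real.norm_of_nonneg (weight_pos x).le,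
    Real.norm_of_nonneg (Real.exp_pos _).le]
  gcongr
  exact hf.weight_le hα x

lemma hasPolyGrowth_bound : HasPolyGrowth (fun x : EuclideanSpace ℝ (Fin d) => L * (1 + ‖x‖ ^ a)) :=
  (HasPolyGrowth.const L).mul ((HasPolyGrowth.const 1).add (HasPolyGrowth.norm_rpow hf.a_pos.le))

lemma norm_fderiv_le (x : EuclideanSpace ℝ (Fin d)) : ‖fderiv ℝ f x‖ ≤ L * (1 + ‖x‖ ^ a) := by
  have := hf.norm_gradient_le x
  rwa [gradient, LinearIsometryEquiv.norm_map] at this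

lemma differentiable : Differentiable ℝ f := hf.contDiff.differentiable (by simp)

lemma continuous_fderiv : Continuous (fderiv ℝ f) := hf.contDiff.continuous_fderiv (by simp)

lemma hasPolyGrowth_fderiv {h : EuclideanSpace ℝ (Fin d) → EuclideanSpace ℝ (Fin d)}
    (hc : Continuous h) (hh : HasPolyGrowth fun x => ‖h x‖) :
    HasPolyGrowth (fun x => fderiv ℝ f x (h x)) := by
  refine (hf.hasPolyGrowth_bound.mul hh).mono (hf.continuous_fderiv.clm_apply hc) fun x => ?_
  refine ((fderiv ℝ f x).le_opNorm (h x)).trans ?_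
  gcongr
  exact hf.norm_fderiv_le x

lemma hasFDerivAt_weight (x : EuclideanSpace ℝ (Fin d)) :
    HasFDerivAt (weight f xstar α) (weight f xstar α x • (-α • fderiv ℝ f x)) x := by
  have h := ((hf.differentiable x).hasFDerivAt.sub_const (f xstar)).const_mul (-α)
  exact h.exp

end GrowthAssumption

/-- The radial derivative at a point of the ball of strong convexity. -/
lemma LocalConvexityAssumption.le_fderiv_radial
    (hf : GrowthAssumption f xstar a L κ β)
    (hf' : LocalConvexityAssumption f xstar δ lam) {x : EuclideanSpace ℝ (Fin d)}
    (hx : ‖x - xstar‖ < δ) :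
    lam / 2 * ‖x - xstar‖ ^ 2 ≤ fderiv ℝ f x (x - xstar) := by
  have hder : HasDerivAt (fun t : ℝ => f (x + t • (xstar - x)))
      (fderiv ℝ f x (xstar - x)) 0 := by
    have h1 : HasDerivAt (fun t : ℝ => x + t • (xstar - x)) (xstar - x) 0 := by
      simpa using ((hasDerivAt_id (0 : ℝ)).smul_const (xstar - x)).const_add x
    have h2 : HasFDerivAt f (fderiv ℝ f x) (x + (0 : ℝ) • (xstar - x)) := by
      simpa using (hf.differentiable x).hasFDerivAt
    exact h2.comp_hasDerivAt 0 h1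
  have key : fderiv ℝ f x (xstar - x) ≤ -(lam / 2 * ‖x - xstar‖ ^ 2) := by
    have hslope := hder.tendsto_slope_zero_right
    -- Strong convexity between `x` and `xstar`, with `f xstar ≤ f x`, bounds the difference
    -- quotients by this function of t; then t tends to 0.
    have hlim : Filter.Tendsto (fun t : ℝ => -(lam / 2 * (1 - t) * ‖x - xstar‖ ^ 2))
        (nhdsWithin 0 (Set.Ioi 0)) (nhds (-(lam / 2 * ‖x - xstar‖ ^ 2))) := by
      have : Continuous (fun t : ℝ => -(lam / 2 * (1 - t) * ‖x - xstar‖ ^ 2)) := by fun_prop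
      simpa using (this.tendsto 0).mono_left nhdsWithin_le_nhds
    refine le_of_tendsto_of_tendsto hslope hlim ?_
    filter_upwards [Ioo_mem_nhdsGT (zero_lt_one' ℝ)] with t ht
    have hxb : x ∈ Metric.ball xstar δ := by simpa [dist_eq_norm] using hx
    have hsc := hf'.strongConvexOn.2 hxb (Metric.mem_ball_self hf'.δ_pos)
      (by linarith [ht.2] : 0 ≤ 1 - t) ht.1.le (by ring)
    have e : (1 - t) • x + t • xstar = x + t • (xstar - x) := by module
    rw [e] at hsc
    simp only [smul_eq_mul] at hsc
    have hmin := hf.isMin x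
    have ht0 := ht.1
    rw [zero_add, zero_smul, add_zero, smul_eq_mul, inv_mul_le_iff₀ ht0]
    nlinarith
  have : fderiv ℝ f x (x - xstar) = - fderiv ℝ f x (xstar - x) := by
    rw [← map_neg, neg_sub]
  linarith

end

section

variable {d : ℕ}

/-! ### Contraction of the mean-field consensus point -/

/-- The unnormalized density of `N(m, v I_d)`. -/
def gaussKernel (m : EuclideanSpace ℝ (Fin d)) (v : ℝ) (x : EuclideanSpace ℝ (Fin d)) : ℝ :=
  Real.exp (-‖x - m‖ ^ 2 / (2 * v))

lemma gaussKernel_pos (m : EuclideanSpace ℝ (Fin d)) (v : ℝ) (x : EuclideanSpace ℝ (Fin d)) :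
    0 < gaussKernel m v x := Real.exp_pos _

lemma gaussKernel_le_one (m : EuclideanSpace ℝ (Fin d)) {v : ℝ} (hv : 0 < v)
    (x : EuclideanSpace ℝ (Fin d)) : gaussKernel m v x ≤ 1 := by
  refine Real.exp_le_one_iff.2 ?_
  rw [neg_div]
  exact neg_nonpos.2 (by positivity)

lemma continuous_gaussKernel (m : EuclideanSpace ℝ (Fin d)) (v : ℝ) :
    Continuous (gaussKernel m v) := by
  unfold gaussKernel
  fun_prop

lemma hasPolyGrowth_gaussKernel (m : EuclideanSpace ℝ (Fin d)) {v : ℝ} (hv : 0 < v) :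
    HasPolyGrowth (gaussKernel m v) :=
  HasPolyGrowth.of_bounded (continuous_gaussKernel m v) (C := 1) fun x => by
    rw [abs_of_pos (gaussKernel_pos m v x)]; exact gaussKernel_le_one m hv x

lemma hasFDerivAt_gaussKernel (m : EuclideanSpace ℝ (Fin d)) (v : ℝ)
    (x : EuclideanSpace ℝ (Fin d)) :
    HasFDerivAt (gaussKernel m v) (gaussKernel m v x • (-(1 / v) • innerSL ℝ (x - m))) x := by
  have h1 : HasFDerivAt (fun x => ‖x - m‖ ^ 2) (2 • innerSL ℝ (x - m)) x := by
    simpa using ((hasFDerivAt_id x).sub_const m).norm_sq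
  have h2 := (h1.const_mul (-(1 / (2 * v)))).exp
  have e1 : gaussKernel m v = fun x => Real.exp (-(1 / (2 * v)) * ‖x - m‖ ^ 2) := by
    funext x; unfold gaussKernel; congr 1; ring
  have e2 : -(1 / (2 * v)) • (2 • innerSL ℝ (x - m)) = -(1 / v) • innerSL ℝ (x - m) := by
    ext y
    simp
    ring
  rw [e1]
  rw [e2] at h2
  exact h2

/-- Integration by parts against the radial vector field. -/
lemma integral_fderiv_radial (y : EuclideanSpace ℝ (Fin d)) {φ : EuclideanSpace ℝ (Fin d) → ℝ}
    (hφ : Differentiable ℝ φ) (hint : Integrable φ)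
    (h1 : ∀ i, Integrable fun x => φ x * (x - y) i)
    (h2 : ∀ i, Integrable fun x => fderiv ℝ φ x (EuclideanSpace.single i 1) * (x - y) i) :
    ∫ x, fderiv ℝ φ x (x - y) = -(d * ∫ x, φ x) := by
  have hdec : ∀ x, fderiv ℝ φ x (x - y)
      = ∑ i, fderiv ℝ φ x (EuclideanSpace.single i 1) * (x - y) i := by
    intro x
    conv_lhs => rw [← (EuclideanSpace.basisFun (Fin d) ℝ).sum_repr (x - y)]
    simp [map_sum, mul_comm]
  have hone : ∀ i x, fderiv ℝ (fun x : EuclideanSpace ℝ (Fin d) => (x - y) i) x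
      (EuclideanSpace.single i 1) = 1 := by
    intro i x
    have : HasFDerivAt (fun x : EuclideanSpace ℝ (Fin d) => (x - y) i)
        (EuclideanSpace.proj i : EuclideanSpace ℝ (Fin d) →L[ℝ] ℝ) x := by
      simpa using (EuclideanSpace.proj i : EuclideanSpace ℝ (Fin d) →L[ℝ] ℝ).hasFDerivAt.sub_const
        (y i)
    rw [this.fderiv]
    simp
  have hpart : ∀ i, ∫ x, fderiv ℝ φ x (EuclideanSpace.single i 1) * (x - y) i = -∫ x, φ x := by
    intro i
    have := integral_mul_fderiv_eq_neg_fderiv_mul_of_integrable (μ := volume)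
      (f := φ) (g := fun x => (x - y) i) (v := EuclideanSpace.single i 1) (h2 i)
      (by simpa only [hone, mul_one] using hint) (h1 i) (fun x _ => hφ x)
      (fun x _ => by fun_prop)
    simp only [hone, mul_one] at this
    rw [this, neg_neg]
  simp only [hdec]
  rw [integral_finsetSum _ fun i _ => h2 i, Finset.sum_congr rfl fun i _ => hpart i]
  simp

variable {f : EuclideanSpace ℝ (Fin d) → ℝ} {xstar : EuclideanSpace ℝ (Fin d)}
  {a L κ β δ lam α : ℝ}

lemma hasPolyGrowth_coord_sub (y : EuclideanSpace ℝ (Fin d)) (i : Fin d) :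
    HasPolyGrowth fun x : EuclideanSpace ℝ (Fin d) => (x - y) i :=
  (HasPolyGrowth.norm_sub y).mono (by fun_prop) fun x => by
    simpa using PiLp.norm_apply_le (x - y) i

lemma hasPolyGrowth_inner (m : EuclideanSpace ℝ (Fin d))
    {h : EuclideanSpace ℝ (Fin d) → EuclideanSpace ℝ (Fin d)}
    (hc : Continuous h) (hh : HasPolyGrowth fun x => ‖h x‖) :
    HasPolyGrowth fun x => inner ℝ (x - m) (h x) :=
  ((HasPolyGrowth.norm_sub m).mul hh).mono (by fun_prop) fun x => abs_real_inner_le_norm _ _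

namespace GrowthAssumption

variable (hf : GrowthAssumption f xstar a L κ β)
include hf

lemma fderiv_weight_mul_gaussKernel (m : EuclideanSpace ℝ (Fin d)) (v : ℝ)
    (x h : EuclideanSpace ℝ (Fin d)) :
    fderiv ℝ (fun x => weight f xstar α x * gaussKernel m v x) x h
      = -(weight f xstar α x * (gaussKernel m v x *
        (α * fderiv ℝ f x h + 1 / v * inner ℝ (x - m) h))) := by
  have := (hf.hasFDerivAt_weight (α := α) x).mul (hasFDerivAt_gaussKernel m v x)
  have h2 : fderiv ℝ (fun x => weight f xstar α x * gaussKernel m v x) x = _ := this.fderiv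
  rw [h2]
  simp [-map_sub]
  ring

/-- The bracket is minus the radial logarithmic derivative of weight times kernel, and d is the
divergence of the radial field. The attraction of f and the pull of the Gaussian towards m are
balanced in this single identity. -/
lemma integral_radial_eq (hα : 1 ≤ α) (m : EuclideanSpace ℝ (Fin d)) {v : ℝ} (hv : 0 < v) :
    ∫ x, weight f xstar α x * (gaussKernel m v x *
      (α * fderiv ℝ f x (x - xstar) + 1 / v * inner ℝ (x - m) (x - xstar)))
    = d * ∫ x, weight f xstar α x * gaussKernel m v x := by
  have hk := hasPolyGrowth_gaussKernel m hv
  have hgr : ∀ h : EuclideanSpace ℝ (Fin d) → EuclideanSpace ℝ (Fin d), Continuous h →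
      HasPolyGrowth (fun x => ‖h x‖) → HasPolyGrowth fun x => gaussKernel m v x *
        (α * fderiv ℝ f x (h x) + 1 / v * inner ℝ (x - m) (h x)) := fun h hc hh =>
    hk.mul (((HasPolyGrowth.const α).mul (hf.hasPolyGrowth_fderiv hc hh)).add
      ((HasPolyGrowth.const (1 / v)).mul (hasPolyGrowth_inner m hc hh)))
  have key := integral_fderiv_radial xstar
    (φ := fun x => weight f xstar α x * gaussKernel m v x)
    (fun x => ((hf.hasFDerivAt_weight x).mul (hasFDerivAt_gaussKernel m v x)).differentiableAt)
    (hf.integrable_weight_mul hk hα)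
    (fun i => by
      have := hf.integrable_weight_mul (hk.mul (hasPolyGrowth_coord_sub xstar i)) hα
      simpa only [mul_assoc] using this)
    (fun i => by
      simp only [hf.fderiv_weight_mul_gaussKernel]
      have := (hf.integrable_weight_mul ((hgr (fun _ => EuclideanSpace.single i 1)
        continuous_const (HasPolyGrowth.const _)).mul (hasPolyGrowth_coord_sub xstar i)) hα).neg
      refine this.congr (Filter.Eventually.of_forall fun x => ?_)
      simp only [Pi.neg_apply]
      ring)
  simp only [hf.fderiv_weight_mul_gaussKernel, integral_neg, neg_inj] at key
  exact key

/-- The Gibbs measure charges the complement of a ball around the minimizer exponentially little,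
uniformly in the mean and the variance of the Gaussian reference measure. -/
lemma exists_tail_le (hd : 1 ≤ d) (hδ : 0 < δ) {g : EuclideanSpace ℝ (Fin d) → ℝ}
    (hg : HasPolyGrowth g) (hg0 : ∀ x, 0 ≤ g x) :
    ∃ (A r : ℝ), 1 ≤ A ∧ 0 < r ∧ ∀ γ : ℝ, 0 < γ → ∀ α, A < α → ∀ v, γ / (2 * α) ≤ v →
      ∀ m : EuclideanSpace ℝ (Fin d), ‖m‖ ≤ √(γ * (κ * δ ^ β / 8)) - ‖xstar‖ - r →
      α * ∫ x in {x | δ ≤ ‖x - xstar‖}, weight f xstar α x * (gaussKernel m v x * g x)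
        ≤ d * ∫ x, weight f xstar α x * gaussKernel m v x := by
  have hκ := hf.κ_pos
  have hβ := hf.one_le_β
  -- At distance at least δ the weight is at most exp(-4cα), while on a small ball around `xstar`
  -- weight and kernel are each at least exp(-cα). The remaining exp(-2cα) absorbs the factor α.
  set c : ℝ := κ * δ ^ β / 8 with hc
  have hc0 : 0 < c := by positivity
  obtain ⟨r, hr, hfr⟩ : ∃ r > 0, ∀ x, ‖x - xstar‖ < r → f x - f xstar ≤ c := by
    obtain ⟨r, hr, h⟩ := Metric.continuousAt_iff.1 (hf.contDiff.continuous.continuousAt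
      (x := xstar)) c hc0
    refine ⟨r, hr, fun x hx => ?_⟩
    have := h (by simpa [dist_eq_norm] using hx)
    rw [Real.dist_eq] at this
    exact (le_abs_self _).trans this.le
  set I₀ : ℝ := ∫ x, Real.exp (-(κ / 2) * ‖x - xstar‖ ^ β) * g x with hI₀
  have hI₀i := hg.integrable_exp_neg_mul (c := κ / 2) (by positivity) hβ xstar
  have hI₀n : 0 ≤ I₀ := integral_nonneg fun x => mul_nonneg (Real.exp_pos _).le (hg0 x)
  set V : ℝ := volume.real (Metric.ball xstar r) with hV
  have hV0 : 0 < V := by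
    rw [hV, measureReal_def]
    exact ENNReal.toReal_pos (Metric.measure_ball_pos _ _ hr).ne' measure_ball_lt_top.ne
  have hlim := tendsto_rpow_mul_exp_neg_mul_atTop_nhds_zero (1 : ℝ) (2 * c) (by positivity)
  have hlim2 : Filter.Tendsto (fun α : ℝ => α ^ (1 : ℝ) * Real.exp (-(2 * c) * α)
      * (Real.exp (4 * c) * I₀)) Filter.atTop (nhds 0) := by
    simpa using hlim.mul_const (Real.exp (4 * c) * I₀)
  have hdV : 0 < d * V := by have : (0 : ℝ) < d := by exact_mod_cast hd
                             positivity
  obtain ⟨A, hA⟩ := Filter.eventually_atTop.1 (hlim2.eventually (gt_mem_nhds hdV))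
  refine ⟨max A 1, r, le_max_right _ _, hr, fun γ hγ α hα v hv m hm => ?_⟩
  have hα1 : 1 ≤ α := (le_max_right _ _).trans hα.le
  have hα0 : 0 < α := by linarith
  have hv0 : 0 < v := lt_of_lt_of_le (by positivity) hv
  have hAα := (hA α ((le_max_left _ _).trans hα.le)).le
  rw [Real.rpow_one] at hAα
  have hk := hasPolyGrowth_gaussKernel m hv0
  -- numerator
  have hnum : ∫ x in {x | δ ≤ ‖x - xstar‖}, weight f xstar α x * (gaussKernel m v x * g x)
      ≤ Real.exp (-(4 * c) * (α - 1)) * I₀ := by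
    rw [hI₀, ← integral_const_mul]
    have hms : MeasurableSet {x | δ ≤ ‖x - xstar‖} :=
      measurableSet_le measurable_const (by fun_prop)
    refine (setIntegral_mono_on (hf.integrable_weight_mul (hk.mul hg) hα1).integrableOn
      (hI₀i.const_mul _).integrableOn hms fun x hx => ?_).trans
      (setIntegral_le_integral (hI₀i.const_mul _) (Filter.Eventually.of_forall fun x =>
        mul_nonneg (Real.exp_pos _).le (mul_nonneg (Real.exp_pos _).le (hg0 x))))
    have hx' : δ ^ β ≤ ‖x - xstar‖ ^ β :=
      Real.rpow_le_rpow hδ.le hx (by linarith)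
    -- One unit of α is kept for integrability; the other α - 1 give the smallness.
    have hw : weight f xstar α x ≤ Real.exp (-(4 * c) * (α - 1))
        * Real.exp (-(κ / 2) * ‖x - xstar‖ ^ β) := by
      refine (hf.weight_le_exp hα0.le x).trans ?_
      rw [← Real.exp_add]
      refine Real.exp_le_exp.2 ?_
      have : 0 ≤ κ / 2 * (α - 1) := mul_nonneg (by positivity) (by linarith)
      rw [hc]
      nlinarith
    calc weight f xstar α x * (gaussKernel m v x * g x)
        ≤ weight f xstar α x * (1 * g x) := by
          have := weight_pos (f := f) (xstar := xstar) (α := α) x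
          have := hg0 x
          gcongr
          exact gaussKernel_le_one m hv0 x
      _ ≤ (Real.exp (-(4 * c) * (α - 1)) * Real.exp (-(κ / 2) * ‖x - xstar‖ ^ β)) * g x := by
          rw [one_mul]
          exact mul_le_mul_of_nonneg_right hw (hg0 x)
      _ = _ := by ring
  -- denominator
  have hden : Real.exp (-(2 * c) * α) * V ≤ ∫ x, weight f xstar α x * gaussKernel m v x := by
    have hi := hf.integrable_weight_mul hk hα1
    refine le_trans ?_ (setIntegral_le_integral (s := Metric.ball xstar r) hi
      (Filter.Eventually.of_forall fun x => mul_nonneg (weight_pos x).le (gaussKernel_pos m v x).le))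
    have : ∫ x in Metric.ball xstar r, Real.exp (-(2 * c) * α) = Real.exp (-(2 * c) * α) * V := by
      rw [setIntegral_const, hV, smul_eq_mul, mul_comm]
    rw [← this]
    refine setIntegral_mono_on (integrableOn_const measure_ball_lt_top.ne) hi.integrableOn
      Metric.isOpen_ball.measurableSet fun x hx => ?_
    have hx' : ‖x - xstar‖ < r := by simpa [dist_eq_norm] using hx
    have h1 := hfr x hx'
    have h2 : ‖x - m‖ ≤ √(γ * c) := by
      calc ‖x - m‖ = ‖(x - xstar) + xstar - m‖ := by rw [sub_add_cancel]
        _ ≤ ‖x - xstar‖ + ‖xstar‖ + ‖m‖ := (norm_sub_le _ _).trans (by gcongr; exact norm_add_le _ _)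
        _ ≤ _ := by linarith
    have h3 : ‖x - m‖ ^ 2 ≤ γ * c := by
      calc ‖x - m‖ ^ 2 ≤ √(γ * c) ^ 2 := by gcongr
        _ = γ * c := Real.sq_sqrt (by positivity)
    -- The lower bound on v and the restriction on ‖m‖ meet here: the kernel costs at most exp(-cα).
    have h4 : ‖x - m‖ ^ 2 / (2 * v) ≤ c * α := by
      rw [div_le_iff₀ (by positivity)]
      rw [div_le_iff₀ (by positivity)] at hv
      nlinarith
    unfold weight gaussKernel
    rw [← Real.exp_add, neg_div]
    refine Real.exp_le_exp.2 ?_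
    nlinarith
  calc α * ∫ x in {x | δ ≤ ‖x - xstar‖}, weight f xstar α x * (gaussKernel m v x * g x)
      ≤ α * (Real.exp (-(4 * c) * (α - 1)) * I₀) := by gcongr
    _ = (α * Real.exp (-(2 * c) * α) * (Real.exp (4 * c) * I₀)) * Real.exp (-(2 * c) * α) := by
        have : Real.exp (-(4 * c) * (α - 1))
            = Real.exp (-(2 * c) * α) * Real.exp (4 * c) * Real.exp (-(2 * c) * α) := by
          rw [← Real.exp_add, ← Real.exp_add]; congr 1; ring
        rw [this]; ring
    _ ≤ (d * V) * Real.exp (-(2 * c) * α) := by gcongr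
    _ = d * (Real.exp (-(2 * c) * α) * V) := by ring
    _ ≤ _ := by gcongr

end GrowthAssumption

/-- If `A w² ≤ B + C w` then `w ≤ C / A + √(B / A)`. -/
lemma le_div_add_sqrt_of_quadratic {A B C w : ℝ} (hA : 0 < A) (hB : 0 ≤ B) (hC : 0 ≤ C)
    (h : A * w ^ 2 ≤ B + C * w) : w ≤ C / A + √(B / A) := by
  by_contra! hlt
  have hs := Real.sq_sqrt (div_nonneg hB hA.le)
  have hs0 := Real.sqrt_nonneg (B / A)
  have hCA : 0 ≤ C / A := by positivity
  have e1 : B = A * √(B / A) ^ 2 := by rw [hs]; field_simp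
  have e2 : C = A * (C / A) := by field_simp
  have h3 : w ^ 2 ≤ √(B / A) ^ 2 + C / A * w := by
    rw [e1] at h
    rw [e2] at h
    have : A * w ^ 2 ≤ A * (√(B / A) ^ 2 + C / A * w) := by
      calc _ ≤ _ := h
        _ = _ := by rw [← e1, ← e2]; rw [mul_add, ← e1, ← mul_assoc, ← e2]
    exact le_of_mul_le_mul_left this hA
  nlinarith

/-- The Gibbs average of the distance to the minimizer, for a Gaussian reference measure, contracts
the distance of its mean to the minimizer up to an error of order `α ^ (-1/2)`. -/
theorem exists_gibbs_mean_le (hd : 1 ≤ d) (hf : GrowthAssumption f xstar a L κ β)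
    (hf' : LocalConvexityAssumption f xstar δ lam) :
    ∃ (A r : ℝ), 1 ≤ A ∧ 0 < r ∧ ∀ γ : ℝ, 0 < γ → ∀ α, A < α → ∀ v, γ / (2 * α) ≤ v →
      ∀ m : EuclideanSpace ℝ (Fin d), ‖m‖ ≤ √(γ * (κ * δ ^ β / 8)) - ‖xstar‖ - r →
      ∫ x, weight f xstar α x * (gaussKernel m v x * ‖x - xstar‖)
        ≤ (‖m - xstar‖ / (1 + lam * γ / 4) + √(4 * d / (α * lam)))
          * ∫ x, weight f xstar α x * gaussKernel m v x := by
  have hlam := hf'.lam_pos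
  -- `g` bounds the error made outside the ball of convexity when the radial derivative is replaced
  -- by its lower bound inside.
  set g : EuclideanSpace ℝ (Fin d) → ℝ := fun x =>
    lam / 2 * (‖x - xstar‖ * ‖x - xstar‖) + L * (1 + ‖x‖ ^ a) * ‖x - xstar‖ with hgdef
  have hn := HasPolyGrowth.norm_sub xstar
  have hg : HasPolyGrowth g :=
    ((HasPolyGrowth.const (lam / 2)).mul (hn.mul hn)).add (hf.hasPolyGrowth_bound.mul hn)
  have hL := hf.L_pos
  have hg0 : ∀ x, 0 ≤ g x := fun x => by positivity
  obtain ⟨A, r, hA, hr, htail⟩ := hf.exists_tail_le hd hf'.δ_pos hg hg0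
  refine ⟨A, r, hA, hr, fun γ hγ α hα v hv m hm => ?_⟩
  have hα1 : 1 ≤ α := hA.trans hα.le
  have hα0 : 0 < α := by linarith
  have hv0 : 0 < v := lt_of_lt_of_le (by positivity) hv
  have ht := htail γ hγ α hα v hv m hm
  have hk := hasPolyGrowth_gaussKernel m hv0
  set I := ∫ x, weight f xstar α x * gaussKernel m v x with hI
  set W := ∫ x, weight f xstar α x * (gaussKernel m v x * ‖x - xstar‖) with hW
  set U := ∫ x, weight f xstar α x * (gaussKernel m v x * (‖x - xstar‖ * ‖x - xstar‖)) with hU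
  have iI := hf.integrable_weight_mul hk hα1
  have iW := hf.integrable_weight_mul (hk.mul hn) hα1
  have iU := hf.integrable_weight_mul (hk.mul (hn.mul hn)) hα1
  have iG := hf.integrable_weight_mul (hk.mul hg) hα1
  have hS : MeasurableSet {x : EuclideanSpace ℝ (Fin d) | δ ≤ ‖x - xstar‖} :=
    measurableSet_le measurable_const (by fun_prop)
  have hI0 : 0 < I := by
    have hcont : Continuous fun x => weight f xstar α x * gaussKernel m v x :=
      hf.continuous_weight.mul (continuous_gaussKernel m v)
    rw [hI, integral_pos_iff_support_of_nonneg
      (fun x => (mul_pos (weight_pos x) (gaussKernel_pos m v x)).le) iI]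
    have : Function.support (fun x => weight f xstar α x * gaussKernel m v x) = Set.univ :=
      Set.eq_univ_of_forall fun x => (mul_pos (weight_pos x) (gaussKernel_pos m v x)).ne'
    rw [this]
    exact Measure.measure_univ_pos.2 (NeZero.ne _)
  have hE := hf.integral_radial_eq hα1 m hv0
  have hlow : (α * lam / 2 + 1 / v) * U - ‖m - xstar‖ / v * W
      - α * ∫ x in {x | δ ≤ ‖x - xstar‖}, weight f xstar α x * (gaussKernel m v x * g x)
      ≤ d * I := by
    have iUW : Integrable fun x => (α * lam / 2 + 1 / v)
        * (weight f xstar α x * (gaussKernel m v x * (‖x - xstar‖ * ‖x - xstar‖)))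
        - ‖m - xstar‖ / v * (weight f xstar α x * (gaussKernel m v x * ‖x - xstar‖)) :=
      (iU.const_mul _).sub (iW.const_mul _)
    rw [← hE, hU, hW, ← integral_indicator hS, ← integral_const_mul, ← integral_const_mul,
      ← integral_const_mul, ← integral_sub (iU.const_mul _) (iW.const_mul _),
      ← integral_sub iUW ((iG.indicator hS).const_mul _)]
    have hc1 : Continuous fun x : EuclideanSpace ℝ (Fin d) => x - xstar := by fun_prop
    refine integral_mono (iUW.sub ((iG.indicator hS).const_mul _))
      (hf.integrable_weight_mul (hk.mul
        (((HasPolyGrowth.const α).mul (hf.hasPolyGrowth_fderiv hc1 hn)).add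
          ((HasPolyGrowth.const (1 / v)).mul (hasPolyGrowth_inner m hc1 hn)))) hα1) fun x => ?_
    have hP : 0 < weight f xstar α x * gaussKernel m v x :=
      mul_pos (weight_pos x) (gaussKernel_pos m v x)
    have hin : ‖x - xstar‖ * ‖x - xstar‖ - ‖m - xstar‖ * ‖x - xstar‖
        ≤ inner ℝ (x - m) (x - xstar) := by
      have e : x - m = (x - xstar) - (m - xstar) := by abel
      have := real_inner_le_norm (m - xstar) (x - xstar)
      rw [e, inner_sub_left, real_inner_self_eq_norm_mul_norm]
      linarith
    have hin' : (‖x - xstar‖ * ‖x - xstar‖ - ‖m - xstar‖ * ‖x - xstar‖) / v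
        ≤ 1 / v * inner ℝ (x - m) (x - xstar) := by
      rw [div_mul_eq_mul_div, one_mul]
      gcongr
    set ι := Set.indicator {x | δ ≤ ‖x - xstar‖} (fun _ => (1 : ℝ)) x with hι
    have hind : Set.indicator {x | δ ≤ ‖x - xstar‖}
        (fun x => weight f xstar α x * (gaussKernel m v x * g x)) x
        = weight f xstar α x * gaussKernel m v x * (ι * g x) := by
      by_cases hx : x ∈ {x | δ ≤ ‖x - xstar‖}
      · simp [hι, Set.indicator_of_mem hx, mul_assoc]
      · simp [hι, Set.indicator_of_notMem hx]
    have hrad : lam / 2 * (‖x - xstar‖ * ‖x - xstar‖) - ι * g x ≤ fderiv ℝ f x (x - xstar) := by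
      by_cases hx : δ ≤ ‖x - xstar‖
      · have h1 : ι = 1 := Set.indicator_of_mem (s := {x | δ ≤ ‖x - xstar‖}) hx _
        have h2 : |fderiv ℝ f x (x - xstar)| ≤ L * (1 + ‖x‖ ^ a) * ‖x - xstar‖ := by
          refine ((fderiv ℝ f x).le_opNorm _).trans ?_
          gcongr
          exact hf.norm_fderiv_le x
        rw [h1, one_mul, hgdef]
        have := neg_abs_le (fderiv ℝ f x (x - xstar))
        simp only
        linarith
      · have h1 : ι = 0 := Set.indicator_of_notMem (s := {x | δ ≤ ‖x - xstar‖}) hx _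
        have := hf'.le_fderiv_radial hf (not_le.1 hx)
        rw [h1, zero_mul, sub_zero, ← pow_two]
        exact this
    have hrad' := mul_le_mul_of_nonneg_left hrad hα0.le
    simp only [hind]
    calc _ = weight f xstar α x * gaussKernel m v x *
          (α * (lam / 2 * (‖x - xstar‖ * ‖x - xstar‖) - ι * g x)
            + (‖x - xstar‖ * ‖x - xstar‖ - ‖m - xstar‖ * ‖x - xstar‖) / v) := by
          field_simp
          ring
      _ ≤ weight f xstar α x * gaussKernel m v x *
          (α * fderiv ℝ f x (x - xstar) + 1 / v * inner ℝ (x - m) (x - xstar)) := by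
          gcongr
      _ = _ := by ring
  -- The tail term costs a second `d * I`; the inequality is then multiplied by v.
  have hUineq : (1 + α * lam * v / 2) * U ≤ 2 * d * v * I + ‖m - xstar‖ * W := by
    have h1 : (α * lam / 2 + 1 / v) * U - ‖m - xstar‖ / v * W ≤ 2 * d * I := by linarith
    have h2 := mul_le_mul_of_nonneg_left h1 hv0.le
    have e : v * ((α * lam / 2 + 1 / v) * U - ‖m - xstar‖ / v * W)
        = (1 + α * lam * v / 2) * U - ‖m - xstar‖ * W := by
      field_simp
      ring
    rw [e] at h2
    linarith
  have hCS : W ^ 2 ≤ I * U := by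
    have hquad : ∀ t : ℝ, 0 ≤ I * (t * t) + (-2 * W) * t + U := by
      intro t
      have e : I * (t * t) + (-2 * W) * t + U = ∫ x, (weight f xstar α x * gaussKernel m v x)
          * (t - ‖x - xstar‖) ^ 2 := by
        have iIW : Integrable fun x => weight f xstar α x * gaussKernel m v x * (t * t)
            + t * -2 * (weight f xstar α x * (gaussKernel m v x * ‖x - xstar‖)) :=
          (iI.mul_const _).add (iW.const_mul _)
        rw [hI, hW, hU, ← integral_mul_const, mul_comm (-2 * _) t, ← mul_assoc,
          ← integral_const_mul, ← integral_add (iI.mul_const _) (iW.const_mul _),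
          ← integral_add iIW iU]
        congr 1
        funext x
        ring
      rw [e]
      exact integral_nonneg fun x =>
        mul_nonneg (mul_pos (weight_pos x) (gaussKernel_pos m v x)).le (sq_nonneg _)
    have := discrim_le_zero hquad
    unfold discrim at this
    nlinarith
  set B := 1 + α * lam * v / 2 with hB
  have hB0 : 0 < B := by positivity
  have hBγ : 1 + lam * γ / 4 ≤ B := by
    rw [div_le_iff₀ (by positivity)] at hv
    have := mul_le_mul_of_nonneg_left hv hlam.le
    rw [hB]
    linarith
  have hw : W / I ≤ ‖m - xstar‖ / B + √(2 * d * v / B) := by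
    refine le_div_add_sqrt_of_quadratic hB0 (by positivity) (norm_nonneg _) ?_
    rw [div_pow]
    have h1 : B * W ^ 2 ≤ 2 * d * v * I ^ 2 + ‖m - xstar‖ * W * I := by
      calc B * W ^ 2 ≤ B * (I * U) := by gcongr
        _ = I * (B * U) := by ring
        _ ≤ I * (2 * d * v * I + ‖m - xstar‖ * W) := by gcongr
        _ = _ := by ring
    calc B * (W ^ 2 / I ^ 2) = B * W ^ 2 / I ^ 2 := by ring
      _ ≤ (2 * d * v * I ^ 2 + ‖m - xstar‖ * W * I) / I ^ 2 := by gcongr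
      _ = _ := by field_simp
  rw [div_le_iff₀ hI0] at hw
  refine hw.trans ?_
  gcongr ?_ * _
  -- The first term uses B ≥ 1 + λγ/4; the second uses B ≥ αλv/2, which eliminates v however large
  -- it is.
  refine add_le_add (by gcongr) (Real.sqrt_le_sqrt ?_)
  rw [div_le_div_iff₀ hB0 (by positivity), hB]
  have : 0 ≤ (d : ℝ) := by positivity
  nlinarith

end

section

variable {d : ℕ}

/-! ### Isotropic Gaussian measures -/

instance (m : EuclideanSpace ℝ (Fin d)) (σ : ℝ) : IsGaussian (isoGaussian m σ) := by
  unfold isoGaussian; infer_instance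

lemma posSemidef_smul_one (σ : ℝ) :
    (σ ^ 2 • (1 : Matrix (Fin d) (Fin d) ℝ)).PosSemidef :=
  Matrix.PosSemidef.one.smul (sq_nonneg σ)

lemma charFun_isoGaussian (m : EuclideanSpace ℝ (Fin d)) (σ : ℝ) (t : EuclideanSpace ℝ (Fin d)) :
    charFun (isoGaussian m σ) t
      = Complex.exp (inner ℝ t m * Complex.I - (σ ^ 2 * ‖t‖ ^ 2 / 2 : ℝ)) := by
  rw [isoGaussian, charFun_multivariateGaussian (posSemidef_smul_one σ)]
  congr 2
  have : (t : Fin d → ℝ) ⬝ᵥ (σ ^ 2 • (1 : Matrix (Fin d) (Fin d) ℝ)).mulVec t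
      = σ ^ 2 * ‖t‖ ^ 2 := by
    rw [Matrix.smul_mulVec, Matrix.one_mulVec, dotProduct_smul, EuclideanSpace.norm_sq_eq]
    simp [dotProduct, pow_two]
  rw [this]
  push_cast
  ring

lemma isoGaussian_map_const_add (m : EuclideanSpace ℝ (Fin d)) (σ : ℝ) :
    (isoGaussian 0 σ).map (fun x => m + x) = isoGaussian m σ := by
  apply Measure.ext_of_charFun
  funext t
  rw [charFun_map_const_add, charFun_isoGaussian, charFun_isoGaussian, ← Complex.exp_add]
  congr 1
  rw [real_inner_comm m t]
  simp
  ring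

lemma memLp_two_isoGaussian (m : EuclideanSpace ℝ (Fin d)) (σ : ℝ) :
    MemLp id 2 (isoGaussian m σ) := IsGaussian.memLp_two_id

lemma integrable_norm_sq_isoGaussian (m : EuclideanSpace ℝ (Fin d)) (σ : ℝ) :
    Integrable (fun x => ‖x‖ ^ 2) (isoGaussian m σ) :=
  (memLp_two_isoGaussian m σ).integrable_norm_pow (by simp)

lemma integral_norm_sq_isoGaussian (m : EuclideanSpace ℝ (Fin d)) (σ : ℝ) :
    ∫ x, ‖x‖ ^ 2 ∂(isoGaussian m σ) = ‖m‖ ^ 2 + d * σ ^ 2 := by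
  have hL : ∀ i, MemLp (fun x : EuclideanSpace ℝ (Fin d) => x i) 2 (isoGaussian m σ) := fun i =>
    (memLp_two_isoGaussian m σ).of_le (by fun_prop)
      (Filter.Eventually.of_forall fun x => by simpa using PiLp.norm_apply_le x i)
  have hi : ∀ i, ∫ x : EuclideanSpace ℝ (Fin d), (x i) ^ 2 ∂(isoGaussian m σ)
      = m i ^ 2 + σ ^ 2 := by
    intro i
    have hv := variance_eq_sub (hL i)
    have hv' : Var[fun x : EuclideanSpace ℝ (Fin d) => x i; isoGaussian m σ] = σ ^ 2 := by
      rw [isoGaussian, variance_eval_multivariateGaussian (posSemidef_smul_one σ)]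
      simp
    have hm : ∫ x : EuclideanSpace ℝ (Fin d), x i ∂(isoGaussian m σ) = m i := by
      have := (EuclideanSpace.proj i : EuclideanSpace ℝ (Fin d) →L[ℝ] ℝ).integral_comp_comm
        (μ := isoGaussian m σ) (φ := fun x => x) IsGaussian.integrable_fun_id
      rw [isoGaussian, integral_id_multivariateGaussian] at this
      exact this
    rw [hv', hm] at hv
    simp only [Pi.pow_apply] at hv
    linarith
  simp only [EuclideanSpace.norm_sq_eq, Real.norm_eq_abs, sq_abs]
  rw [integral_finsetSum _ fun i _ => (hL i).integrable_sq]
  simp [hi, Finset.sum_add_distrib]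

/-- Integration against an isotropic Gaussian in terms of its Lebesgue density. -/
lemma exists_integral_isoGaussian_eq (m : EuclideanSpace ℝ (Fin d)) {σ : ℝ} (hσ : σ ≠ 0) :
    ∃ c : ℝ, 0 < c ∧ ∀ g : EuclideanSpace ℝ (Fin d) → ℝ,
      ∫ x, g x ∂(isoGaussian m σ) = c * ∫ x, g x * gaussKernel m (σ ^ 2) x := by
  have hσ2 : 0 < σ ^ 2 := by positivity
  set b : ℝ := 1 / (2 * σ ^ 2) with hb
  have hb0 : 0 < b := by positivity
  set Z : ℝ := (Real.pi / b) ^ ((d : ℝ) / 2) with hZ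
  have hZ0 : 0 < Z := by positivity
  set c : ℝ := Z⁻¹ with hc
  have hc0 : 0 < c := by positivity
  set ρ : EuclideanSpace ℝ (Fin d) → ℝ := fun x => c * gaussKernel 0 (σ ^ 2) x with hρ
  have hk : ∀ x : EuclideanSpace ℝ (Fin d), gaussKernel 0 (σ ^ 2) x = Real.exp (-b * ‖x‖ ^ 2) := by
    intro x
    unfold gaussKernel
    rw [sub_zero, hb]
    congr 1
    ring
  have hZint : ∫ x : EuclideanSpace ℝ (Fin d), gaussKernel 0 (σ ^ 2) x = Z := by
    simp only [hk]
    rw [GaussianFourier.integral_rexp_neg_mul_sq_norm hb0]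
    simp [hZ]
  have hint : Integrable (gaussKernel (0 : EuclideanSpace ℝ (Fin d)) (σ ^ 2)) := by
    by_contra h
    rw [integral_undef h] at hZint
    exact hZ0.ne hZint
  have hρm : Measurable ρ := ((continuous_gaussKernel 0 (σ ^ 2)).measurable.const_mul c)
  have hρ0 : ∀ x, 0 ≤ ρ x := fun x => mul_nonneg hc0.le (gaussKernel_pos _ _ x).le
  set μ : Measure (EuclideanSpace ℝ (Fin d)) :=
    volume.withDensity (fun x => ENNReal.ofReal (ρ x)) with hμ
  have hfin : IsFiniteMeasure μ := by
    refine isFiniteMeasure_withDensity_ofReal ?_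
    exact (hint.const_mul c).2
  have hformC : ∀ g : EuclideanSpace ℝ (Fin d) → ℂ, ∫ x, g x ∂μ = ∫ x, ρ x • g x := by
    intro g
    rw [hμ, integral_withDensity_eq_integral_toReal_smul (by fun_prop)
      (Filter.Eventually.of_forall fun x => ENNReal.ofReal_lt_top)]
    simp [ENNReal.toReal_ofReal (hρ0 _)]
  have hformR : ∀ g : EuclideanSpace ℝ (Fin d) → ℝ, ∫ x, g x ∂μ = ∫ x, ρ x • g x := by
    intro g
    rw [hμ, integral_withDensity_eq_integral_toReal_smul (by fun_prop)
      (Filter.Eventually.of_forall fun x => ENNReal.ofReal_lt_top)]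
    simp [ENNReal.toReal_ofReal (hρ0 _)]
  -- Both measures have the same characteristic function. The value of `c` is not recorded, as it
  -- cancels when numerator and normalization are compared.
  have heq : isoGaussian 0 σ = μ := by
    apply Measure.ext_of_charFun
    funext t
    rw [charFun_isoGaussian, charFun_apply, hformC]
    have h1 := GaussianFourier.integral_cexp_neg_mul_sq_norm_add (V := EuclideanSpace ℝ (Fin d))
      (b := (b : ℂ)) (by simpa using hb0) Complex.I t
    have h2 : ∀ x : EuclideanSpace ℝ (Fin d), ρ x • Complex.exp (inner ℝ x t * Complex.I)
        = (c : ℂ) * Complex.exp (-b * ‖x‖ ^ 2 + Complex.I * inner ℝ t x) := by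
      intro x
      simp only [Complex.real_smul, hρ, hk, Complex.exp_add, real_inner_comm]
      push_cast
      ring_nf
    simp only [h2]
    rw [integral_const_mul, h1]
    have h3 : ((Real.pi : ℂ) / b) ^ ((Module.finrank ℝ (EuclideanSpace ℝ (Fin d)) : ℂ) / 2)
        = (Z : ℂ) := by
      rw [hZ, Complex.ofReal_cpow (by positivity)]
      simp
    rw [h3, hc, Complex.ofReal_inv, inv_mul_cancel_left₀ (by exact_mod_cast hZ0.ne')]
    congr 1
    have hb' : (b : ℂ) ≠ 0 := by exact_mod_cast hb0.ne'
    have hb2 : (σ : ℂ) ^ 2 = 1 / (2 * b) := by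
      rw [hb]; push_cast
      have : (σ : ℂ) ≠ 0 := by exact_mod_cast hσ
      field_simp
    simp only [inner_zero_right]
    push_cast
    rw [hb2, Complex.I_sq]
    field_simp
    ring
  refine ⟨c, hc0, fun g => ?_⟩
  rw [← isoGaussian_map_const_add, ← MeasurableEquiv.coe_addLeft, (MeasurableEquiv.addLeft m).measurableEmbedding.integral_map,
    heq, hformR, ← integral_const_mul]
  have hshift : ∀ x, ρ x • g (m + x) = (fun y => c * (g y * gaussKernel m (σ ^ 2) y)) (m + x) := by
    intro x
    simp only [hρ, gaussKernel, sub_zero, add_sub_cancel_left, smul_eq_mul]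
    ring
  simp only [MeasurableEquiv.coe_addLeft, hshift]
  exact integral_add_left_eq_self (fun y => c * (g y * gaussKernel m (σ ^ 2) y)) m

/-- An independent sum of scaled centered isotropic Gaussians. -/
lemma hasLaw_smul_add_smul {Ω : Type*} [MeasurableSpace Ω] {P : Measure Ω} [IsProbabilityMeasure P]
    {X Y : Ω → EuclideanSpace ℝ (Fin d)} {σ τ υ u v : ℝ} (hX : HasLaw X (isoGaussian 0 σ) P)
    (hY : HasLaw Y (isoGaussian 0 τ) P) (h : IndepFun X Y P)
    (hυ : υ ^ 2 = u ^ 2 * σ ^ 2 + v ^ 2 * τ ^ 2) :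
    HasLaw (fun ω => u • X ω + v • Y ω) (isoGaussian 0 υ) P := by
  have hXm := hX.aemeasurable
  have hYm := hY.aemeasurable
  refine ⟨by fun_prop, ?_⟩
  have hind : IndepFun (fun ω => u • X ω) (fun ω => v • Y ω) P :=
    h.comp (measurable_const_smul u) (measurable_const_smul v)
  apply Measure.ext_of_charFun
  have := hind.charFun_map_add_eq_mul (by fun_prop) (by fun_prop)
  refine (this.trans ?_)
  funext t
  rw [Pi.mul_apply, charFun_map_smul_comp hXm, charFun_map_smul_comp hYm, hX.map_eq, hY.map_eq,
    charFun_isoGaussian, charFun_isoGaussian, charFun_isoGaussian, ← Complex.exp_add]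
  congr 1
  have : (υ : ℂ) ^ 2 = u ^ 2 * σ ^ 2 + v ^ 2 * τ ^ 2 := by exact_mod_cast hυ
  simp only [inner_zero_right, norm_smul, mul_pow, Real.norm_eq_abs, sq_abs]
  push_cast
  rw [this]
  ring

lemma stdGaussian_eq_isoGaussian :
    stdGaussian (EuclideanSpace ℝ (Fin d)) = isoGaussian 0 1 := by
  simp [isoGaussian]

end

section

variable {d : ℕ}

/-! ### A uniform law of large numbers on balls -/

lemma norm_le_sum_abs (x : EuclideanSpace ℝ (Fin d)) : ‖x‖ ≤ ∑ i, |x i| := by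
  conv_lhs => rw [← (EuclideanSpace.basisFun (Fin d) ℝ).sum_repr x]
  refine (norm_sum_le _ _).trans (le_of_eq ?_)
  simp [norm_smul]

/-- A grid of mesh `h` covering the ball of radius `ρ`. -/
lemma exists_grid {ρ h : ℝ} (hh : 0 < h) :
    ∃ T : Finset (EuclideanSpace ℝ (Fin d)), (T.card : ℝ) ≤ (2 * |ρ| / h + 2) ^ d ∧
      ∀ m : EuclideanSpace ℝ (Fin d), ‖m‖ ≤ ρ → ∃ t ∈ T, ‖m - t‖ ≤ d * h := by
  classical
  set S : Finset ℤ := Finset.Icc ⌊-(|ρ| / h)⌋ ⌊|ρ| / h⌋ with hS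
  refine ⟨(Fintype.piFinset fun _ : Fin d => S).image
    fun z => WithLp.toLp 2 fun i => h * (z i : ℝ), ?_, fun m hm => ?_⟩
  · have h1 : (((Fintype.piFinset fun _ : Fin d => S).image
        fun z => (WithLp.toLp 2 fun i => h * (z i : ℝ) : EuclideanSpace ℝ (Fin d))).card : ℝ)
        ≤ (S.card : ℝ) ^ d := by
      exact_mod_cast Finset.card_image_le.trans (le_of_eq (by simp))
    refine h1.trans ?_
    gcongr
    rw [hS, Int.card_Icc]
    have h2 := Int.floor_le (|ρ| / h)
    have h3 := Int.sub_one_lt_floor (-(|ρ| / h))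
    have h4 : ⌊-(|ρ| / h)⌋ ≤ ⌊|ρ| / h⌋ :=
      Int.floor_le_floor (by have : 0 ≤ |ρ| / h := by positivity
                             linarith)
    have h5 : (((⌊|ρ| / h⌋ + 1 - ⌊-(|ρ| / h)⌋).toNat : ℤ) : ℝ)
        = (⌊|ρ| / h⌋ : ℝ) + 1 - ⌊-(|ρ| / h)⌋ := by
      rw [Int.toNat_of_nonneg (by omega)]
      push_cast
      ring
    rw [← Int.cast_natCast, h5, mul_div_assoc]
    linarith
  · refine ⟨WithLp.toLp 2 fun i => h * (⌊m i / h⌋ : ℝ),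
      Finset.mem_image.2 ⟨fun i => ⌊m i / h⌋, ?_, rfl⟩, ?_⟩
    · refine Fintype.mem_piFinset.2 fun i => ?_
      have hi : |m i| ≤ |ρ| :=
        ((by simpa using PiLp.norm_apply_le m i : |m i| ≤ ‖m‖).trans hm).trans (le_abs_self ρ)
      obtain ⟨h1, h2⟩ := abs_le.1 hi
      rw [hS, Finset.mem_Icc]
      constructor
      · refine Int.floor_le_floor ?_
        rw [← neg_div]
        gcongr
      · refine Int.floor_le_floor ?_
        gcongr
    · refine (norm_le_sum_abs _).trans ?_
      have : ∀ i : Fin d, |(m - WithLp.toLp 2 fun i => h * (⌊m i / h⌋ : ℝ)) i| ≤ h := by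
        intro i
        have h1 := Int.floor_le (m i / h)
        have h2 := Int.lt_floor_add_one (m i / h)
        rw [le_div_iff₀ hh] at h1
        rw [div_lt_iff₀ hh] at h2
        simp only [PiLp.sub_apply]
        rw [abs_le]
        constructor <;> nlinarith
      calc _ ≤ ∑ _i : Fin d, h := Finset.sum_le_sum fun i _ => this i
        _ = d * h := by simp

section LLN

variable {Ω : Type*} [MeasurableSpace Ω] {P : Measure Ω} [IsProbabilityMeasure P] {n : ℕ}
  {μ : Measure (EuclideanSpace ℝ (Fin d))} {G : Fin n → Ω → EuclideanSpace ℝ (Fin d)}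

/-- Chebyshev's inequality for the empirical mean of a bounded function. -/
lemma measureReal_empirical_dev_le (hG : ∀ i, HasLaw (G i) μ P)
    (hind : Pairwise fun i j => IndepFun (G i) (G j) P)
    {ψ : EuclideanSpace ℝ (Fin d) → ℝ} (hψ : Measurable ψ) {B : ℝ} (hB : ∀ x, |ψ x| ≤ B)
    {τ : ℝ} (hτ : 0 < τ) (hn : 0 < n) :
    P.real {ω | τ ≤ |(n : ℝ)⁻¹ * ∑ i, ψ (G i ω) - ∫ x, ψ x ∂μ|} ≤ B ^ 2 / (n * τ ^ 2) := by
  have hn' : (0 : ℝ) < n := by exact_mod_cast hn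
  have hm : ∀ i, AEMeasurable (fun ω => ψ (G i ω)) P := fun i =>
    hψ.comp_aemeasurable (hG i).aemeasurable
  have hL : ∀ i, MemLp (fun ω => ψ (G i ω)) 2 P := fun i =>
    MemLp.of_bound (hm i).aestronglyMeasurable B (Filter.Eventually.of_forall fun ω => hB _)
  have hmean : ∀ i, ∫ ω, ψ (G i ω) ∂P = ∫ x, ψ x ∂μ := fun i => by
    rw [← (hG i).map_eq, integral_map (hG i).aemeasurable hψ.aestronglyMeasurable]
  have hvar1 : ∀ i, Var[fun ω => ψ (G i ω); P] ≤ B ^ 2 := by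
    intro i
    refine (variance_le_expectation_sq (hm i).aestronglyMeasurable).trans ?_
    have : ∫ ω, ψ (G i ω) ^ 2 ∂P ≤ ∫ _ω, B ^ 2 ∂P :=
      integral_mono (hL i).integrable_sq (integrable_const _) fun ω => by
        rw [← sq_abs]
        have := hB (G i ω)
        simp only
        gcongr
    simpa using this
  set S : Ω → ℝ := fun ω => (n : ℝ)⁻¹ * ∑ i, ψ (G i ω) with hS
  have hSL : MemLp S 2 P := (memLp_finsetSum _ fun i _ => hL i).const_mul _
  have hSmean : ∫ ω, S ω ∂P = ∫ x, ψ x ∂μ := by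
    rw [hS, integral_const_mul, integral_finsetSum _ fun i _ => (hL i).integrable one_le_two]
    simp only [hmean, Finset.sum_const, Finset.card_univ, Fintype.card_fin, nsmul_eq_mul]
    field_simp
  have hSvar : Var[S; P] ≤ B ^ 2 / n := by
    have h1 : Var[∑ i, fun ω => ψ (G i ω); P] = ∑ i, Var[fun ω => ψ (G i ω); P] :=
      IndepFun.variance_sum (fun i _ => hL i) fun i _ j _ hij => (hind hij).comp hψ hψ
    have h2 : Var[S; P] = (n : ℝ)⁻¹ ^ 2 * Var[∑ i, fun ω => ψ (G i ω); P] := by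
      rw [← variance_const_mul]
      congr 1
      funext ω
      simp [hS, Finset.sum_apply]
    rw [h2, h1]
    calc (n : ℝ)⁻¹ ^ 2 * ∑ i, Var[fun ω => ψ (G i ω); P]
        ≤ (n : ℝ)⁻¹ ^ 2 * ∑ _i : Fin n, B ^ 2 := by
          gcongr with i
          exact hvar1 i
      _ = B ^ 2 / n := by
          simp only [Finset.sum_const, Finset.card_univ, Fintype.card_fin, nsmul_eq_mul]
          field_simp
  have key := meas_ge_le_variance_div_sq hSL hτ
  rw [hSmean] at key
  rw [measureReal_def]
  refine ENNReal.toReal_le_of_le_ofReal (by positivity) (key.trans (ENNReal.ofReal_le_ofReal ?_))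
  calc Var[S; P] / τ ^ 2 ≤ B ^ 2 / n / τ ^ 2 := by gcongr
    _ = _ := by rw [div_div]

/-- Outside an event of probability `O(1/n)`, the empirical means of finitely many bounded Lipschitz
functions, translated by any vector of a ball, are close to their expectations. -/
lemma exists_uniform_lln (hG : ∀ i, HasLaw (G i) μ P)
    (hind : Pairwise fun i j => IndepFun (G i) (G j) P) [IsProbabilityMeasure μ]
    {ι : Type*} [Fintype ι] {φ : ι → EuclideanSpace ℝ (Fin d) → ℝ} {B ℓ ρ h τ : ℝ}
    (hB : ∀ j x, |φ j x| ≤ B) (hℓ : ∀ j x y, |φ j x - φ j y| ≤ ℓ * ‖x - y‖) (hℓ0 : 0 ≤ ℓ)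
    (hφ : ∀ j, Continuous (φ j))
    (hh : 0 < h) (hτ : 0 < τ) (hn : 0 < n) :
    ∃ bad : Set Ω, MeasurableSet bad ∧
      P.real bad ≤ Fintype.card ι * (2 * |ρ| / h + 2) ^ d * B ^ 2 / τ ^ 2 / n ∧
      ∀ ω ∉ bad, ∀ m : EuclideanSpace ℝ (Fin d), ‖m‖ ≤ ρ → ∀ j,
        |(n : ℝ)⁻¹ * ∑ i, φ j (m + G i ω) - ∫ x, φ j (m + x) ∂μ| ≤ τ + 2 * ℓ * (d * h) := by
  classical
  have hn' : (0 : ℝ) < n := by exact_mod_cast hn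
  obtain ⟨T, hT, hcov⟩ := exists_grid (d := d) (ρ := ρ) hh
  set ev : ι × EuclideanSpace ℝ (Fin d) → Set Ω := fun p =>
    {ω | τ ≤ |(n : ℝ)⁻¹ * ∑ i, φ p.1 (p.2 + G i ω) - ∫ x, φ p.1 (p.2 + x) ∂μ|} with hev
  set bad₀ : Set Ω := ⋃ p ∈ (Finset.univ ×ˢ T : Finset (ι × EuclideanSpace ℝ (Fin d))), ev p
    with hbad₀
  -- The sample is only almost everywhere measurable, so the event is replaced by a measurable hull
  -- of the same probability.
  refine ⟨toMeasurable P bad₀, measurableSet_toMeasurable _ _, ?_, fun ω hω m hm j => ?_⟩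
  · rw [measureReal_def, measure_toMeasurable, ← measureReal_def]
    calc P.real bad₀ ≤ ∑ p ∈ (Finset.univ ×ˢ T : Finset (ι × EuclideanSpace ℝ (Fin d))),
          P.real (ev p) := measureReal_biUnion_finset_le _ _
      _ ≤ ∑ _p ∈ (Finset.univ ×ˢ T : Finset (ι × EuclideanSpace ℝ (Fin d))),
          B ^ 2 / (n * τ ^ 2) := Finset.sum_le_sum fun p _ =>
            measureReal_empirical_dev_le hG hind (ψ := fun x => φ p.1 (p.2 + x))
              ((hφ p.1).comp (by fun_prop)).measurable (fun x => hB _ _) hτ hn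
      _ = Fintype.card ι * T.card * (B ^ 2 / (n * τ ^ 2)) := by
          rw [Finset.sum_const, Finset.card_product, nsmul_eq_mul]
          push_cast
          simp
      _ ≤ Fintype.card ι * (2 * |ρ| / h + 2) ^ d * (B ^ 2 / (n * τ ^ 2)) := by gcongr
      _ = _ := by field_simp
  · obtain ⟨t, ht, hmt⟩ := hcov m hm
    have hω' : ω ∉ ev (j, t) := fun hmem => hω (subset_toMeasurable _ _
      (Set.mem_biUnion (show (j, t) ∈ (Finset.univ ×ˢ T : Finset _) by simp [ht]) hmem))
    have h1 : |(n : ℝ)⁻¹ * ∑ i, φ j (t + G i ω) - ∫ x, φ j (t + x) ∂μ| ≤ τ :=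
      (not_le.1 hω').le
    -- Moving `m` to the grid point `t` costs this much in the empirical mean and as much in the
    -- expectation.
    have hlip : ∀ x, |φ j (m + x) - φ j (t + x)| ≤ ℓ * (d * h) := fun x => by
      refine (hℓ j _ _).trans ?_
      rw [add_sub_add_right_eq_sub]
      gcongr
    have h2 : |(n : ℝ)⁻¹ * ∑ i, φ j (m + G i ω) - (n : ℝ)⁻¹ * ∑ i, φ j (t + G i ω)|
        ≤ ℓ * (d * h) := by
      rw [← mul_sub, ← Finset.sum_sub_distrib, abs_mul, abs_of_pos (inv_pos.2 hn')]
      calc (n : ℝ)⁻¹ * |∑ i, (φ j (m + G i ω) - φ j (t + G i ω))|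
          ≤ (n : ℝ)⁻¹ * ∑ _i : Fin n, ℓ * (d * h) := by
            gcongr
            exact (Finset.abs_sum_le_sum_abs _ _).trans (Finset.sum_le_sum fun i _ => hlip _)
        _ = ℓ * (d * h) := by
            simp only [Finset.sum_const, Finset.card_univ, Fintype.card_fin, nsmul_eq_mul]
            field_simp
    have hi : ∀ y : EuclideanSpace ℝ (Fin d), Integrable (fun x => φ j (y + x)) μ := fun y =>
      Integrable.of_bound ((hφ j).comp (by fun_prop)).aestronglyMeasurable B
        (Filter.Eventually.of_forall fun x => hB _ _)
    have h3 : |∫ x, φ j (m + x) ∂μ - ∫ x, φ j (t + x) ∂μ| ≤ ℓ * (d * h) := by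
      rw [← integral_sub (hi m) (hi t), ← Real.norm_eq_abs]
      have := norm_integral_le_of_norm_le_const (μ := μ) (f := fun x => φ j (m + x) - φ j (t + x))
        (Filter.Eventually.of_forall hlip)
      simpa using this
    rw [abs_le] at h1 h2 h3 ⊢
    constructor <;> linarith [h1.1, h1.2, h2.1, h2.2, h3.1, h3.2]

end LLN

end

section

variable {d : ℕ}

/-! ### Contraction of the empirical consensus point -/

lemma integral_const_add_isoGaussian {F : Type*} [NormedAddCommGroup F] [NormedSpace ℝ F]
    (m : EuclideanSpace ℝ (Fin d)) (σ : ℝ) (g : EuclideanSpace ℝ (Fin d) → F) :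
    ∫ x, g (m + x) ∂(isoGaussian 0 σ) = ∫ x, g x ∂(isoGaussian m σ) := by
  rw [← isoGaussian_map_const_add m σ, ← MeasurableEquiv.coe_addLeft,
    (MeasurableEquiv.addLeft m).measurableEmbedding.integral_map]
  simp

/-- The functions whose empirical means determine the consensus point: the weight and the
coordinates of the weighted displacement from the minimizer. -/
def consensusFun (f : EuclideanSpace ℝ (Fin d) → ℝ) (xstar : EuclideanSpace ℝ (Fin d)) (α : ℝ) :
    Option (Fin d) → EuclideanSpace ℝ (Fin d) → ℝ
  | none, x => weight f xstar α x
  | some i, x => weight f xstar α x * (x - xstar) i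

variable {f : EuclideanSpace ℝ (Fin d) → ℝ} {xstar : EuclideanSpace ℝ (Fin d)}
  {a L κ β δ lam α : ℝ}

namespace GrowthAssumption

variable (hf : GrowthAssumption f xstar a L κ β)
include hf

lemma continuous_consensusFun (j : Option (Fin d)) : Continuous (consensusFun f xstar α j) := by
  have h := hf.continuous_weight (α := α)
  cases j with
  | none => exact h
  | some i =>
    unfold consensusFun
    fun_prop

lemma exists_weight_mul_le {g : EuclideanSpace ℝ (Fin d) → ℝ} (hg : HasPolyGrowth g) :
    ∃ C : ℝ, 0 < C ∧ ∀ α, 1 ≤ α → ∀ x, weight f xstar α x * |g x| ≤ C := by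
  have hκ := hf.κ_pos
  obtain ⟨C, hC, h⟩ := hg.exists_exp_neg_mul_le (c := κ / 2) (by positivity) hf.one_le_β xstar
  refine ⟨C, hC, fun α hα x => le_trans ?_ (h x)⟩
  gcongr
  exact hf.weight_le hα x

/-- The weight has derivative -α times itself times that of f, whose polynomial growth is absorbed
by the decay of the weight. So α enters only linearly, through the Lipschitz constant, and the cost
of the law of large numbers stays polynomial in α. -/
lemma exists_consensusFun_bounds : ∃ K : ℝ, 1 ≤ K ∧ ∀ α, 1 ≤ α → ∀ j,
    (∀ x, |consensusFun f xstar α j x| ≤ K) ∧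
    (∀ x y, |consensusFun f xstar α j x - consensusFun f xstar α j y| ≤ K * α * ‖x - y‖) ∧
    ∀ x, weight f xstar α x * ‖x - xstar‖ ≤ K := by
  have hn := HasPolyGrowth.norm_sub xstar
  have hL := hf.L_pos
  obtain ⟨C₁, hC₁, h₁⟩ := hf.exists_weight_mul_le hn
  obtain ⟨C₂, hC₂, h₂⟩ := hf.exists_weight_mul_le hf.hasPolyGrowth_bound
  obtain ⟨C₃, hC₃, h₃⟩ := hf.exists_weight_mul_le (hf.hasPolyGrowth_bound.mul hn)
  refine ⟨1 + C₁ + C₂ + C₃, by linarith, fun α hα j => ?_⟩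
  have hα0 : 0 ≤ α := by linarith
  have hw1 := hf.weight_le_one hα0
  have hw0 : ∀ x, 0 < weight f xstar α x := weight_pos
  have hb1 : ∀ x, weight f xstar α x * ‖x - xstar‖ ≤ C₁ := fun x => by
    simpa using h₁ α hα x
  have hb2 : ∀ x, weight f xstar α x * (L * (1 + ‖x‖ ^ a)) ≤ C₂ := fun x => by
    have := h₂ α hα x
    rwa [abs_of_nonneg (by positivity)] at this
  have hb3 : ∀ x, weight f xstar α x * (L * (1 + ‖x‖ ^ a) * ‖x - xstar‖) ≤ C₃ := fun x => by
    have := h₃ α hα x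
    rwa [abs_of_nonneg (by positivity)] at this
  have hdw : ∀ x, ‖weight f xstar α x • (-α • fderiv ℝ f x)‖
      ≤ α * (weight f xstar α x * (L * (1 + ‖x‖ ^ a))) := fun x => by
    rw [norm_smul, norm_smul, Real.norm_of_nonneg (hw0 x).le, norm_neg, Real.norm_of_nonneg hα0]
    calc weight f xstar α x * (α * ‖fderiv ℝ f x‖)
        ≤ weight f xstar α x * (α * (L * (1 + ‖x‖ ^ a))) := by
          have := (hw0 x).le
          gcongr
          exact hf.norm_fderiv_le x
      _ = _ := by ring
  have hcoord : ∀ (i : Fin d) (x : EuclideanSpace ℝ (Fin d)), |(x - xstar) i| ≤ ‖x - xstar‖ :=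
    fun i x => by simpa using PiLp.norm_apply_le (x - xstar) i
  refine ⟨fun x => ?_, fun x y => ?_, fun x => (hb1 x).trans (by linarith)⟩
  · cases j with
    | none =>
      simp only [consensusFun]
      rw [abs_of_pos (hw0 x)]
      linarith [hw1 x]
    | some i =>
      simp only [consensusFun]
      rw [abs_mul, abs_of_pos (hw0 x)]
      have := mul_le_mul_of_nonneg_left (hcoord i x) (hw0 x).le
      linarith [hb1 x]
  · have hlip : ∀ (φ : EuclideanSpace ℝ (Fin d) → ℝ)
        (φ' : EuclideanSpace ℝ (Fin d) → EuclideanSpace ℝ (Fin d) →L[ℝ] ℝ),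
        (∀ x, HasFDerivAt φ (φ' x) x) → (∀ x, ‖φ' x‖ ≤ (1 + C₁ + C₂ + C₃) * α) →
        |φ x - φ y| ≤ (1 + C₁ + C₂ + C₃) * α * ‖x - y‖ := fun φ φ' h1 h2 =>
      convex_univ.norm_image_sub_le_of_norm_hasFDerivWithin_le
        (fun z _ => (h1 z).hasFDerivWithinAt) (fun z _ => h2 z) (Set.mem_univ y) (Set.mem_univ x)
    cases j with
    | none =>
      refine hlip _ _ (fun z => hf.hasFDerivAt_weight z) fun z => (hdw z).trans ?_
      have := mul_le_mul_of_nonneg_left (hb2 z) hα0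
      nlinarith
    | some i =>
      have hc : ∀ z, HasFDerivAt (fun x : EuclideanSpace ℝ (Fin d) => (x - xstar) i)
          (EuclideanSpace.proj i : EuclideanSpace ℝ (Fin d) →L[ℝ] ℝ) z := fun z => by
        simpa using
          (EuclideanSpace.proj i : EuclideanSpace ℝ (Fin d) →L[ℝ] ℝ).hasFDerivAt.sub_const
            (xstar i)
      have hp : ‖(EuclideanSpace.proj i : EuclideanSpace ℝ (Fin d) →L[ℝ] ℝ)‖ ≤ 1 :=
        ContinuousLinearMap.opNorm_le_bound _ zero_le_one fun z => by
          simpa using PiLp.norm_apply_le z i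
      refine hlip _ _ (fun z => (hf.hasFDerivAt_weight z).mul (hc z)) fun z => ?_
      refine (norm_add_le _ _).trans ?_
      rw [norm_smul, norm_smul, Real.norm_of_nonneg (hw0 z).le, Real.norm_eq_abs]
      have e1 : weight f xstar α z * ‖(EuclideanSpace.proj i :
          EuclideanSpace ℝ (Fin d) →L[ℝ] ℝ)‖ ≤ 1 :=
        mul_le_one₀ (hw1 z) (norm_nonneg _) hp
      have e2 : |(z - xstar) i| * ‖weight f xstar α z • (-α • fderiv ℝ f z)‖ ≤ α * C₃ := by
        calc |(z - xstar) i| * ‖weight f xstar α z • (-α • fderiv ℝ f z)‖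
            ≤ ‖z - xstar‖ * (α * (weight f xstar α z * (L * (1 + ‖z‖ ^ a)))) :=
              mul_le_mul (hcoord i z) (hdw z) (norm_nonneg _) (norm_nonneg _)
          _ = α * (weight f xstar α z * (L * (1 + ‖z‖ ^ a) * ‖z - xstar‖)) := by ring
          _ ≤ α * C₃ := by
              gcongr
              exact hb3 z
      nlinarith [mul_nonneg (by linarith : (0:ℝ) ≤ α) hC₁.le,
        mul_nonneg (by linarith : (0:ℝ) ≤ α) hC₂.le]

end GrowthAssumption

/-- The displacement of the consensus point from the minimizer, through normalized weights. -/
lemma sum_weight_smul_consensus_sub {n : ℕ} (hn : 0 < n)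
    (x : Fin n → EuclideanSpace ℝ (Fin d)) :
    (∑ i, weight f xstar α (x i)) • (consensus f α x - xstar)
      = ∑ i, weight f xstar α (x i) • (x i - xstar) := by
  have hne : Nonempty (Fin n) := ⟨⟨0, hn⟩⟩
  have hw : ∀ y, weight f xstar α y = Real.exp (α * f xstar) * Real.exp (-α * f y) := by
    intro y
    rw [weight, ← Real.exp_add]
    congr 1
    ring
  have hpos : 0 < ∑ i, Real.exp (-α * f (x i)) :=
    Finset.sum_pos (fun i _ => Real.exp_pos _) Finset.univ_nonempty
  simp only [smul_sub, Finset.sum_sub_distrib, ← Finset.sum_smul, consensus]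
  congr 1
  simp only [hw, ← Finset.mul_sum, mul_smul, ← Finset.smul_sum]
  rw [smul_inv_smul₀ hpos.ne']

section

variable {Ω : Type*} [MeasurableSpace Ω] {P : Measure Ω} [IsProbabilityMeasure P] {n : ℕ}
  {G : Fin n → Ω → EuclideanSpace ℝ (Fin d)}

/-- Outside an event of probability `O(1/n)`, the empirical consensus point inherits the contraction
of the mean-field one, uniformly over the translates of the sample. -/
lemma exists_bad_event (hd : 1 ≤ d) (hf : GrowthAssumption f xstar a L κ β) {K : ℝ} (hK : 1 ≤ K)
    (hα : 1 ≤ α)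
    (hφ : ∀ j, (∀ x, |consensusFun f xstar α j x| ≤ K) ∧
      (∀ x y, |consensusFun f xstar α j x - consensusFun f xstar α j y| ≤ K * α * ‖x - y‖) ∧
      ∀ x, weight f xstar α x * ‖x - xstar‖ ≤ K)
    {σ ρ q b s T : ℝ} (hσ : σ ≠ 0) (hT : 0 < T) (hs : 0 < s) (hq : 0 ≤ q) (hb : 0 ≤ b)
    (hmean : ∀ m : EuclideanSpace ℝ (Fin d), ‖m‖ ≤ ρ →
      ∫ x, weight f xstar α x * (gaussKernel m (σ ^ 2) x * ‖x - xstar‖)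
        ≤ (q * ‖m - xstar‖ + b) * ∫ x, weight f xstar α x * gaussKernel m (σ ^ 2) x)
    (hlow : ∀ m : EuclideanSpace ℝ (Fin d), ‖m‖ ≤ ρ →
      1 / (2 * s) ≤ ∫ x, weight f xstar α x ∂(isoGaussian m σ))
    (hT1 : T ≤ 1 / (4 * s))
    (hT2 : ∀ m : EuclideanSpace ℝ (Fin d), ‖m‖ ≤ ρ → T * (q * ‖m - xstar‖ + b + d) ≤ b / (4 * s))
    (hG : ∀ i, HasLaw (G i) (isoGaussian 0 σ) P)
    (hind : Pairwise fun i j => IndepFun (G i) (G j) P) (hn : 0 < n) :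
    ∃ bad : Set Ω, MeasurableSet bad ∧
      P.real bad ≤ (d + 1) * (8 * |ρ| * (K * α * d) / T + 2) ^ d * K ^ 2 / (T / 2) ^ 2 / n ∧
      ∀ ω ∉ bad, ∀ m : EuclideanSpace ℝ (Fin d), ‖m‖ ≤ ρ →
        ‖consensus f α (fun i => m + G i ω) - xstar‖ ≤ q * ‖m - xstar‖ + 2 * b := by
  have hn' : (0 : ℝ) < n := by exact_mod_cast hn
  have hd' : (0 : ℝ) < d := by exact_mod_cast hd
  have hKα : 0 < K * α := by positivity
  -- The tolerance `T` is split evenly between the Chebyshev deviation and the discretization error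
  -- 2(Kα)dh.
  obtain ⟨bad, hbm, hbP, hbad⟩ := exists_uniform_lln (μ := isoGaussian 0 σ) (ρ := ρ)
    (h := T / (4 * (K * α) * d)) (τ := T / 2) hG hind
    (φ := consensusFun f xstar α) (fun j => (hφ j).1) (fun j => (hφ j).2.1) hKα.le
    hf.continuous_consensusFun (by positivity) (by positivity) hn
  refine ⟨bad, hbm, hbP.trans (le_of_eq ?_), fun ω hω m hm => ?_⟩
  · have e : 2 * |ρ| / (T / (4 * (K * α) * d)) = 8 * |ρ| * (K * α * d) / T := by
      field_simp
      ring
    rw [e]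
    simp
  have hdev : ∀ j, |(n : ℝ)⁻¹ * ∑ i, consensusFun f xstar α j (m + G i ω)
      - ∫ x, consensusFun f xstar α j x ∂(isoGaussian m σ)| ≤ T := by
    intro j
    have h1 := hbad ω hω m hm j
    rw [integral_const_add_isoGaussian] at h1
    refine h1.trans (le_of_eq ?_)
    field_simp
    norm_num
  set Zh : ℝ := (n : ℝ)⁻¹ * ∑ i, weight f xstar α (m + G i ω) with hZh
  set Zb : ℝ := ∫ x, weight f xstar α x ∂(isoGaussian m σ) with hZb
  set Nh : EuclideanSpace ℝ (Fin d) :=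
    (n : ℝ)⁻¹ • ∑ i, weight f xstar α (m + G i ω) • (m + G i ω - xstar) with hNh
  set Nb : EuclideanSpace ℝ (Fin d) :=
    ∫ x, weight f xstar α x • (x - xstar) ∂(isoGaussian m σ) with hNb
  have hcw := hf.continuous_weight (α := α)
  have iN : Integrable (fun x => weight f xstar α x • (x - xstar)) (isoGaussian m σ) :=
    Integrable.of_bound (by fun_prop) K (Filter.Eventually.of_forall fun x => by
      rw [norm_smul, Real.norm_of_nonneg (weight_pos x).le]
      exact (hφ none).2.2 x)
  have hZdev : |Zh - Zb| ≤ T := hdev none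
  have hNdev : ‖Nh - Nb‖ ≤ d * T := by
    refine (norm_le_sum_abs _).trans ?_
    calc ∑ i, |(Nh - Nb) i| ≤ ∑ _i : Fin d, T := Finset.sum_le_sum fun i _ => ?_
      _ = d * T := by simp
    have h1 := hdev (some i)
    have h2 : Nb i = ∫ x, consensusFun f xstar α (some i) x ∂(isoGaussian m σ) := by
      have := (EuclideanSpace.proj i : EuclideanSpace ℝ (Fin d) →L[ℝ] ℝ).integral_comp_comm iN
      exact this.symm
    have h3 : Nh i = (n : ℝ)⁻¹ * ∑ l, consensusFun f xstar α (some i) (m + G l ω) := by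
      simp [hNh, consensusFun]
    rw [PiLp.sub_apply, h2, h3]
    exact h1
  have hNb : ‖Nb‖ ≤ (q * ‖m - xstar‖ + b) * Zb := by
    obtain ⟨c, hc, hint⟩ := exists_integral_isoGaussian_eq m hσ
    calc ‖Nb‖ ≤ ∫ x, ‖weight f xstar α x • (x - xstar)‖ ∂(isoGaussian m σ) :=
          norm_integral_le_integral_norm _
      _ = c * ∫ x, weight f xstar α x * (gaussKernel m (σ ^ 2) x * ‖x - xstar‖) := by
          rw [hint]
          congr 2
          funext x
          rw [norm_smul, Real.norm_of_nonneg (weight_pos x).le]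
          ring
      _ ≤ c * ((q * ‖m - xstar‖ + b)
          * ∫ x, weight f xstar α x * gaussKernel m (σ ^ 2) x) := by
          gcongr
          exact hmean m hm
      _ = _ := by rw [hZb, hint]; ring
  have hlow' := hlow m hm
  have hZh0 : 1 / (4 * s) ≤ Zh := by
    have e : 1 / (2 * s) = 1 / (4 * s) + 1 / (4 * s) := by field_simp; norm_num
    have := (abs_le.1 hZdev).1
    linarith
  have hZpos : 0 < Zh := lt_of_lt_of_le (by positivity) hZh0
  have hid : Zh • (consensus f α (fun i => m + G i ω) - xstar) = Nh := by
    rw [hZh, hNh, mul_smul, sum_weight_smul_consensus_sub hn]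
  -- The errors in normalization and numerator add up to T(q‖m - x*‖ + b + d) ≤ b/(4s) ≤ b `Zh`,
  -- whence the second b.
  have hfin : Zh * ‖consensus f α (fun i => m + G i ω) - xstar‖
      ≤ Zh * (q * ‖m - xstar‖ + 2 * b) := by
    rw [← Real.norm_of_nonneg hZpos.le, ← norm_smul, Real.norm_of_nonneg hZpos.le, hid]
    have h1 : ‖Nh‖ ≤ ‖Nb‖ + ‖Nh - Nb‖ := by
      have := norm_add_le Nb (Nh - Nb)
      rwa [add_sub_cancel] at this
    have h2 : Zb ≤ Zh + T := by linarith [(abs_le.1 hZdev).1]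
    have h0 : 0 ≤ q * ‖m - xstar‖ + b := by positivity
    have h3 := mul_le_mul_of_nonneg_left h2 h0
    have h4 := hT2 m hm
    have h5 : b / (4 * s) ≤ b * Zh := by
      rw [div_eq_mul_one_div]
      gcongr
    nlinarith
  exact le_of_mul_le_mul_left hfin hZpos

end

end

section

variable {d : ℕ}

/-! ### Clipping and step sizes -/

lemma norm_clip_le {R : ℝ} (hR : 0 ≤ R) (x : EuclideanSpace ℝ (Fin d)) : ‖clip R x‖ ≤ R := by
  rcases eq_or_ne x 0 with rfl | hx
  · simpa [clip] using hR
  · have hx' : 0 < ‖x‖ := norm_pos_iff.2 hx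
    rw [clip, norm_smul, Real.norm_of_nonneg (by positivity), div_mul_cancel₀ _ hx'.ne']
    exact min_le_left _ _

/-- Clipping is the projection on a ball, hence does not increase the distance to its points. -/
lemma norm_clip_sub_le {R : ℝ} {y : EuclideanSpace ℝ (Fin d)} (hy : ‖y‖ ≤ R)
    (x : EuclideanSpace ℝ (Fin d)) : ‖clip R x - y‖ ≤ ‖x - y‖ := by
  rcases eq_or_ne x 0 with rfl | hx
  · simp [clip]
  have hx' : 0 < ‖x‖ := norm_pos_iff.2 hx
  rcases le_total ‖x‖ R with h | h
  · rw [clip, min_eq_right h, div_self hx'.ne', one_smul]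
  · rw [clip, min_eq_left h]
    set c := R / ‖x‖ with hc
    have hcx : c * ‖x‖ = R := div_mul_cancel₀ _ hx'.ne'
    have hc1 : c ≤ 1 := (div_le_one hx').2 h
    refine le_of_sq_le_sq ?_ (norm_nonneg _)
    rw [norm_sub_sq_real, norm_sub_sq_real, norm_smul, inner_smul_left, mul_pow, Real.norm_eq_abs,
      sq_abs]
    have h1 : inner ℝ x y ≤ ‖x‖ * R :=
      (real_inner_le_norm x y).trans (mul_le_mul_of_nonneg_left hy hx'.le)
    simp only [conj_trivial]
    -- The difference of the two squared distances is twice this quantity plus that of `h3`.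
    have h2 : 0 ≤ (1 - c) * (‖x‖ * R - inner ℝ x y) :=
      mul_nonneg (by linarith) (by linarith)
    have h3 : 0 ≤ (1 - c) * (‖x‖ * (‖x‖ - R)) :=
      mul_nonneg (by linarith) (mul_nonneg hx'.le (by linarith))
    have h4 : c ^ 2 * ‖x‖ ^ 2 = R * (c * ‖x‖) := by rw [← mul_pow, hcx]; ring
    nlinarith

lemma stepSize_pos {η₀ ζ : ℝ} (h0 : 0 < η₀) (k : ℕ) : 0 < stepSize η₀ ζ (k + 1) := by
  unfold stepSize
  positivity

lemma stepSize_le_one {η₀ ζ : ℝ} (h1 : η₀ ≤ 1) (hζ : 0 < ζ) (k : ℕ) :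
    stepSize η₀ ζ (k + 1) ≤ 1 := by
  unfold stepSize
  have : (1 : ℝ) ≤ ((k + 1 : ℕ) : ℝ) ^ ζ := Real.one_le_rpow (by push_cast; linarith) hζ.le
  exact div_le_one_of_le₀ (h1.trans this) (by linarith)

/-! ### Decomposition into a common drift and independent Gaussian fluctuations -/

/-- The variance of the fluctuations. -/
def varSeq (η₀ ζ γ α σ₀ : ℝ) : ℕ → ℝ
  | 0 => σ₀ ^ 2
  | k + 1 => (1 - stepSize η₀ ζ (k + 1)) ^ 2 * varSeq η₀ ζ γ α σ₀ k
      + 2 * stepSize η₀ ζ (k + 1) * γ / α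

section Variance

variable {η₀ ζ γ α σ₀ : ℝ}

/-- At the value γ/(2α) one step multiplies by (1 - η)² + 4η = (1 + η)² ≥ 1, so the noise outweighs
the contraction. -/
lemma le_varSeq (h0 : 0 < η₀) (h1 : η₀ ≤ 1) (hζ : 0 < ζ) (hγ : 0 < γ) (hα : 0 < α)
    (hσ : γ / (2 * α) ≤ σ₀ ^ 2) (k : ℕ) : γ / (2 * α) ≤ varSeq η₀ ζ γ α σ₀ k := by
  induction k with
  | zero => exact hσ
  | succ k ih =>
    have hs0 := stepSize_pos (ζ := ζ) h0 k
    have hs1 := stepSize_le_one h1 hζ k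
    simp only [varSeq]
    set η := stepSize η₀ ζ (k + 1)
    have hg : 0 < γ / (2 * α) := by positivity
    have e : 2 * η * γ / α = 4 * η * (γ / (2 * α)) := by field_simp; norm_num
    have := mul_le_mul_of_nonneg_left ih (sq_nonneg (1 - η))
    rw [e]
    nlinarith [mul_pos hs0 hg, mul_nonneg (sq_nonneg η) hg.le]

/-- The rate 3/4 is weaker than what (1 - η)² allows; it is that of the drift, so that both initial
errors carry the same product. -/
lemma varSeq_le (h0 : 0 < η₀) (h1 : η₀ ≤ 1) (hζ : 0 < ζ) (hγ : 0 < γ) (hα : 0 < α) (k : ℕ) :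
    varSeq η₀ ζ γ α σ₀ k ≤ 2 * γ / α
      + (∏ j ∈ Finset.range k, (1 - 3 / 4 * stepSize η₀ ζ (j + 1))) * σ₀ ^ 2 := by
  induction k with
  | zero => simp only [varSeq, Finset.range_zero, Finset.prod_empty, one_mul]
            have : 0 < 2 * γ / α := by positivity
            linarith
  | succ k ih =>
    have hs0 := stepSize_pos (ζ := ζ) h0 k
    have hs1 := stepSize_le_one h1 hζ k
    have hQ : 0 ≤ ∏ j ∈ Finset.range k, (1 - 3 / 4 * stepSize η₀ ζ (j + 1)) :=
      Finset.prod_nonneg fun j _ => by linarith [stepSize_le_one h1 hζ j]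
    rw [Finset.prod_range_succ]
    simp only [varSeq]
    have alg : ∀ η g v Q w : ℝ, 0 < η → η ≤ 1 → 0 < g → 0 ≤ Q * w → v ≤ 2 * g + Q * w →
        (1 - η) ^ 2 * v + 2 * η * g ≤ 2 * g + Q * (1 - 3 / 4 * η) * w := by
      intro η g v Q w hη hη1 hg hQw hv
      have h2 := mul_le_mul_of_nonneg_left hv (sq_nonneg (1 - η))
      have h3 : (1 - η) ^ 2 ≤ 1 - 3 / 4 * η := by nlinarith
      have h5 := mul_le_mul_of_nonneg_right h3 hQw
      have h6 : 0 ≤ η * (1 - η) * g := mul_nonneg (mul_nonneg hη.le (by linarith)) hg.le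
      nlinarith
    rw [mul_div_assoc] at ih ⊢
    rw [mul_div_assoc]
    exact alg _ _ _ _ _ hs0 hs1 (by positivity) (by positivity) ih

/-- Since (1 - η)² ≤ 1 - η, a step is dominated by a convex combination of the old variance and
2γ/α. -/
lemma varSeq_le_max (h0 : 0 < η₀) (h1 : η₀ ≤ 1) (hζ : 0 < ζ) (hγ : 0 < γ) (hα : 0 < α) (k : ℕ) :
    varSeq η₀ ζ γ α σ₀ k ≤ max (σ₀ ^ 2) (2 * γ / α) := by
  induction k with
  | zero => exact le_max_left _ _
  | succ k ih =>
    have hs0 := stepSize_pos (ζ := ζ) h0 k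
    have hs1 := stepSize_le_one h1 hζ k
    simp only [varSeq]
    set η := stepSize η₀ ζ (k + 1)
    set m := max (σ₀ ^ 2) (2 * γ / α) with hm
    have h2 := mul_le_mul_of_nonneg_left ih (sq_nonneg (1 - η))
    have h3 : 2 * γ / α ≤ m := le_max_right _ _
    have h4 := mul_le_mul_of_nonneg_left h3 hs0.le
    have e : 2 * η * γ / α = η * (2 * γ / α) := by ring
    have h5 : 0 ≤ m := (by positivity : 0 ≤ 2 * γ / α).trans h3
    have h6 : 0 ≤ η * (1 - η) * m := mul_nonneg (mul_nonneg hs0.le (by linarith)) h5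
    rw [e]
    nlinarith

end Variance

section Decomposition

variable {Ω : Type*} {n : ℕ}

/-- The centered Gaussian fluctuations of the particles. -/
def fluct (η₀ ζ γ α : ℝ) (m₀ : EuclideanSpace ℝ (Fin d))
    (X ξ : ℕ → Fin n → Ω → EuclideanSpace ℝ (Fin d)) :
    ℕ → Fin n → Ω → EuclideanSpace ℝ (Fin d)
  | 0, i, ω => X 0 i ω - m₀
  | k + 1, i, ω => (1 - stepSize η₀ ζ (k + 1)) • fluct η₀ ζ γ α m₀ X ξ k i ω
      + √(2 * stepSize η₀ ζ (k + 1) * γ / α) • ξ (k + 1) i ω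

/-- The drift common to all the particles. -/
def drift (f : EuclideanSpace ℝ (Fin d) → ℝ) (R α η₀ ζ : ℝ) (m₀ : EuclideanSpace ℝ (Fin d))
    (X : ℕ → Fin n → Ω → EuclideanSpace ℝ (Fin d)) : ℕ → Ω → EuclideanSpace ℝ (Fin d)
  | 0, _ => m₀
  | k + 1, ω => (1 - stepSize η₀ ζ (k + 1)) • drift f R α η₀ ζ m₀ X k ω
      + stepSize η₀ ζ (k + 1) • clip R (consensus f α fun j => X k j ω)

variable {f : EuclideanSpace ℝ (Fin d) → ℝ} {R α γ η₀ ζ σ₀ : ℝ} {m₀ : EuclideanSpace ℝ (Fin d)}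
  {X ξ : ℕ → Fin n → Ω → EuclideanSpace ℝ (Fin d)}

/-- Each step is a convex combination with a clipped point. This deterministic ball is the set of
translations for the uniform law of large numbers. -/
lemma norm_drift_le (h0 : 0 < η₀) (h1 : η₀ ≤ 1) (hζ : 0 < ζ) (hR : 0 ≤ R) (k : ℕ) (ω : Ω) :
    ‖drift f R α η₀ ζ m₀ X k ω‖ ≤ max R ‖m₀‖ := by
  induction k with
  | zero => exact le_max_right _ _
  | succ k ih =>
    have hs0 := stepSize_pos (ζ := ζ) h0 k
    have hs1 := stepSize_le_one h1 hζ k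
    simp only [drift]
    refine (norm_add_le _ _).trans ?_
    rw [norm_smul, norm_smul, Real.norm_of_nonneg hs0.le, Real.norm_of_nonneg (by linarith)]
    have h2 := (norm_clip_le hR (consensus f α fun j => X k j ω)).trans (le_max_left R ‖m₀‖)
    have h3 := mul_le_mul_of_nonneg_left ih (by linarith : 0 ≤ 1 - stepSize η₀ ζ (k + 1))
    have h4 := mul_le_mul_of_nonneg_left h2 hs0.le
    linarith

/-- A fluctuation is a function of the initial position and the noise of its own particle. -/
lemma exists_fluct_eq (k : ℕ) (i : Fin n) (S : Finset (Fin n ⊕ ℕ × Fin n))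
    (hi : Sum.inl i ∈ S) (hS : ∀ l < k, Sum.inr (l, i) ∈ S) :
    ∃ g : (S → EuclideanSpace ℝ (Fin d)) → EuclideanSpace ℝ (Fin d), Measurable g ∧
      fluct η₀ ζ γ α m₀ X ξ k i = g ∘ fun ω (s : S) =>
        Sum.elim (fun i : Fin n => X 0 i) (fun p : ℕ × Fin n => ξ (p.1 + 1) p.2) s ω := by
  induction k with
  | zero =>
    exact ⟨fun z => z ⟨Sum.inl i, hi⟩ - m₀, by fun_prop, rfl⟩
  | succ k ih =>
    obtain ⟨g, hg, he⟩ := ih fun l hl => hS l (by omega)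
    refine ⟨fun z => (1 - stepSize η₀ ζ (k + 1)) • g z
      + √(2 * stepSize η₀ ζ (k + 1) * γ / α) • z ⟨Sum.inr (k, i), hS k (by omega)⟩,
      by fun_prop, ?_⟩
    funext ω
    simp only [fluct, he]
    rfl

variable [MeasurableSpace Ω] {P : Measure Ω}

namespace IsClippedCBO

variable (h : IsClippedCBO P f R α γ η₀ ζ (isoGaussian m₀ σ₀) X ξ)
include h

lemma eq_drift_add_fluct (k : ℕ) (i : Fin n) (ω : Ω) :
    X k i ω = drift f R α η₀ ζ m₀ X k ω + fluct η₀ ζ γ α m₀ X ξ k i ω := by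
  induction k with
  | zero => simp [drift, fluct]
  | succ k ih =>
    rw [h.step, drift, fluct]
    have e : ∀ (η : ℝ) (x c M G N : EuclideanSpace ℝ (Fin d)), x = M + G →
        x + η • (c - x) + N = (1 - η) • M + η • c + ((1 - η) • G + N) := by
      rintro η x c M G N rfl
      module
    exact e _ _ _ _ _ _ ih

lemma aemeasurable_family (s : Fin n ⊕ ℕ × Fin n) :
    AEMeasurable (Sum.elim (fun i : Fin n => X 0 i)
      (fun p : ℕ × Fin n => ξ (p.1 + 1) p.2) s) P := by
  cases s with
  | inl i => exact (h.law_init i).aemeasurable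
  | inr p => exact (h.law_noise p.1 p.2).aemeasurable

lemma indepFun_fluct (k : ℕ) :
    Pairwise fun i j =>
      IndepFun (fluct η₀ ζ γ α m₀ X ξ k i) (fluct η₀ ζ γ α m₀ X ξ k j) P := by
  classical
  intro i j hij
  set S : Fin n → Finset (Fin n ⊕ ℕ × Fin n) := fun i =>
    insert (Sum.inl i) ((Finset.range k).image fun l => Sum.inr (l, i)) with hS
  have hdisj : Disjoint (S i) (S j) := by
    rw [Finset.disjoint_left]
    intro s hs hs'
    simp only [hS, Finset.mem_insert, Finset.mem_image] at hs hs'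
    rcases hs with rfl | ⟨l, _, rfl⟩ <;> simp_all
  obtain ⟨g, hg, he⟩ := exists_fluct_eq (η₀ := η₀) (ζ := ζ) (γ := γ) (α := α) (m₀ := m₀) (X := X)
    (ξ := ξ) k i (S i) (by simp [hS]) (by simp [hS])
  obtain ⟨g', hg', he'⟩ := exists_fluct_eq (η₀ := η₀) (ζ := ζ) (γ := γ) (α := α) (m₀ := m₀) (X := X)
    (ξ := ξ) k j (S j) (by simp [hS]) (by simp [hS])
  rw [he, he']
  exact (h.indep.indepFun_finset₀ (S i) (S j) hdisj h.aemeasurable_family).comp hg hg'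

lemma indepFun_fluct_noise (k : ℕ) (i : Fin n) :
    IndepFun (fluct η₀ ζ γ α m₀ X ξ k i) (ξ (k + 1) i) P := by
  classical
  -- The index `Sum.inr (l, i)` carries `ξ (l + 1) i`, so `Finset.range k` stops just before `ξ (k +
  -- 1) i`.
  set S : Finset (Fin n ⊕ ℕ × Fin n) :=
    insert (Sum.inl i) ((Finset.range k).image fun l => Sum.inr (l, i)) with hS
  have hdisj : Disjoint S {Sum.inr (k, i)} := by
    simp [hS]
  obtain ⟨g, hg, he⟩ := exists_fluct_eq (η₀ := η₀) (ζ := ζ) (γ := γ) (α := α) (m₀ := m₀) (X := X)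
    (ξ := ξ) k i S (by simp [hS]) (by simp [hS])
  rw [he]
  exact (h.indep.indepFun_finset₀ S {Sum.inr (k, i)} hdisj h.aemeasurable_family).comp hg
    (measurable_pi_apply (⟨Sum.inr (k, i), by simp⟩ :
      ({Sum.inr (k, i)} : Finset (Fin n ⊕ ℕ × Fin n))))

lemma hasLaw_fluct [IsProbabilityMeasure P] (h0 : 0 < η₀) (hγ : 0 < γ) (hα : 0 < α)
    (k : ℕ) (i : Fin n) :
    HasLaw (fluct η₀ ζ γ α m₀ X ξ k i) (isoGaussian 0 (√(varSeq η₀ ζ γ α σ₀ k))) P := by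
  have hv : ∀ k, 0 ≤ varSeq η₀ ζ γ α σ₀ k := by
    intro k
    induction k with
    | zero => exact sq_nonneg _
    | succ k ih =>
      have := stepSize_pos (ζ := ζ) h0 k
      simp only [varSeq]
      positivity
  induction k with
  | zero =>
    have hm := (h.law_init i).aemeasurable
    refine ⟨hm.sub_const m₀, ?_⟩
    have e : (fluct η₀ ζ γ α m₀ X ξ 0 i) = (fun x => -m₀ + x) ∘ X 0 i := by
      funext ω
      simp only [fluct, Function.comp_apply]
      abel
    rw [e, ← AEMeasurable.map_map_of_aemeasurable (by fun_prop) hm, (h.law_init i).map_eq]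
    apply Measure.ext_of_charFun
    funext t
    rw [charFun_map_const_add, charFun_isoGaussian, charFun_isoGaussian, ← Complex.exp_add,
      Real.sq_sqrt (hv 0), inner_neg_left, real_inner_comm, inner_zero_right]
    congr 1
    simp only [varSeq]
    push_cast
    ring
  | succ k ih =>
    have hs := stepSize_pos (ζ := ζ) h0 k
    have hξ := h.law_noise k i
    rw [stdGaussian_eq_isoGaussian] at hξ
    refine hasLaw_smul_add_smul ih hξ (h.indepFun_fluct_noise k i) ?_
    rw [Real.sq_sqrt (hv _), Real.sq_sqrt (hv _), Real.sq_sqrt (by positivity), varSeq]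
    ring

lemma aemeasurable_drift (hf : Continuous f)
    (hG : ∀ k i, AEMeasurable (fluct η₀ ζ γ α m₀ X ξ k i) P) (k : ℕ) :
    AEMeasurable (drift f R α η₀ ζ m₀ X k) P := by
  induction k with
  | zero => exact aemeasurable_const
  | succ k ih =>
    have hX : ∀ j, AEMeasurable (fun ω => X k j ω) P := fun j => by
      simp only [h.eq_drift_add_fluct k j]
      exact ih.add (hG k j)
    have hc : Measurable fun x : Fin n → EuclideanSpace ℝ (Fin d) => clip R (consensus f α x) := by
      unfold clip consensus
      fun_prop
    have e : drift f R α η₀ ζ m₀ X (k + 1) = fun ω =>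
        (1 - stepSize η₀ ζ (k + 1)) • drift f R α η₀ ζ m₀ X k ω
        + stepSize η₀ ζ (k + 1) • clip R (consensus f α fun j => X k j ω) := by
      funext ω
      rw [drift]
    rw [e]
    have hcl : AEMeasurable (fun ω => clip R (consensus f α fun j => X k j ω)) P :=
      hc.comp_aemeasurable (aemeasurable_pi_lambda _ hX)
    generalize stepSize η₀ ζ (k + 1) = η
    fun_prop

end IsClippedCBO

end Decomposition

end

section

variable {d : ℕ}

/-! ### The second moment recursion -/

/-- One step of the drift, squared: `y` and `y'` are the distances to the minimizer before and after
the step, `t` that of the clipped consensus point. -/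
lemma sq_step_le {η q B R y y' t e : ℝ} (hη0 : 0 < η) (hη1 : η ≤ 1) (hq0 : 0 ≤ q) (hq : q ≤ 1 / 4)
    (hy' : 0 ≤ y') (ht0 : 0 ≤ t) (he : e ^ 2 = e)
    (ht : t ≤ q * y + B + 2 * R * e) (hstep : y' ≤ (1 - η) * y + η * t) :
    y' ^ 2 ≤ (1 - 3 / 4 * η) * y ^ 2 + η * (3 * B ^ 2 + 12 * R ^ 2 * e) := by
  have h1 : y' ^ 2 ≤ ((1 - η) * y + η * t) ^ 2 := by gcongr
  have h2 : ((1 - η) * y + η * t) ^ 2 ≤ (1 - η) * y ^ 2 + η * t ^ 2 := by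
    nlinarith [mul_nonneg (mul_nonneg hη0.le (sub_nonneg.2 hη1)) (sq_nonneg (y - t))]
  have h3 : t ^ 2 ≤ (q * y + B + 2 * R * e) ^ 2 := by gcongr
  have h4 : (q * y + B + 2 * R * e) ^ 2 ≤ 3 * (q * y) ^ 2 + 3 * B ^ 2 + 3 * (2 * R * e) ^ 2 := by
    nlinarith [sq_nonneg (q * y - B), sq_nonneg (q * y - 2 * R * e), sq_nonneg (B - 2 * R * e)]
  have h5 : (2 * R * e) ^ 2 = 4 * R ^ 2 * e := by rw [mul_pow, he]; ring
  have h6 : (q * y) ^ 2 ≤ 1 / 16 * y ^ 2 := by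
    rw [mul_pow]
    gcongr
    nlinarith
  -- Here 3q² ≤ 3/16 ≤ 1/4, so the coefficient of y² becomes 1 - η + η/4.
  have h7 : t ^ 2 ≤ 1 / 4 * y ^ 2 + (3 * B ^ 2 + 12 * R ^ 2 * e) := by
    nlinarith [sq_nonneg y]
  have h8 := mul_le_mul_of_nonneg_left h7 hη0.le
  linarith

/-- The solution of the linear recursion satisfied by the second moments. -/
lemma le_prod_mul_add {u η : ℕ → ℝ} {c : ℝ} (hη : ∀ k, η k ≤ 1) (hc : 0 ≤ c)
    (h : ∀ k, u (k + 1) ≤ (1 - 3 / 4 * η k) * u k + η k * c) (k : ℕ) :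
    u k ≤ (∏ j ∈ Finset.range k, (1 - 3 / 4 * η j)) * u 0 + 4 / 3 * c := by
  -- The value 4c/3 is the fixed point of every step of the recursion.
  induction k with
  | zero => simp; positivity
  | succ k ih =>
    rw [Finset.prod_range_succ]
    refine (h k).trans ?_
    have := mul_le_mul_of_nonneg_left ih (by linarith [hη k] : 0 ≤ 1 - 3 / 4 * η k)
    linarith

variable {Ω : Type*} {n : ℕ} [MeasurableSpace Ω] {P : Measure Ω} [IsProbabilityMeasure P]
  {f : EuclideanSpace ℝ (Fin d) → ℝ} {R α γ η₀ ζ σ₀ : ℝ} {m₀ xstar : EuclideanSpace ℝ (Fin d)}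
  {X ξ : ℕ → Fin n → Ω → EuclideanSpace ℝ (Fin d)}

/-- If the empirical consensus point contracts outside events of probability at most `p`, then the
second moments are bounded uniformly in time. -/
theorem IsClippedCBO.second_moment_le
    (h : IsClippedCBO P f R α γ η₀ ζ (isoGaussian m₀ σ₀) X ξ) (hfc : Continuous f)
    (h0 : 0 < η₀) (h1 : η₀ ≤ 1) (hζ : 0 < ζ) (hγ : 0 < γ) (hα : 0 < α)
    (hσ : γ / (2 * α) ≤ σ₀ ^ 2) (hx : ‖xstar‖ ≤ R)
    {q B p : ℝ} (hq0 : 0 ≤ q) (hq : q ≤ 1 / 4) (hB : 0 ≤ B)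
    (hbad : ∀ k, ∃ bad : Set Ω, MeasurableSet bad ∧ P.real bad ≤ p ∧ ∀ ω ∉ bad,
      ‖consensus f α (fun j => X k j ω) - xstar‖
        ≤ q * ‖drift f R α η₀ ζ m₀ X k ω - xstar‖ + B) (k : ℕ) (i : Fin n) :
    Integrable (fun ω => ‖X k i ω - xstar‖ ^ 2) P ∧
      ∫ ω, ‖X k i ω - xstar‖ ^ 2 ∂P ≤
        2 * ((∏ j ∈ Finset.range k, (1 - 3 / 4 * stepSize η₀ ζ (j + 1))) * ‖m₀ - xstar‖ ^ 2
          + 4 * B ^ 2 + 16 * R ^ 2 * p) + 2 * (d * varSeq η₀ ζ γ α σ₀ k) := by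
  have hR : 0 ≤ R := (norm_nonneg _).trans hx
  set M := drift f R α η₀ ζ m₀ X with hM
  set G := fluct η₀ ζ γ α m₀ X ξ with hG
  have hlaw := fun k i => h.hasLaw_fluct h0 hγ hα k i
  have hGm : ∀ k i, AEMeasurable (G k i) P := fun k i => (hlaw k i).aemeasurable
  have hMm := h.aemeasurable_drift hfc hGm
  have hMb : ∀ k ω, ‖M k ω‖ ≤ max R ‖m₀‖ := norm_drift_le h0 h1 hζ hR
  have hp0 : 0 ≤ p := by
    obtain ⟨bad, _, hb, _⟩ := hbad 0
    exact measureReal_nonneg.trans hb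
  have hMint : ∀ k, Integrable (fun ω => ‖M k ω - xstar‖ ^ 2) P := fun k => by
    refine Integrable.of_bound (((hMm k).sub_const _).norm.pow_const 2).aestronglyMeasurable
      ((max R ‖m₀‖ + ‖xstar‖) ^ 2) (Filter.Eventually.of_forall fun ω => ?_)
    rw [Real.norm_of_nonneg (by positivity)]
    gcongr
    exact (norm_sub_le _ _).trans (by gcongr; exact hMb k ω)
  have hrec : ∀ k, ∫ ω, ‖M (k + 1) ω - xstar‖ ^ 2 ∂P
      ≤ (1 - 3 / 4 * stepSize η₀ ζ (k + 1)) * ∫ ω, ‖M k ω - xstar‖ ^ 2 ∂P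
        + stepSize η₀ ζ (k + 1) * (3 * B ^ 2 + 12 * R ^ 2 * p) := by
    intro k
    obtain ⟨bad, hbm, hbP, hb⟩ := hbad k
    have hs0 := stepSize_pos (ζ := ζ) h0 k
    have hs1 := stepSize_le_one h1 hζ k
    have hMs : ∀ ω, M (k + 1) ω = (1 - stepSize η₀ ζ (k + 1)) • M k ω
        + stepSize η₀ ζ (k + 1) • clip R (consensus f α fun j => X k j ω) := fun ω => by
      rw [hM, drift]
    generalize stepSize η₀ ζ (k + 1) = η at *
    have hpt : ∀ ω, ‖M (k + 1) ω - xstar‖ ^ 2 ≤ (1 - 3 / 4 * η) * ‖M k ω - xstar‖ ^ 2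
        + (η * (3 * B ^ 2) + η * (12 * R ^ 2) * bad.indicator (fun _ => (1 : ℝ)) ω) := by
      intro ω
      have hstep : ‖M (k + 1) ω - xstar‖ ≤ (1 - η) * ‖M k ω - xstar‖
          + η * ‖clip R (consensus f α fun j => X k j ω) - xstar‖ := by
        have e : M (k + 1) ω - xstar = (1 - η) • (M k ω - xstar)
            + η • (clip R (consensus f α fun j => X k j ω) - xstar) := by
          rw [hMs]; module
        rw [e]
        refine (norm_add_le _ _).trans (le_of_eq ?_)
        rw [norm_smul, norm_smul, Real.norm_of_nonneg hs0.le, Real.norm_of_nonneg (by linarith)]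
      have he : (bad.indicator (fun _ => (1 : ℝ)) ω) ^ 2 = bad.indicator (fun _ => (1 : ℝ)) ω := by
        by_cases hω : ω ∈ bad <;> simp [hω]
      have ht : ‖clip R (consensus f α fun j => X k j ω) - xstar‖
          ≤ q * ‖M k ω - xstar‖ + B + 2 * R * bad.indicator (fun _ => (1 : ℝ)) ω := by
        -- On the bad event clipping alone gives 2R; off it, clipping does not increase the distance
        -- to `xstar`.
        by_cases hω : ω ∈ bad
        · have h2 : ‖clip R (consensus f α fun j => X k j ω) - xstar‖ ≤ 2 * R := by
            refine (norm_sub_le _ _).trans ?_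
            linarith [norm_clip_le hR (consensus f α fun j => X k j ω)]
          have h3 : 0 ≤ q * ‖M k ω - xstar‖ := by positivity
          rw [Set.indicator_of_mem hω]
          linarith
        · rw [Set.indicator_of_notMem hω, mul_zero, add_zero]
          exact (norm_clip_sub_le hx _).trans (hb ω hω)
      have := sq_step_le hs0 hs1 hq0 hq (norm_nonneg _) (norm_nonneg _) he ht hstep
      linarith
    have hind : Integrable (bad.indicator fun _ => (1 : ℝ)) P :=
      (integrable_const _).indicator hbm
    have iC : Integrable (fun ω => η * (3 * B ^ 2)
        + η * (12 * R ^ 2) * bad.indicator (fun _ => (1 : ℝ)) ω) P :=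
      (integrable_const _).add (hind.const_mul _)
    have hmono := integral_mono (hMint (k + 1)) (((hMint k).const_mul _).add iC) hpt
    refine hmono.trans ?_
    simp only [Pi.add_apply]
    rw [integral_add ((hMint k).const_mul _) iC, integral_const_mul,
      integral_add (integrable_const _) (hind.const_mul _), integral_const, integral_const_mul,
      integral_indicator_const _ hbm]
    simp only [probReal_univ, smul_eq_mul, mul_one]
    have : η * (12 * R ^ 2) * P.real bad ≤ η * (12 * R ^ 2) * p := by gcongr
    linarith
  have hMk := le_prod_mul_add (u := fun k => ∫ ω, ‖M k ω - xstar‖ ^ 2 ∂P)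
    (η := fun k => stepSize η₀ ζ (k + 1)) (fun k => stepSize_le_one h1 hζ k) (by positivity) hrec k
  have hM0 : ∫ ω, ‖M 0 ω - xstar‖ ^ 2 ∂P = ‖m₀ - xstar‖ ^ 2 := by
    simp [hM, drift]
  simp only [hM0] at hMk
  have hvk : 0 ≤ varSeq η₀ ζ γ α σ₀ k :=
    (by positivity : 0 ≤ γ / (2 * α)).trans (le_varSeq h0 h1 hζ hγ hα hσ k)
  have hn2 := integrable_norm_sq_isoGaussian (0 : EuclideanSpace ℝ (Fin d))
    (√(varSeq η₀ ζ γ α σ₀ k))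
  have hGint : Integrable (fun ω => ‖G k i ω‖ ^ 2) P := by
    rw [← (hlaw k i).map_eq] at hn2
    exact hn2.comp_aemeasurable (hGm k i)
  have hGval : ∫ ω, ‖G k i ω‖ ^ 2 ∂P = d * varSeq η₀ ζ γ α σ₀ k := by
    have := integral_norm_sq_isoGaussian (0 : EuclideanSpace ℝ (Fin d)) (√(varSeq η₀ ζ γ α σ₀ k))
    rw [Real.sq_sqrt hvk, ← (hlaw k i).map_eq, integral_map (hGm k i) (by fun_prop)] at this
    simpa using this
  -- Drift and fluctuation need not be independent, so the cross term is paid for with a factor 2.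
  have hpt : ∀ ω, ‖X k i ω - xstar‖ ^ 2 ≤ 2 * ‖M k ω - xstar‖ ^ 2 + 2 * ‖G k i ω‖ ^ 2 := by
    intro ω
    rw [h.eq_drift_add_fluct k i ω, add_sub_right_comm]
    have h2 := norm_add_le (M k ω - xstar) (G k i ω)
    have h3 : ‖M k ω - xstar + G k i ω‖ ^ 2 ≤ (‖M k ω - xstar‖ + ‖G k i ω‖) ^ 2 := by gcongr
    nlinarith [sq_nonneg (‖M k ω - xstar‖ - ‖G k i ω‖)]
  have hXm : AEMeasurable (fun ω => X k i ω) P := by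
    simp only [h.eq_drift_add_fluct k i]
    exact (hMm k).add (hGm k i)
  have hbint : Integrable (fun ω => 2 * ‖M k ω - xstar‖ ^ 2 + 2 * ‖G k i ω‖ ^ 2) P :=
    ((hMint k).const_mul 2).add (hGint.const_mul 2)
  have hXint : Integrable (fun ω => ‖X k i ω - xstar‖ ^ 2) P :=
    hbint.mono' ((hXm.sub_const _).norm.pow_const 2).aestronglyMeasurable
      (Filter.Eventually.of_forall fun ω => by
        rw [Real.norm_of_nonneg (by positivity)]; exact hpt ω)
  refine ⟨hXint, (integral_mono hXint hbint hpt).trans ?_⟩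
  rw [integral_add ((hMint k).const_mul 2) (hGint.const_mul 2), integral_const_mul,
    integral_const_mul, hGval]
  linarith

end

section

variable {d : ℕ}

/-! ### Comparison of the constants -/

/-- The tolerance used in the law of large numbers makes the constant there polynomial in `s`. -/
lemma exists_lln_constant_le (hd : 1 ≤ d) {lam c K : ℝ} (hlam : 0 < lam) (hc : 0 < c)
    (hK : 1 ≤ K) :
    ∃ s₀ : ℝ, 1 ≤ s₀ ∧ ∀ s α C ρ b : ℝ, s₀ ≤ s → 0 < α → α ≤ c * s → 0 ≤ C → C ≤ s → 0 ≤ ρ →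
      ρ ≤ s → b = √(4 * d / (α * lam)) → ∀ T : ℝ, T = b / (4 * s * (C + b + d)) →
      (d + 1) * (8 * ρ * (K * α * d) / T + 2) ^ d * K ^ 2 / (T / 2) ^ 2 ≤ Real.exp s := by
  have hd' : (1 : ℝ) ≤ d := by exact_mod_cast hd
  -- `Q * s ^ 3` will bound 1/T. With ρ ≤ s and α ≤ cs the base of the d-th power is of order s⁵,
  -- and 1/T² of order s⁶: hence the exponent 5d + 6.
  set Q : ℝ := 4 * (1 + (1 + d) * (1 + lam * c)) with hQ
  have hQ0 : 0 < Q := by positivity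
  set H : ℝ := (d + 1) * (8 * K * c * d * Q + 2) ^ d * K ^ 2 * (4 * Q ^ 2) with hH
  have hH0 : 0 < H := by positivity
  have hlim : Filter.Tendsto (fun s : ℝ => H * (s ^ (5 * d + 6) * Real.exp (-s))) Filter.atTop
      (nhds 0) := by
    simpa using (Real.tendsto_pow_mul_exp_neg_atTop_nhds_zero (5 * d + 6)).const_mul H
  obtain ⟨s₀, hs₀⟩ := Filter.eventually_atTop.1 (hlim.eventually (gt_mem_nhds one_pos))
  refine ⟨max s₀ 1, le_max_right _ _, ?_⟩
  intro s α C ρ b hs hα hαs hC hCs hρ hρs hb T hT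
  have hs1 : 1 ≤ s := (le_max_right _ _).trans hs
  have hs0 : 0 < s := by linarith
  have hb0 : 0 < b := by rw [hb]; exact Real.sqrt_pos.2 (by positivity)
  have hbinv : 1 / b ≤ 1 + lam * c * s := by
    rw [div_le_iff₀ hb0]
    have hu : 0 < 4 * d / (α * lam) := by positivity
    have h1 : 1 ≤ (1 + lam * c * s) * b := by
      have hsq : 1 ≤ (1 + lam * c * s) * (4 * d / (α * lam)) := by
        rw [← mul_div_assoc, one_le_div (by positivity)]
        have h2 : α * lam ≤ lam * c * s := by nlinarith
        have h3 : 0 < lam * c * s := by positivity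
        calc α * lam ≤ (1 + lam * c * s) * 1 := by linarith
          _ ≤ (1 + lam * c * s) * (4 * d) := by gcongr; linarith
      have h2 : 1 ≤ (1 + lam * c * s) ^ 2 * b ^ 2 := by
        rw [hb, Real.sq_sqrt hu.le, pow_two, mul_assoc]
        have : 1 ≤ 1 + lam * c * s := by have : 0 < lam * c * s := by positivity
                                         linarith
        nlinarith
      rw [← mul_pow] at h2
      exact (one_le_sq_iff₀ (by positivity)).1 h2
    exact h1
  have hT0 : 0 < T := by rw [hT]; positivity
  have hTinv : 1 / T ≤ Q * s ^ 3 := by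
    have e : 1 / T = 4 * s * (1 + (C + d) * (1 / b)) := by
      rw [hT]
      field_simp
      ring
    rw [e]
    have h1 : C + d ≤ (1 + d) * s := by nlinarith
    have h2 : 1 + lam * c * s ≤ (1 + lam * c) * s := by
      have : 0 < lam * c := by positivity
      nlinarith
    have h3 : (C + d) * (1 / b) ≤ ((1 + d) * s) * ((1 + lam * c) * s) :=
      mul_le_mul h1 (hbinv.trans h2) (by positivity) (by positivity)
    have h4 : (1 : ℝ) ≤ s ^ 2 := one_le_pow₀ hs1
    calc 4 * s * (1 + (C + d) * (1 / b))
        ≤ 4 * s * (s ^ 2 + ((1 + d) * s) * ((1 + lam * c) * s)) := by gcongr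
      _ = Q * s ^ 3 := by rw [hQ]; ring
  have h5 : 8 * ρ * (K * α * d) / T + 2 ≤ (8 * K * c * d * Q + 2) * s ^ 5 := by
    have h6 : (1 : ℝ) ≤ s ^ 5 := one_le_pow₀ hs1
    calc 8 * ρ * (K * α * d) / T + 2 = 8 * ρ * (K * α * d) * (1 / T) + 2 := by ring
      _ ≤ 8 * s * (K * (c * s) * d) * (Q * s ^ 3) + 2 * s ^ 5 := by
          gcongr
          linarith
      _ = _ := by ring
  have h7 : 1 / (T / 2) ^ 2 ≤ 4 * Q ^ 2 * s ^ 6 := by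
    calc 1 / (T / 2) ^ 2 = 4 * (1 / T) ^ 2 := by field_simp; norm_num
      _ ≤ 4 * (Q * s ^ 3) ^ 2 := by gcongr
      _ = _ := by ring
  have hfin := (hs₀ s ((le_max_left _ _).trans hs)).le
  calc (d + 1) * (8 * ρ * (K * α * d) / T + 2) ^ d * K ^ 2 / (T / 2) ^ 2
      = (d + 1) * (8 * ρ * (K * α * d) / T + 2) ^ d * K ^ 2 * (1 / (T / 2) ^ 2) := by ring
    _ ≤ (d + 1) * ((8 * K * c * d * Q + 2) * s ^ 5) ^ d * K ^ 2 * (4 * Q ^ 2 * s ^ 6) := by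
        gcongr
    _ = H * s ^ (5 * d + 6) := by rw [hH, mul_pow, ← pow_mul, pow_add]; ring
    _ ≤ Real.exp s := by
        rw [Real.exp_neg, ← mul_assoc, ← div_eq_mul_inv, div_le_one (Real.exp_pos _)] at hfin
        exact hfin

/-! ### Block length, sums of step sizes and the exponential rate. -/

lemma log_le_T₁ {lam γ : ℝ} (hlam : 0 < lam) (hγ : 0 < γ) : Real.log 72 ≤ T₁ lam γ := by
  have h : 0 < Real.log 72 := Real.log_pos (by norm_num)
  have h2 : 0 < 2 / (lam * γ) := by positivity
  rw [T₁, c₁, one_div, inv_inv]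
  nlinarith

/-- With log 72 ≤ T₁ this gives log 2 / T₁ ≤ 1/4: the claimed rate is at most a third of the rate
3/4 of the drift. -/
lemma four_mul_log_two_le : 4 * Real.log 2 ≤ Real.log 72 := by
  have : 4 * Real.log 2 = Real.log (2 ^ 4) := by rw [Real.log_pow]; norm_num
  rw [this]
  exact Real.log_le_log (by norm_num) (by norm_num)

lemma T₁_pos {lam γ : ℝ} (hlam : 0 < lam) (hγ : 0 < γ) : 0 < T₁ lam γ :=
  (Real.log_pos (by norm_num)).trans_le (log_le_T₁ hlam hγ)

lemma sum_stepSize_ge {η₀ ζ : ℝ} (h0 : 0 < η₀) (hζ : 0 < ζ) (hζ1 : ζ < 1) (k : ℕ) :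
    η₀ / (1 - ζ) * ((k : ℝ) ^ (1 - ζ) - 1) ≤ ∑ j ∈ Finset.range k, stepSize η₀ ζ (j + 1) := by
  have hz : 0 < 1 - ζ := by linarith
  -- With the shift by one, the induction starts from 0 = 0 and Bernoulli's inequality bounds each
  -- increment by a step size.
  have hstrong : ∀ k : ℕ, η₀ / (1 - ζ) * (((k : ℝ) + 1) ^ (1 - ζ) - 1)
      ≤ ∑ j ∈ Finset.range k, stepSize η₀ ζ (j + 1) := by
    intro k
    induction k with
    | zero => simp
    | succ k ih =>
      rw [Finset.sum_range_succ]
      have hk : (0 : ℝ) < (k : ℝ) + 1 := by positivity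
      have hb : ((k : ℝ) + 1 + 1) ^ (1 - ζ) - ((k : ℝ) + 1) ^ (1 - ζ)
          ≤ (1 - ζ) * ((k : ℝ) + 1) ^ (-ζ) := by
        have h1 : (1 + 1 / ((k : ℝ) + 1)) ^ (1 - ζ) ≤ 1 + (1 - ζ) * (1 / ((k : ℝ) + 1)) :=
          rpow_one_add_le_one_add_mul_self (by
            have : 0 < 1 / ((k : ℝ) + 1) := by positivity
            linarith) hz.le (by linarith)
        have e : (k : ℝ) + 1 + 1 = ((k : ℝ) + 1) * (1 + 1 / ((k : ℝ) + 1)) := by field_simp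
        have e2 : ((k : ℝ) + 1) ^ (-ζ) = ((k : ℝ) + 1) ^ (1 - ζ) * (1 / ((k : ℝ) + 1)) := by
          rw [show -ζ = (1 - ζ) - 1 by ring, Real.rpow_sub_one hk.ne']
          ring
        rw [e, Real.mul_rpow hk.le (by positivity), e2]
        have h2 : 0 < ((k : ℝ) + 1) ^ (1 - ζ) := by positivity
        nlinarith
      have hs : stepSize η₀ ζ (k + 1) = η₀ * ((k : ℝ) + 1) ^ (-ζ) := by
        rw [stepSize, Real.rpow_neg (by positivity), div_eq_mul_inv]
        push_cast
        rfl
      have h3 : η₀ / (1 - ζ) * (((k : ℝ) + 1 + 1) ^ (1 - ζ) - ((k : ℝ) + 1) ^ (1 - ζ))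
          ≤ stepSize η₀ ζ (k + 1) := by
        rw [hs]
        calc _ ≤ η₀ / (1 - ζ) * ((1 - ζ) * ((k : ℝ) + 1) ^ (-ζ)) := by gcongr
          _ = _ := by field_simp
      push_cast
      linarith
  refine le_trans ?_ (hstrong k)
  gcongr
  linarith

/-- The decay of the drift beats the rate `1 + c₂`. -/
lemma exists_prod_le {η₀ ζ : ℝ} (h0 : 0 < η₀) (h1 : η₀ ≤ 1) (hζ : 0 < ζ) (hζ1 : ζ < 1) :
    ∃ K₀ : ℕ, ∀ k, K₀ ≤ k → ∀ lam γ : ℝ, 0 < lam → 0 < γ →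
      2 * (∏ j ∈ Finset.range k, (1 - 3 / 4 * stepSize η₀ ζ (j + 1)))
        ≤ 1 / (1 + c₂ lam γ η₀ ζ) ^ ((k : ℝ) ^ (1 - ζ)) := by
  have hz : 0 < 1 - ζ := by linarith
  have hlim : Filter.Tendsto (fun k : ℕ => (k : ℝ) ^ (1 - ζ)) Filter.atTop Filter.atTop :=
    (tendsto_rpow_atTop hz).comp tendsto_natCast_atTop_atTop
  -- From here on the margin between the rates 3/4 and 1/4 absorbs log 2 and the -1 of the sum. The
  -- threshold involves neither λ nor γ.
  obtain ⟨K₀, hK₀⟩ := Filter.eventually_atTop.1 (hlim.eventually_ge_atTop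
    ((Real.log 2 + 3 / 4 * (η₀ / (1 - ζ))) * 2 / (η₀ / (1 - ζ))))
  refine ⟨K₀, fun k hk lam γ hlam hγ => ?_⟩
  have hT := T₁_pos hlam hγ
  have hT4 : 4 * Real.log 2 ≤ T₁ lam γ := four_mul_log_two_le.trans (log_le_T₁ hlam hγ)
  have hu : 0 < η₀ / (1 - ζ) := by positivity
  have hlarge := hK₀ k hk
  rw [div_le_iff₀ hu] at hlarge
  set y : ℝ := (k : ℝ) ^ (1 - ζ) with hy
  have hy0 : 0 ≤ y := by positivity
  have hprod : ∏ j ∈ Finset.range k, (1 - 3 / 4 * stepSize η₀ ζ (j + 1))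
      ≤ Real.exp (-(3 / 4 * (η₀ / (1 - ζ) * (y - 1)))) := by
    calc ∏ j ∈ Finset.range k, (1 - 3 / 4 * stepSize η₀ ζ (j + 1))
        ≤ ∏ j ∈ Finset.range k, Real.exp (-(3 / 4 * stepSize η₀ ζ (j + 1))) := by
          refine Finset.prod_le_prod (fun j _ => by linarith [stepSize_le_one h1 hζ j])
            fun j _ => ?_
          have := Real.add_one_le_exp (-(3 / 4 * stepSize η₀ ζ (j + 1)))
          linarith
      _ = Real.exp (-(3 / 4 * ∑ j ∈ Finset.range k, stepSize η₀ ζ (j + 1))) := by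
          rw [← Real.exp_sum, Finset.sum_neg_distrib, ← Finset.mul_sum]
      _ ≤ _ := by
          refine Real.exp_le_exp.2 ?_
          have := sum_stepSize_ge h0 hζ hζ1 k
          linarith
  have hrate : (1 + c₂ lam γ η₀ ζ) ^ y ≤ Real.exp (1 / 4 * (η₀ / (1 - ζ) * y)) := by
    have e : (1 + c₂ lam γ η₀ ζ) ^ y = Real.exp (Real.log 2 * (η₀ / ((1 - ζ) * T₁ lam γ) * y)) := by
      rw [c₂, add_sub_cancel, ← Real.rpow_mul (by norm_num), Real.rpow_def_of_pos (by norm_num)]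
    rw [e]
    refine Real.exp_le_exp.2 ?_
    have e2 : Real.log 2 * (η₀ / ((1 - ζ) * T₁ lam γ) * y)
        = Real.log 2 / T₁ lam γ * (η₀ / (1 - ζ) * y) := by
      field_simp
    rw [e2]
    refine mul_le_mul_of_nonneg_right ?_ (by positivity)
    rw [div_le_div_iff₀ hT (by norm_num)]
    linarith
  have hpos : 0 < (1 + c₂ lam γ η₀ ζ) ^ y := by
    rw [c₂, add_sub_cancel]
    positivity
  rw [le_div_iff₀ hpos]
  calc 2 * (∏ j ∈ Finset.range k, (1 - 3 / 4 * stepSize η₀ ζ (j + 1))) * (1 + c₂ lam γ η₀ ζ) ^ y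
      ≤ 2 * Real.exp (-(3 / 4 * (η₀ / (1 - ζ) * (y - 1))))
        * Real.exp (1 / 4 * (η₀ / (1 - ζ) * y)) := by gcongr
    _ = Real.exp (Real.log 2 + -(3 / 4 * (η₀ / (1 - ζ) * (y - 1)))
        + 1 / 4 * (η₀ / (1 - ζ) * y)) := by
        rw [Real.exp_add, Real.exp_add, Real.exp_log (by norm_num)]
    _ ≤ 1 := Real.exp_le_one_iff.2 (by linarith)

/-! ### Lower bounds for the explicit constants. -/

namespace Data

variable {D : Data d}

section

variable (hf : GrowthAssumption D.f D.xstar D.a D.L D.κ D.β)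
include hf

lemma L₁_nonneg : 0 ≤ D.L₁ := by
  have := hf.L_pos
  exact mul_nonneg (Real.exp_pos _).le (Real.iSup_nonneg fun x => by positivity)

/-- The supremum is tested at `xstar`. Boundedness has to be checked, an unbounded real supremum
being 0 by convention. -/
lemma exp_le_L₀ (hα : 0 < D.α) : Real.exp (-D.α * D.f D.xstar) ≤ D.L₀ := by
  have hL := hf.L_pos
  have hκ := hf.κ_pos
  have ha := hf.a_pos
  have hβ := hf.one_le_β
  have hg : HasPolyGrowth fun x : EuclideanSpace ℝ (Fin d) =>
      1 + D.L * ‖x‖ + D.L * ‖x‖ ^ (D.a + 1) :=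
    ((HasPolyGrowth.const 1).add ((HasPolyGrowth.const D.L).mul HasPolyGrowth.norm)).add
      ((HasPolyGrowth.const D.L).mul (HasPolyGrowth.norm_rpow (by linarith)))
  obtain ⟨C, -, hC⟩ := hg.exists_exp_neg_mul_le (c := D.κ * D.α / 2) (by positivity) hβ D.xstar
  have hbdd : BddAbove (Set.range fun x : EuclideanSpace ℝ (Fin d) =>
      Real.exp (-(D.κ * D.α / 2) * ‖x - D.xstar‖ ^ D.β)
        * (1 + D.L * ‖x‖ + D.L * ‖x‖ ^ (D.a + 1))) := by
    refine ⟨C, ?_⟩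
    rintro _ ⟨x, rfl⟩
    exact (mul_le_mul_of_nonneg_left (le_abs_self _) (Real.exp_pos _).le).trans (hC x)
  have h1 := le_ciSup hbdd D.xstar
  have h2 : (1 : ℝ) ≤ Real.exp (-(D.κ * D.α / 2) * ‖D.xstar - D.xstar‖ ^ D.β)
      * (1 + D.L * ‖D.xstar‖ + D.L * ‖D.xstar‖ ^ (D.a + 1)) := by
    rw [sub_self, norm_zero, Real.zero_rpow (by linarith), mul_zero, Real.exp_zero, one_mul]
    have : 0 ≤ D.L * ‖D.xstar‖ := by positivity
    have : 0 ≤ D.L * ‖D.xstar‖ ^ (D.a + 1) := by positivity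
    linarith
  exact le_mul_of_one_le_right (Real.exp_pos _).le (h2.trans h1)

end

lemma Cint₈_pos : 0 < D.Cint₈ := by
  unfold Cint₈
  positivity

lemma C₄_nonneg : 0 ≤ D.C₄ := Real.sqrt_nonneg _

lemma C₄_sq_ge (hR : 0 ≤ D.R) (hη : 0 < D.η₀) (hγ : 0 < D.γ) (hα₀ : 0 < D.α₀) :
    ∫ x, ‖x‖ ^ 2 ∂D.ν ≤ D.C₄ ^ 2 ∧ D.R ^ 2 + 2 * (d * D.γ / D.α₀) ≤ D.C₄ ^ 2 := by
  have hs : 0 ≤ √(2 * (d * D.γ / D.α₀)) := Real.sqrt_nonneg _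
  have hs2 : √(2 * (d * D.γ / D.α₀)) ^ 2 = 2 * (d * D.γ / D.α₀) := Real.sq_sqrt (by positivity)
  have hsecond : D.R ^ 2 + 2 * (d * D.γ / D.α₀) ≤ (D.R + √(2 * (d * D.γ / D.α₀))) ^ 2
      + D.η₀ * (2 * d * (D.γ / D.α₀) + 2 * D.η₀ * (D.R + √(2 * (d * D.γ / D.α₀)))) := by
    have h1 : 0 ≤ D.η₀ * (2 * d * (D.γ / D.α₀) + 2 * D.η₀ * (D.R + √(2 * (d * D.γ / D.α₀)))) := by
      positivity
    nlinarith [mul_nonneg hR hs]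
  have h0 : 0 ≤ D.R ^ 2 + 2 * (d * D.γ / D.α₀) := by positivity
  rw [C₄, Real.sq_sqrt (h0.trans (hsecond.trans (le_max_right _ _)))]
  exact ⟨le_max_left _ _, hsecond.trans (le_max_right _ _)⟩

/-- The oscillation of the Gibbs weight on the ball of radius `2 C₄`. -/
def gap (D : Data d) : ℝ := Real.exp (D.α *
  ((⨆ y : Metric.ball (0 : EuclideanSpace ℝ (Fin d)) (2 * D.C₄), D.f y) - D.f D.xstar))

lemma gap_pos : 0 < D.gap := Real.exp_pos _

section

variable (hf : GrowthAssumption D.f D.xstar D.a D.L D.κ D.β)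
include hf

lemma bddAbove_range_ball : BddAbove (Set.range fun y :
    Metric.ball (0 : EuclideanSpace ℝ (Fin d)) (2 * D.C₄) => D.f y) := by
  have hc : IsCompact (Metric.closedBall (0 : EuclideanSpace ℝ (Fin d)) (2 * D.C₄)) :=
    isCompact_closedBall _ _
  obtain ⟨C, hC⟩ := hc.bddAbove_image hf.contDiff.continuous.continuousOn
  refine ⟨C, ?_⟩
  rintro _ ⟨y, rfl⟩
  exact hC ⟨y, Metric.ball_subset_closedBall y.2, rfl⟩

lemma one_div_gap_le_weight (hα : 0 < D.α) {x : EuclideanSpace ℝ (Fin d)} (hx : ‖x‖ < 2 * D.C₄) :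
    1 / D.gap ≤ weight D.f D.xstar D.α x := by
  have h1 := le_ciSup (bddAbove_range_ball hf) ⟨x, by simpa using hx⟩
  rw [gap, one_div, ← Real.exp_neg, weight]
  refine Real.exp_le_exp.2 ?_
  simp only at h1
  nlinarith

/-- A point of norm C₄ in a direction with nonpositive inner product with `xstar` lies at distance
at least C₄ from it, and there the growth of f applies. This makes `gap` dominate α and C₄. -/
lemma exp_le_gap (hd : 1 ≤ d) (hα : 0 < D.α) (hC : 0 < D.C₄) :
    Real.exp (D.α * (D.κ / 2 * D.C₄ ^ D.β)) ≤ D.gap := by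
  have hκ := hf.κ_pos
  obtain ⟨e, he, hin⟩ : ∃ e : EuclideanSpace ℝ (Fin d), ‖e‖ = 1 ∧ inner ℝ e D.xstar ≤ 0 := by
    set u : EuclideanSpace ℝ (Fin d) := EuclideanSpace.single ⟨0, hd⟩ 1
    have hu : ‖u‖ = 1 := by simp [u]
    rcases le_total (inner ℝ u D.xstar) 0 with h | h
    · exact ⟨u, hu, h⟩
    · exact ⟨-u, by simpa using hu, by rw [inner_neg_left]; linarith⟩
  set y : EuclideanSpace ℝ (Fin d) := D.C₄ • e with hy
  have hyn : ‖y‖ = D.C₄ := by rw [hy, norm_smul, he, Real.norm_of_nonneg hC.le, mul_one]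
  have hdist : D.C₄ ≤ ‖y - D.xstar‖ := by
    refine le_of_sq_le_sq ?_ (norm_nonneg _)
    rw [norm_sub_sq_real, hyn, hy, inner_smul_left]
    simp only [conj_trivial]
    nlinarith [sq_nonneg ‖D.xstar‖]
  have h1 := le_ciSup (bddAbove_range_ball hf) ⟨y, by simp [hyn]; linarith⟩
  have h2 := hf.growth y
  have h3 : D.C₄ ^ D.β ≤ ‖y - D.xstar‖ ^ D.β :=
    Real.rpow_le_rpow hC.le hdist (by linarith [hf.one_le_β])
  refine Real.exp_le_exp.2 (mul_le_mul_of_nonneg_left ?_ hα.le)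
  simp only at h1
  nlinarith

/-- The ratio of L₀ to `Cint₈` is already at least `gap`, and it enters `Cint₃` squared. -/
lemma gap_le_Cint₃ (hα : 0 < D.α) (hgap : 1 ≤ D.gap) : D.gap ≤ D.Cint₃ := by
  have hL₁ := L₁_nonneg hf
  have hL₀ := exp_le_L₀ hf hα
  have h8 := Cint₈_pos (D := D)
  have hC := C₄_nonneg (D := D)
  have hr : D.gap ≤ (D.L₀ + 4 * (D.C₄ / D.Cint₈) * D.L₁) / D.Cint₈ := by
    rw [le_div_iff₀ h8]
    have h1 : D.gap * D.Cint₈ = 3 / 4 * Real.exp (-D.α * D.f D.xstar) := by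
      rw [gap, Cint₈, mul_left_comm, ← Real.exp_add]
      congr 2
      ring
    have h2 : 0 ≤ 4 * (D.C₄ / D.Cint₈) * D.L₁ := by positivity
    rw [h1]
    linarith [Real.exp_pos (-D.α * D.f D.xstar)]
  have h3 : 0 ≤ 16 * D.R ^ 2 * D.L₁ ^ 2 / D.Cint₈ ^ 2 := by positivity
  rw [Cint₃]
  set u := (D.L₀ + 4 * (D.C₄ / D.Cint₈) * D.L₁) / D.Cint₈
  nlinarith

/-- The first summand suffices, as T₁ ≥ 1 and `Cint₂` ≥ 8R². The exponential is what absorbs the law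
of large numbers. -/
lemma C₂_ge (hα : 0 < D.α) (hγ : 0 < D.γ) (hlam : 0 < D.lam) (hgap : 1 ≤ D.gap) :
    48 * D.R ^ 2 * Real.exp D.gap ≤ D.C₂ := by
  have h8 := Cint₈_pos (D := D)
  have hC := C₄_nonneg (D := D)
  have h3 := gap_le_Cint₃ hf hα hgap
  have hT : 1 ≤ T₁ D.lam D.γ := by
    refine le_trans ?_ (log_le_T₁ hlam hγ)
    have : (2 : ℝ)⁻¹ ≤ Real.log 2 := by
      have := Real.log_two_gt_d9
      norm_num at this ⊢
      linarith
    linarith [four_mul_log_two_le]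
  have h2 : 8 * D.R ^ 2 ≤ D.Cint₂ := by
    rw [Cint₂]
    have e1 : 0 ≤ 16 / D.Cint₈ ^ 2 * (2 * D.R ^ 2 + D.C₄ ^ 2 + (D.C₄ / D.Cint₈) ^ 2) := by positivity
    have e2 : 0 ≤ 8 * D.R ^ 2 * (12 / D.Cint₈ ^ 2) := by positivity
    linarith
  have h20 : 0 ≤ D.Cint₂ := le_trans (by positivity) h2
  have h6 : 0 ≤ D.Cint₆ (T₁ D.lam D.γ) := by
    rw [Cint₆]
    positivity
  have he : Real.exp D.gap ≤ Real.exp (D.Cint₃ * T₁ D.lam D.γ) := by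
    refine Real.exp_le_exp.2 ?_
    nlinarith
  rw [C₂]
  calc 48 * D.R ^ 2 * Real.exp D.gap = 6 * Real.exp D.gap * (8 * D.R ^ 2) := by ring
    _ ≤ 6 * Real.exp (D.Cint₃ * T₁ D.lam D.γ) * D.Cint₂ := by gcongr
    _ ≤ _ := le_add_of_nonneg_right (by positivity)

end

lemma Cint₇_nonneg (hη : 0 < D.η₀) (hγ : 0 < D.γ) (hα₀ : 0 < D.α₀) : 0 ≤ D.Cint₇ := by
  rw [Cint₇, Cint₄]
  positivity

lemma C₁_ge (hη : 0 < D.η₀) (hγ : 0 < D.γ) (hα₀ : 0 < D.α₀) (hlam : 0 < D.lam) (hζ : D.ζ < 1) :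
    6 * D.C₄ ^ 2 ≤ D.C₁ := by
  have h7 := Cint₇_nonneg hη hγ hα₀
  have hT := T₁_pos hlam hγ
  have hz : 0 < 1 - D.ζ := by linarith
  have h2 : (2 : ℝ) ≤ 2 ^ (D.η₀ / ((1 - D.ζ) * T₁ D.lam D.γ) + 1) := by
    rw [Real.rpow_add_one (by norm_num)]
    have : (1 : ℝ) ≤ 2 ^ (D.η₀ / ((1 - D.ζ) * T₁ D.lam D.γ)) :=
      Real.one_le_rpow (by norm_num) (by positivity)
    linarith
  have hC0 : 0 ≤ D.C₀ := by rw [C₀]; positivity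
  rw [C₁]
  calc 6 * D.C₄ ^ 2 = 2 * (3 * D.C₄ ^ 2) := by ring
    _ ≤ _ := by
      have : 0 ≤ D.C₀ / D.α₀ := by positivity
      have : 0 ≤ D.γ * d / D.α₀ := by positivity
      have : 0 ≤ D.Cint₇ * D.η₀ := by positivity
      gcongr
      linarith

/-- The recursion produces no error of order k^(-ζ), so only the sign of this constant matters. -/
lemma C₃_nonneg (hη : 0 < D.η₀) (hγ : 0 < D.γ) (hα₀ : 0 < D.α₀) (hlam : 0 < D.lam)
    (hζ0 : 0 < D.ζ) (hζ : D.ζ < 1) : 0 ≤ D.C₃ := by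
  have h7 := Cint₇_nonneg hη hγ hα₀
  have hT := T₁_pos hlam hγ
  have hz : 0 < 1 - D.ζ := by linarith
  have h9 : 0 ≤ D.Cint₉ := by
    rw [Cint₉]
    refine inv_nonneg.2 (le_min (le_min (by positivity) (by positivity)) ?_)
    have : (1 : ℝ) ≤ (1 + T₁ D.lam D.γ * (1 - D.ζ)) ^ (D.ζ / (1 - D.ζ)) :=
      Real.one_le_rpow (by have : 0 < T₁ D.lam D.γ * (1 - D.ζ) := by positivity
                           linarith) (by positivity)
    linarith
  have hs : 0 ≤ ∑' l : ℕ, ((2 : ℝ) ^ l)⁻¹ * ((l : ℝ) + 1) ^ (D.ζ / (1 - D.ζ)) :=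
    tsum_nonneg fun l => by positivity
  rw [C₃]
  positivity

end Data

end

section

variable {d : ℕ} {f : EuclideanSpace ℝ (Fin d) → ℝ} {xstar : EuclideanSpace ℝ (Fin d)}
  {a L κ β δ lam : ℝ}

/-! ### The main estimate -/

/-- A lower bound for the mean-field normalization, by Chebyshev's inequality. -/
lemma Data.le_integral_weight {D : Data d}
    (hf : GrowthAssumption D.f D.xstar D.a D.L D.κ D.β) (hα : 0 < D.α) (hC : 0 < D.C₄)
    {m : EuclideanSpace ℝ (Fin d)} {σ : ℝ} (hm : ‖m‖ ^ 2 + d * σ ^ 2 ≤ 2 * D.C₄ ^ 2) :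
    1 / (2 * D.gap) ≤ ∫ x, weight D.f D.xstar D.α x ∂(isoGaussian m σ) := by
  have hg := D.gap_pos
  -- Outside the ball of radius 2C₄ the left side is nonpositive. Integrated, it is at least half of
  -- 1/`gap` by the second moment bound.
  have hpt : ∀ x, 1 / D.gap * (1 - ‖x‖ ^ 2 / (4 * D.C₄ ^ 2)) ≤ weight D.f D.xstar D.α x := by
    intro x
    have hx0 : 0 ≤ ‖x‖ ^ 2 / (4 * D.C₄ ^ 2) := by positivity
    rcases lt_or_ge ‖x‖ (2 * D.C₄) with hx | hx
    · refine le_trans ?_ (one_div_gap_le_weight hf hα hx)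
      exact mul_le_of_le_one_right (by positivity) (by linarith)
    · refine le_trans ?_ (weight_pos x).le
      have h1 : 1 ≤ ‖x‖ ^ 2 / (4 * D.C₄ ^ 2) := by
        rw [one_le_div (by positivity)]
        nlinarith
      exact mul_nonpos_of_nonneg_of_nonpos (by positivity) (by linarith)
  have hi := (integrable_norm_sq_isoGaussian m σ).div_const (4 * D.C₄ ^ 2)
  have hi2 : Integrable (fun x => 1 / D.gap * (1 - ‖x‖ ^ 2 / (4 * D.C₄ ^ 2))) (isoGaussian m σ) :=
    ((integrable_const _).sub hi).const_mul _
  have hw : Integrable (weight D.f D.xstar D.α) (isoGaussian m σ) :=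
    Integrable.of_bound hf.continuous_weight.aestronglyMeasurable 1
      (Filter.Eventually.of_forall fun x => by
        rw [Real.norm_of_nonneg (weight_pos x).le]
        exact hf.weight_le_one hα.le x)
  refine le_trans ?_ (integral_mono hi2 hw hpt)
  rw [integral_const_mul, integral_sub (integrable_const _) hi, integral_div,
    integral_norm_sq_isoGaussian]
  have h1 : (‖m‖ ^ 2 + d * σ ^ 2) / (4 * D.C₄ ^ 2) ≤ 1 / 2 := by
    rw [div_le_div_iff₀ (by positivity) (by norm_num)]
    linarith
  simp only [integral_const, probReal_univ, smul_eq_mul, mul_one]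
  calc 1 / (2 * D.gap) = 1 / D.gap * (1 / 2) := by field_simp
    _ ≤ _ := by
      gcongr
      linarith

/-- With x = d, the first term is the consensus bias 2·4·(2b)² and the second twice the limiting
second moment of the fluctuations. The total 32 + 4 = 36 is exactly 6C₀/α. -/
lemma bias_le {x γ α lam : ℝ} (hα : 0 < α) (hlam : 0 < lam) (hx : 0 ≤ x) (hγ : 4 ≤ lam * γ) :
    32 * (4 * x / (α * lam)) + 2 * x * (2 * γ / α) ≤ 36 * (x * γ / α) := by
  have h1 : 4 * x / (α * lam) ≤ x * γ / α := by
    rw [div_le_div_iff₀ (by positivity) hα]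
    have : 0 ≤ x * α := by positivity
    nlinarith
  have h2 : 2 * x * (2 * γ / α) = 4 * (x * γ / α) := by ring
  linarith

/-- The oscillation of the weight dominates the other parameters. -/
lemma Data.gap_bounds {D : Data d} (hf : GrowthAssumption D.f D.xstar D.a D.L D.κ D.β)
    (hd : 1 ≤ d) {s₀ : ℝ} (hδ : 0 < δ) (hδC : δ ≤ D.C₄) (hs₀ : 1 ≤ s₀) (hα : 0 < D.α)
    (hακ : 2 / D.κ < D.α) (hαs : 2 / (D.κ * δ ^ D.β) * s₀ < D.α) :
    D.α ≤ 2 / (D.κ * δ ^ D.β) * D.gap ∧ s₀ ≤ D.gap ∧ D.C₄ ≤ D.gap := by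
  have hκ := hf.κ_pos
  have hβ := hf.one_le_β
  have hC : 0 < D.C₄ := hδ.trans_le hδC
  have hgap := Data.exp_le_gap hf hd hα hC
  have hself : ∀ t : ℝ, t ≤ Real.exp t := fun t => by linarith [Real.add_one_le_exp t]
  have hgapα : D.α ≤ 2 / (D.κ * δ ^ D.β) * D.gap := by
    have h2 : δ ^ D.β ≤ D.C₄ ^ D.β := Real.rpow_le_rpow hδ.le hδC (by linarith)
    have h3 : D.α * (D.κ / 2 * δ ^ D.β) ≤ D.gap := by
      refine le_trans ?_ ((hself _).trans hgap)
      gcongr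
    rw [div_mul_eq_mul_div, le_div_iff₀ (by positivity)]
    linarith
  have hgaps : s₀ ≤ D.gap :=
    le_of_mul_le_mul_left (hαs.le.trans hgapα) (by positivity)
  refine ⟨hgapα, hgaps, ?_⟩
  rcases le_total D.C₄ 1 with h2 | h2
  · exact h2.trans (hs₀.trans hgaps)
  · refine le_trans ?_ ((hself _).trans hgap)
    have h3 : D.C₄ ≤ D.C₄ ^ D.β := Real.self_le_rpow_of_one_le h2 hβ
    rw [div_lt_iff₀ hκ] at hακ
    nlinarith

/-- The bound on the second moments, with the initial error multiplied by the explicit product. -/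
theorem exists_second_moment_bound (hd : 1 ≤ d) (hf : GrowthAssumption f xstar a L κ β)
    (hf' : LocalConvexityAssumption f xstar δ lam) :
    ∃ A r : ℝ, 1 ≤ A ∧ 0 < r ∧ ∀ D : Data d, D.f = f → D.xstar = xstar → D.a = a → D.L = L →
      D.κ = κ → D.β = β → D.lam = lam → D.α₀ = A → ‖xstar‖ + δ ≤ D.R → 0 < D.η₀ → D.η₀ ≤ 1 →
      0 < D.ζ → 12 ≤ lam * D.γ → A < D.α →
      ∀ (m₀ : EuclideanSpace ℝ (Fin d)) (σ₀ : ℝ), D.ν = isoGaussian m₀ σ₀ →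
      max D.R ‖m₀‖ ≤ √(D.γ * (κ * δ ^ β / 8)) - ‖xstar‖ - r → D.γ / (2 * D.α) ≤ σ₀ ^ 2 →
      ∀ (n : ℕ) (Ω : Type*) [MeasurableSpace Ω] (P : Measure Ω) [IsProbabilityMeasure P]
        (X ξ : ℕ → Fin n → Ω → EuclideanSpace ℝ (Fin d)),
        IsClippedCBO P f D.R D.α D.γ D.η₀ D.ζ D.ν X ξ → ∀ (k : ℕ) (i : Fin n),
        Integrable (fun ω => ‖X k i ω - xstar‖ ^ 2) P ∧
        ∫ ω, ‖X k i ω - xstar‖ ^ 2 ∂P ≤ 6 * D.C₀ / D.α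
          + (∏ j ∈ Finset.range k, (1 - 3 / 4 * stepSize D.η₀ D.ζ (j + 1)))
            * (2 * ‖m₀ - xstar‖ ^ 2 + 2 * (d * σ₀ ^ 2)) + D.C₂ / n := by
  have hκ := hf.κ_pos
  have hlam := hf'.lam_pos
  have hδ := hf'.δ_pos
  have hd' : (1 : ℝ) ≤ d := by exact_mod_cast hd
  obtain ⟨A₁, r, hA₁, hr, hmean⟩ := exists_gibbs_mean_le hd hf hf'
  obtain ⟨K, hK, hφ⟩ := hf.exists_consensusFun_bounds
  set c : ℝ := 2 / (κ * δ ^ β) with hc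
  have hc0 : 0 < c := by positivity
  obtain ⟨s₀, hs₀1, hs₀⟩ := exists_lln_constant_le hd hlam hc0 hK
  -- A₁ serves the mean-field contraction, 2/κ the bound C₄ ≤ `gap`, and c s₀ the bound s₀ ≤ `gap`.
  refine ⟨max A₁ (max (2 / κ) (c * s₀)), r, hA₁.trans (le_max_left _ _), hr, ?_⟩
  rintro D rfl rfl rfl rfl rfl rfl hDlam hα₀ hR h0 h1 hζ hγ12 hα m₀ σ₀ hν hρ hσ n Ω _ P _ X ξ h k i
  have hαA₁ : A₁ < D.α := lt_of_le_of_lt (le_max_left _ _) hα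
  have hα1 : 1 ≤ D.α := hA₁.trans hαA₁.le
  have hα0 : 0 < D.α := by linarith
  have hακ : 2 / D.κ < D.α := lt_of_le_of_lt ((le_max_left _ _).trans (le_max_right _ _)) hα
  have hαs : c * s₀ < D.α := lt_of_le_of_lt ((le_max_right _ _).trans (le_max_right _ _)) hα
  have hα₀0 : 0 < D.α₀ := by rw [hα₀]; linarith [hA₁.trans (le_max_left A₁ (max (2 / D.κ) (c * s₀)))]
  have hα₀α : D.α₀ ≤ D.α := by rw [hα₀]; exact hα.le
  have hγ : 0 < D.γ := by
    by_contra! hneg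
    nlinarith
  have hxR : ‖D.xstar‖ ≤ D.R := by linarith
  have hR0 : 0 ≤ D.R := (norm_nonneg _).trans hxR
  have hn : 0 < n := i.pos
  have hn' : (0 : ℝ) < n := by exact_mod_cast hn
  -- the constant `C₄` dominates all the lengths involved
  obtain ⟨hC4ν, hC4R⟩ := Data.C₄_sq_ge (D := D) hR0 h0 hγ hα₀0
  rw [hν, integral_norm_sq_isoGaussian] at hC4ν
  have hC40 := Data.C₄_nonneg (D := D)
  have hγα : 0 ≤ d * D.γ / D.α₀ := by positivity
  have hRC : D.R ≤ D.C₄ := le_of_sq_le_sq (by linarith) hC40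
  have hmC : ‖m₀‖ ≤ D.C₄ := by
    refine le_of_sq_le_sq (le_trans ?_ hC4ν) hC40
    have : 0 ≤ d * σ₀ ^ 2 := by positivity
    linarith
  have hρC : max D.R ‖m₀‖ ≤ D.C₄ := max_le hRC hmC
  have hδC : δ ≤ D.C₄ := by linarith [norm_nonneg D.xstar]
  have hC : 0 < D.C₄ := hδ.trans_le hδC
  obtain ⟨hgapα, hgaps, hgapC⟩ := Data.gap_bounds hf hd hδ hδC hs₀1 hα0 hακ hαs
  have hgap1 : 1 ≤ D.gap := hs₀1.trans hgaps
  -- the parameters of the contraction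
  set q : ℝ := 1 / (1 + lam * D.γ / 4) with hq
  have hq0 : 0 ≤ q := by positivity
  have hq4 : q ≤ 1 / 4 := one_div_le_one_div_of_le (by norm_num) (by linarith)
  set b : ℝ := √(4 * d / (D.α * lam)) with hb
  have hb0 : 0 < b := Real.sqrt_pos.2 (by positivity)
  have hb2 : b ^ 2 = 4 * d / (D.α * lam) := Real.sq_sqrt (by positivity)
  have hg := D.gap_pos
  -- C₄ stands for q‖m - x*‖, which it dominates on the ball of the drift because q ≤ 1/4.
  set T : ℝ := b / (4 * D.gap * (D.C₄ + b + d)) with hT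
  have hT0 : 0 < T := by positivity
  have hT1 : T ≤ 1 / (4 * D.gap) := by
    rw [hT, div_le_div_iff₀ (by positivity) (by positivity)]
    have : b * (4 * D.gap) ≤ (D.C₄ + b + d) * (4 * D.gap) := by
      gcongr
      linarith
    linarith
  have hT2 : ∀ m : EuclideanSpace ℝ (Fin d), ‖m‖ ≤ max D.R ‖m₀‖ →
      T * (q * ‖m - D.xstar‖ + b + d) ≤ b / (4 * D.gap) := by
    intro m hm
    have h2 : q * ‖m - D.xstar‖ ≤ D.C₄ := by
      have h3 : ‖m - D.xstar‖ ≤ 2 * D.C₄ := by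
        refine (norm_sub_le _ _).trans ?_
        linarith
      calc q * ‖m - D.xstar‖ ≤ 1 / 4 * (2 * D.C₄) := by gcongr
        _ ≤ D.C₄ := by linarith
    calc T * (q * ‖m - D.xstar‖ + b + d) ≤ T * (D.C₄ + b + d) := by gcongr
      _ = b / (4 * D.gap) := by rw [hT]; field_simp
  have hconst := hs₀ D.gap D.α D.C₄ (max D.R ‖m₀‖) b hgaps hα0 hgapα hC40 hgapC
    (hR0.trans (le_max_left _ _)) (hρC.trans hgapC) hb T hT
  rw [hν] at h
  -- the bad events
  have hbad : ∀ k, ∃ bad : Set Ω, MeasurableSet bad ∧ P.real bad ≤ Real.exp D.gap / n ∧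
      ∀ ω ∉ bad, ‖consensus D.f D.α (fun j => X k j ω) - D.xstar‖
        ≤ q * ‖drift D.f D.R D.α D.η₀ D.ζ m₀ X k ω - D.xstar‖ + 2 * b := by
    intro k
    have hv := le_varSeq (ζ := D.ζ) h0 h1 hζ hγ hα0 hσ k
    have hv0 : 0 < varSeq D.η₀ D.ζ D.γ D.α σ₀ k := lt_of_lt_of_le (by positivity) hv
    have hvmax := varSeq_le_max (σ₀ := σ₀) (ζ := D.ζ) h0 h1 hζ hγ hα0 k
    have hsq := Real.sq_sqrt hv0.le
    have hvC : d * varSeq D.η₀ D.ζ D.γ D.α σ₀ k ≤ D.C₄ ^ 2 := by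
      have h2 : d * varSeq D.η₀ D.ζ D.γ D.α σ₀ k ≤ d * max (σ₀ ^ 2) (2 * D.γ / D.α) := by gcongr
      refine h2.trans ?_
      rw [mul_max_of_nonneg _ _ (by positivity)]
      refine max_le ?_ ?_
      · have : 0 ≤ ‖m₀‖ ^ 2 := by positivity
        linarith
      · have h3 : d * (2 * D.γ / D.α) ≤ 2 * (d * D.γ / D.α₀) := by
          calc d * (2 * D.γ / D.α) = 2 * (d * D.γ / D.α) := by ring
            _ ≤ _ := by gcongr
        have : 0 ≤ D.R ^ 2 := by positivity
        linarith
    obtain ⟨bad, hbm, hbP, hb⟩ := exists_bad_event hd hf hK hα1 (hφ D.α hα1)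
      (σ := √(varSeq D.η₀ D.ζ D.γ D.α σ₀ k)) (ρ := max D.R ‖m₀‖) (q := q) (b := b) (s := D.gap)
      (T := T) (Real.sqrt_pos.2 hv0).ne' hT0 hg hq0 hb0.le
      (fun m hm => by
        rw [hsq]
        have := hmean D.γ hγ D.α hαA₁ _ hv m (hm.trans hρ)
        rwa [div_eq_mul_one_div, mul_comm ‖m - D.xstar‖] at this)
      (fun m hm => Data.le_integral_weight hf hα0 hC (by
        rw [hsq]
        have : ‖m‖ ^ 2 ≤ D.C₄ ^ 2 := by
          have := hm.trans hρC
          gcongr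
        linarith))
      hT1 hT2 (fun i => h.hasLaw_fluct h0 hγ hα0 k i) (h.indepFun_fluct k) hn
    refine ⟨bad, hbm, hbP.trans ?_, fun ω hω => ?_⟩
    · rw [abs_of_nonneg (hR0.trans (le_max_left _ _))]
      gcongr
    · simp only [h.eq_drift_add_fluct k]
      exact hb ω hω _ (norm_drift_le h0 h1 hζ hR0 k ω)
  obtain ⟨hint, hle⟩ := h.second_moment_le hf.contDiff.continuous h0 h1 hζ hγ hα0 hσ hxR hq0 hq4
    (by positivity : 0 ≤ 2 * b) hbad k i
  refine ⟨hint, hle.trans ?_⟩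
  have hvar := varSeq_le (σ₀ := σ₀) (ζ := D.ζ) h0 h1 hζ hγ hα0 k
  have hvar' := mul_le_mul_of_nonneg_left hvar (by positivity : (0 : ℝ) ≤ 2 * d)
  have hC2 := Data.C₂_ge hf hα0 hγ (by rwa [hDlam]) hgap1
  have hC2n : 32 * D.R ^ 2 * (Real.exp D.gap / n) ≤ D.C₂ / n := by
    rw [← mul_div_assoc]
    gcongr
    have : 0 ≤ D.R ^ 2 * Real.exp D.gap := by positivity
    linarith
  have hbias : 32 * b ^ 2 + 2 * d * (2 * D.γ / D.α) ≤ 6 * D.C₀ / D.α := by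
    have h3 : 6 * D.C₀ / D.α = 36 * (d * D.γ / D.α) := by rw [Data.C₀]; ring
    rw [hb2, h3]
    exact bias_le hα0 hlam (Nat.cast_nonneg d) (by linarith)
  generalize (∏ j ∈ Finset.range k, (1 - 3 / 4 * stepSize D.η₀ D.ζ (j + 1))) = Q at *
  linarith

end

end CBO

end


/-! ### Choice of the thresholds and conclusion. -/

theorem theorem2 {d : ℕ} (hd : 1 ≤ d)
    (f : EuclideanSpace ℝ (Fin d) → ℝ) (xstar : EuclideanSpace ℝ (Fin d))
    (a L κ β δ lam : ℝ)
    (hf : CBO.GrowthAssumption f xstar a L κ β)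
    (hf' : CBO.LocalConvexityAssumption f xstar δ lam) :
    -- the threshold `α₀` depends on `γ` and on the objective only
    ∃ α₀ : ℝ → ℝ, (∀ γ, 0 < γ → 0 < α₀ γ) ∧
    ∀ R : ℝ, ‖xstar‖ + δ ≤ R →
    ∀ η₀ : ℝ, 0 < η₀ → η₀ ≤ 1 →
    ∀ ζ : ℝ, 0 < ζ → ζ ≤ 1 →
    ∀ m₀ : EuclideanSpace ℝ (Fin d),
    ∃ γ₀ : ℝ, 0 < γ₀ ∧ ∃ K₀ : ℕ,
    ∀ γ : ℝ, γ₀ < γ →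
    -- `c₂` does not depend on `α`; the closed forms require `ζ < 1`
    ∃ c₂ : ℝ, 0 < c₂ ∧ (ζ < 1 → c₂ = CBO.c₂ lam γ η₀ ζ) ∧
    ∀ α : ℝ, α₀ γ < α →
    ∀ σ₀ : ℝ, γ / (2 * α) ≤ σ₀ ^ 2 →
    let D : CBO.Data d :=
      { f := f, xstar := xstar, a := a, L := L, κ := κ, β := β, lam := lam, R := R,
        η₀ := η₀, ζ := ζ, γ := γ, α₀ := α₀ γ, α := α, ν := CBO.isoGaussian m₀ σ₀ }
    ∃ C₁ C₃ : ℝ, (ζ < 1 → C₁ = D.C₁ ∧ C₃ = D.C₃) ∧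
    ∀ (n : ℕ) (Ω : Type*) [MeasurableSpace Ω] (P : MeasureTheory.Measure Ω)
      [MeasureTheory.IsProbabilityMeasure P]
      (X ξ : ℕ → Fin n → Ω → EuclideanSpace ℝ (Fin d)),
      CBO.IsClippedCBO P f R α γ η₀ ζ (CBO.isoGaussian m₀ σ₀) X ξ →
      ∀ k : ℕ, K₀ ≤ k → ∀ i : Fin n,
        MeasureTheory.Integrable (fun ω => ‖X k i ω - xstar‖ ^ 2) P ∧
        ∫ ω, ‖X k i ω - xstar‖ ^ 2 ∂P ≤
          6 * D.C₀ / α + C₁ / (1 + c₂) ^ ((k : ℝ) ^ (1 - ζ)) + D.C₂ / n + C₃ / (k : ℝ) ^ ζ := by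
  have hκ := hf.κ_pos
  have hlam := hf'.lam_pos
  have hδ := hf'.δ_pos
  obtain ⟨A, r, hA, hr, hbound⟩ := CBO.exists_second_moment_bound hd hf hf'
  have hA0 : 0 < A := by linarith
  refine ⟨fun _ => A, fun _ _ => hA0, fun R hR η₀ h0 h1 ζ hζ hζ1 m₀ => ?_⟩
  set c : ℝ := κ * δ ^ β / 8 with hc
  have hc0 : 0 < c := by positivity
  set ρ : ℝ := max R ‖m₀‖ + ‖xstar‖ + r with hρ
  have hρ0 : 0 < ρ := by
    have : 0 ≤ max R ‖m₀‖ := (norm_nonneg _).trans (le_max_right _ _)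
    positivity
  -- 12/λ makes q ≤ 1/4; ρ²/c places the ball of the drift in the range of the tail estimate.
  have hγlarge : ∀ γ, 12 / lam + ρ ^ 2 / c < γ →
      12 ≤ lam * γ ∧ 0 < γ ∧ max R ‖m₀‖ ≤ √(γ * c) - ‖xstar‖ - r := by
    intro γ hγ
    have e1 : 0 < 12 / lam := by positivity
    have e2 : 0 < ρ ^ 2 / c := by positivity
    have h2 : 12 / lam ≤ γ := by linarith
    have h3 : ρ ^ 2 / c ≤ γ := by linarith
    rw [div_le_iff₀ hlam] at h2
    rw [div_le_iff₀ hc0] at h3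
    have h4 : ρ ≤ √(γ * c) := Real.le_sqrt_of_sq_le h3
    refine ⟨by linarith, by linarith, by linarith⟩
  rcases lt_or_eq_of_le hζ1 with hlt | rfl
  · obtain ⟨K₀, hK₀⟩ := CBO.exists_prod_le h0 h1 hζ hlt
    refine ⟨12 / lam + ρ ^ 2 / c, by positivity, K₀, fun γ hγ => ?_⟩
    obtain ⟨hγ12, hγ0, hργ⟩ := hγlarge γ hγ
    have hz : 0 < 1 - ζ := by linarith
    have hT := CBO.T₁_pos hlam hγ0
    have hc₂ : 0 < CBO.c₂ lam γ η₀ ζ := by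
      rw [CBO.c₂, sub_pos]
      exact Real.one_lt_rpow (by norm_num) (by positivity)
    refine ⟨CBO.c₂ lam γ η₀ ζ, hc₂, fun _ => rfl, fun α hα σ₀ hσ => ?_⟩
    intro D
    refine ⟨D.C₁, D.C₃, fun _ => ⟨rfl, rfl⟩, fun n Ω _ P _ X ξ h k hk i => ?_⟩
    obtain ⟨hint, hle⟩ := hbound D rfl rfl rfl rfl rfl rfl rfl rfl hR h0 h1 hζ hγ12 hα m₀ σ₀ rfl
      hργ hσ n Ω P X ξ h k i
    refine ⟨hint, hle.trans ?_⟩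
    have hR0 : 0 ≤ R := by linarith [norm_nonneg xstar]
    have hxR : ‖xstar‖ ≤ R := by linarith
    obtain ⟨hC4ν, hC4R⟩ := CBO.Data.C₄_sq_ge (D := D) hR0 h0 hγ0 hA0
    have hC4ν' : ‖m₀‖ ^ 2 + d * σ₀ ^ 2 ≤ D.C₄ ^ 2 := by
      rw [← CBO.integral_norm_sq_isoGaussian]
      exact hC4ν
    have hC4x : ‖xstar‖ ^ 2 ≤ D.C₄ ^ 2 := by
      have h2 : ‖xstar‖ ^ 2 ≤ R ^ 2 := by gcongr
      have h3 : 0 ≤ 2 * (d * γ / A) := by positivity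
      have h4 : R ^ 2 + 2 * (d * γ / A) ≤ D.C₄ ^ 2 := hC4R
      linarith
    have hC1 := CBO.Data.C₁_ge (D := D) h0 hγ0 hA0 hlam hlt
    have hC3 := CBO.Data.C₃_nonneg (D := D) h0 hγ0 hA0 hlam hζ hlt
    have hprod := hK₀ k hk lam γ hlam hγ0
    have hinit : 2 * ‖m₀ - xstar‖ ^ 2 + 2 * (d * σ₀ ^ 2) ≤ 8 * D.C₄ ^ 2 := by
      have h2 : ‖m₀ - xstar‖ ^ 2 ≤ (‖m₀‖ + ‖xstar‖) ^ 2 := by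
        gcongr
        exact norm_sub_le _ _
      have h3 : 0 ≤ d * σ₀ ^ 2 := by positivity
      nlinarith [sq_nonneg (‖m₀‖ - ‖xstar‖)]
    have hQ0 : 0 ≤ ∏ j ∈ Finset.range k, (1 - 3 / 4 * CBO.stepSize η₀ ζ (j + 1)) :=
      Finset.prod_nonneg fun j _ => by linarith [CBO.stepSize_le_one h1 hζ j]
    have hpos : 0 < (1 + CBO.c₂ lam γ η₀ ζ) ^ ((k : ℝ) ^ (1 - ζ)) := by positivity
    have hfirst : (∏ j ∈ Finset.range k, (1 - 3 / 4 * CBO.stepSize η₀ ζ (j + 1)))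
        * (2 * ‖m₀ - xstar‖ ^ 2 + 2 * (d * σ₀ ^ 2))
        ≤ D.C₁ / (1 + CBO.c₂ lam γ η₀ ζ) ^ ((k : ℝ) ^ (1 - ζ)) := by
      calc _ ≤ (∏ j ∈ Finset.range k, (1 - 3 / 4 * CBO.stepSize η₀ ζ (j + 1)))
            * (8 * D.C₄ ^ 2) := by gcongr
        _ = 2 * (∏ j ∈ Finset.range k, (1 - 3 / 4 * CBO.stepSize η₀ ζ (j + 1)))
            * (4 * D.C₄ ^ 2) := by ring
        _ ≤ 1 / (1 + CBO.c₂ lam γ η₀ ζ) ^ ((k : ℝ) ^ (1 - ζ)) * D.C₁ := by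
            gcongr
            linarith [sq_nonneg D.C₄]
        _ = _ := by ring
    have hlast : 0 ≤ D.C₃ / (k : ℝ) ^ ζ := by positivity
    exact (add_le_add_left (add_le_add_right hfirst _) _).trans (le_add_of_nonneg_right hlast)
  · refine ⟨12 / lam + ρ ^ 2 / c, by positivity, 0, fun γ hγ => ?_⟩
    obtain ⟨hγ12, hγ0, hργ⟩ := hγlarge γ hγ
    -- For ζ = 1 the exponent k^(1-ζ) equals 1, so with c₂ = 1 the second term is the constant C₁/2.
    -- It suffices that C₁ be twice the initial error, the product being at most 1.
    refine ⟨1, one_pos, fun h => absurd h (lt_irrefl _), fun α hα σ₀ hσ => ?_⟩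
    intro D
    refine ⟨2 * (2 * ‖m₀ - xstar‖ ^ 2 + 2 * (d * σ₀ ^ 2)), 0,
      fun h => absurd h (lt_irrefl _), fun n Ω _ P _ X ξ h k _ i => ?_⟩
    obtain ⟨hint, hle⟩ := hbound D rfl rfl rfl rfl rfl rfl rfl rfl hR h0 h1 hζ hγ12 hα m₀ σ₀ rfl
      hργ hσ n Ω P X ξ h k i
    refine ⟨hint, hle.trans ?_⟩
    have hQ1 : ∏ j ∈ Finset.range k, (1 - 3 / 4 * CBO.stepSize η₀ 1 (j + 1)) ≤ 1 :=
      Finset.prod_le_one (fun j _ => by linarith [CBO.stepSize_le_one h1 one_pos j])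
        fun j _ => by linarith [CBO.stepSize_pos (ζ := 1) h0 j]
    rw [sub_self, Real.rpow_zero, Real.rpow_one, zero_div, add_zero]
    have hfirst : (∏ j ∈ Finset.range k, (1 - 3 / 4 * CBO.stepSize η₀ 1 (j + 1)))
        * (2 * ‖m₀ - xstar‖ ^ 2 + 2 * (d * σ₀ ^ 2))
        ≤ 2 * (2 * ‖m₀ - xstar‖ ^ 2 + 2 * (d * σ₀ ^ 2)) / (1 + 1) := by
      have h2 : 2 * (2 * ‖m₀ - xstar‖ ^ 2 + 2 * (d * σ₀ ^ 2)) / (1 + 1)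
          = 1 * (2 * ‖m₀ - xstar‖ ^ 2 + 2 * (d * σ₀ ^ 2)) := by ring
      rw [h2]
      gcongr
    exact add_le_add_left (add_le_add_right hfirst _) _
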